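/- Let $d\ge 1$ and fix a radial $\chi\in C_c^\infty(B_1)$ on $\mathbb R^d$ with $\int\chi\,dx=1$ and $\int x^\alpha\chi(x)\,dx=0$ for $1\le|\alpha|\le 3$. There are a constant $c_d>0$ and constants $C_{j,\alpha,\beta}$, depending only on $d$, $\chi$ (and on $j,\alpha,\beta$), such that the following holds. Let ${\rm g}$ be a Riemannian metric on $\mathbb R^d$ whose first and second weak derivatives are locally integrable functions and which satisfies $$\sup_{ijkl}\|{\rm R}_{ijkl}\|_{L^\infty}+\sup_{ij}\|{\rm g}_{ij}-\delta_{ij}\|_{\mathrm{Lip}}+\sup_{ijlm}\|\partial_{x_l}\partial_{x_m}{\rm g}_{ij}\|_{BMO}\le c_d ,$$ where ${\rm R}_{ijkl}$ is the Riemann curvature tensor of ${\rm g}$ and $\|f\|_{\mathrm{Lip}}$ is the sum of $\sup|f|$ and the best Lipschitz constant of $f$. For an integer $k\ge 1$ put $$({\rm g}_k)^{ij}(x)=2^{kd/2}\int\chi\bigl(2^{k/2}(x-y)\bigr)\,{\rm g}^{ij}(y)\,dy,\qquad p_k(x,\xi)=\Bigl(\sum_{i,j}({\rm g}_k)^{ij}(x)\,\xi_i\xi_j\Bigr)^{1/2}.$$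 Then there is a unique function $\varphi_k(t,x,\eta)$, $0\le t\le 1$, $x\in\mathbb R^d$, $\eta\in\mathbb R^d\setminus\{0\}$, which for each $\eta$ is $C^1$ in $(t,x)$ and solves the eikonal equation $$\partial_t\varphi_k(t,x,\eta)=-p_k\bigl(x,\nabla_x\varphi_k(t,x,\eta)\bigr),\qquad \varphi_k(0,x,\eta)=\langle x,\eta\rangle .$$ For each $t\in[0,1]$ it is $C^\infty$ in $(x,\eta)$, and for all integers $j\ge 0$, all multi-indices $\alpha,\beta$ with $|\alpha|\ge 2$ or $|\beta|\ge 2$, all $x$ and all $\eta\ne 0$: if $2^{-k}\le t\le 1$, then $$\bigl|\langle\eta,\partial_\eta\rangle^j\partial_x^\beta\partial_\eta^\alpha\varphi_k(t,x,\eta)\bigr|\le C_{j,\alpha,\beta}\,\bigl(t^{1/2}2^{k/2}\bigr)^{|\alpha|}\,2^{\frac k2(|\beta|-2)}\,|\eta|^{1-|\alpha|},$$ and if $0\le t\le 2^{-k}$, then $$\bigl|\langle\eta,\partial_\eta\rangle^j\partial_x^\beta\partial_\eta^\alpha\varphi_k(t,x,\eta)\bigr|\le C_{j,\alpha,\beta}\,2^{\frac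 k2(|\beta|-2)}\,|\eta|^{1-|\alpha|}.$$ -/

import Mathlib

open scoped ContDiff
open MeasureTheory

noncomputable section

namespace EikonalBounds

/-- Euclidean space of dimension `d`. -/
abbrev E (d : ℕ) : Type := EuclideanSpace ℝ (Fin d)

/-- The `i`-th standard basis vector. -/
def e {d : ℕ} (i : Fin d) : E d := EuclideanSpace.single i (1 : ℝ)

/-! ### Norms -/

/-- The norm `‖f‖_Lip = sup |f| + (best Lipschitz constant of f)`, with values in `[0, ∞]`. -/
def lipNorm {d : ℕ} (f : E d → ℝ) : ENNReal :=
  (⨆ x, ‖f x‖ₑ) + ⨆ (x : E d) (y : E d), edist (f x) (f y) / edist x y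

/-- The seminorm of bounded mean oscillation: the supremum over all balls `B` of the mean over
`B` of `|f - f_B|`, where `f_B` is the mean of `f` over `B`. -/
def bmoNorm {d : ℕ} (f : E d → ℝ) : ENNReal :=
  ⨆ (x : E d) (r : ℝ) (_ : 0 < r),
    ⨍⁻ y in Metric.ball x r, ‖f y - ⨍ z in Metric.ball x r, f z ∂volume‖ₑ ∂volume

/-! ### Metrics of bounded curvature -/

/-- `h` is locally integrable and is the weak (distributional) derivative `∂f/∂x_m`. -/
def HasWeakPartial {d : ℕ} (m : Fin d) (f h : E d → ℝ) : Prop :=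
  LocallyIntegrable h volume ∧
    ∀ ψ : E d → ℝ, ContDiff ℝ ∞ ψ → HasCompactSupport ψ →
      ∫ x, f x * fderiv ℝ ψ x (e m) = - ∫ x, h x * ψ x

/-- Christoffel symbols `Γ^m_{ij} = ½ ∑_l g^{ml} (∂_i g_{jl} + ∂_j g_{il} - ∂_l g_{ij})` of a
metric with values `g` (a matrix) and first derivatives `dg l i j = ∂_l g_{ij}` at a point. -/
def christoffel {d : ℕ} (g : Matrix (Fin d) (Fin d) ℝ) (dg : Fin d → Fin d → Fin d → ℝ)
    (m i j : Fin d) : ℝ :=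
  (1 / 2) * ∑ l, g⁻¹ m l * (dg i j l + dg j i l - dg l i j)

/-- The Riemann curvature components `R_{ijkl}` of a metric with values `g`, first derivatives
`dg l i j = ∂_l g_{ij}` and second derivatives `ddg l m i j = ∂_l ∂_m g_{ij}` at a point:
`½ (∂_j∂_l g_{ik} + ∂_i∂_k g_{jl} - ∂_j∂_k g_{il} - ∂_i∂_l g_{jk})
  + ∑ g_{mn} (Γ^m_{jl} Γ^n_{ik} - Γ^m_{jk} Γ^n_{il})`. -/
def riemann {d : ℕ} (g : Matrix (Fin d) (Fin d) ℝ) (dg : Fin d → Fin d → Fin d → ℝ)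
    (ddg : Fin d → Fin d → Fin d → Fin d → ℝ) (i j k l : Fin d) : ℝ :=
  (1 / 2) * (ddg j l i k + ddg i k j l - ddg j k i l - ddg i l j k)
    + ∑ m, ∑ n, g m n *
        (christoffel g dg m j l * christoffel g dg n i k
          - christoffel g dg m j k * christoffel g dg n i l)

/-- `g` is a Riemannian metric on `ℝ^d` whose first and second weak derivatives are functions and
`sup ‖R_{ijkl}‖_{L^∞} + sup ‖g_{ij} - δ_{ij}‖_Lip + sup ‖∂²g_{ij}‖_BMO ≤ c`. -/
def IsSmallMetric {d : ℕ} (c : ℝ) (g : E d → Matrix (Fin d) (Fin d) ℝ) : Prop :=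
  (∀ x, (g x).PosDef) ∧
  ∃ (dg : Fin d → Fin d → Fin d → E d → ℝ) (ddg : Fin d → Fin d → Fin d → Fin d → E d → ℝ),
    (∀ m i j, HasWeakPartial m (fun x => g x i j) (dg m i j)) ∧
    (∀ l m i j, HasWeakPartial l (dg m i j) (ddg l m i j)) ∧
    (⨆ (i : Fin d) (j : Fin d) (k : Fin d) (l : Fin d),
        eLpNorm (fun x => riemann (g x) (fun a b c => dg a b c x)
          (fun a b c d' => ddg a b c d' x) i j k l) ⊤ volume)
      + (⨆ (i : Fin d) (j : Fin d),
          lipNorm (fun x => g x i j - (1 : Matrix (Fin d) (Fin d) ℝ) i j))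
      + (⨆ (l : Fin d) (m : Fin d) (i : Fin d) (j : Fin d), bmoNorm (ddg l m i j))
      ≤ ENNReal.ofReal c

/-! ### Mollification -/

/-- A radial function `χ ∈ C_c^∞(B_1)` with integral one and vanishing moments of the
orders one, two and three. -/
structure IsMollifier {d : ℕ} (χ : E d → ℝ) : Prop where
  smooth : ContDiff ℝ ∞ χ
  support : tsupport χ ⊆ Metric.ball 0 1
  radial : ∀ x y, ‖x‖ = ‖y‖ → χ x = χ y
  integral_one : ∫ x, χ x = 1
  moments : ∀ α : Fin d → ℕ, 1 ≤ ∑ i, α i → ∑ i, α i ≤ 3 → ∫ x, (∏ i, x i ^ α i) * χ x = 0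

/-- The inverse metric `(g_k)^{ij}(x) = 2^{kd/2} ∫ χ(2^{k/2}(x - y)) g^{ij}(y) dy`. -/
def mollifiedInverse {d : ℕ} (χ : E d → ℝ) (g : E d → Matrix (Fin d) (Fin d) ℝ) (k : ℕ)
    (x : E d) (i j : Fin d) : ℝ :=
  (2 : ℝ) ^ ((k : ℝ) * d / 2) * ∫ y, χ ((2 : ℝ) ^ ((k : ℝ) / 2) • (x - y)) * (g y)⁻¹ i j

/-- The symbol `p_k(x, ξ) = (∑_{ij} (g_k)^{ij}(x) ξ_i ξ_j)^{1/2}`. -/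
def symbol {d : ℕ} (χ : E d → ℝ) (g : E d → Matrix (Fin d) (Fin d) ℝ) (k : ℕ)
    (x ξ : E d) : ℝ :=
  Real.sqrt (∑ i, ∑ j, mollifiedInverse χ g k x i j * ξ i * ξ j)

/-! ### The eikonal equation -/

/-- `φ(t, x, η)`, `0 ≤ t ≤ 1`, `η ≠ 0`, is a classical (`C¹` in `(t, x)` for each `η`) solution of
`∂_t φ = -p(x, ∇_x φ)`, `φ(0, x, η) = ⟨x, η⟩`. -/
structure IsEikonalSolution {d : ℕ} (p : E d → E d → ℝ) (φ : ℝ → E d → E d → ℝ) : Prop where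
  contDiffOn : ∀ η, η ≠ 0 →
    ContDiffOn ℝ 1 (fun z : ℝ × E d => φ z.1 z.2 η) (Set.Icc 0 1 ×ˢ Set.univ)
  equation : ∀ η, η ≠ 0 → ∀ t ∈ Set.Icc (0 : ℝ) 1, ∀ x,
    HasDerivWithinAt (fun s => φ s x η) (-p x (gradient (fun x' => φ t x' η) x)) (Set.Icc 0 1) t
  initial : ∀ η, η ≠ 0 → ∀ x, φ 0 x η = inner ℝ x η

/-! ### Derivatives of functions of `(x, η)` -/

/-- `∂F/∂x_i`. -/
def partialX {d : ℕ} (i : Fin d) (F : E d → E d → ℝ) : E d → E d → ℝ :=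
  fun x η => fderiv ℝ (fun x' => F x' η) x (e i)

/-- `∂F/∂η_i`. -/
def partialEta {d : ℕ} (i : Fin d) (F : E d → E d → ℝ) : E d → E d → ℝ :=
  fun x η => fderiv ℝ (fun η' => F x η') η (e i)

/-- `∂_x^β F` for a multi-index `β`. -/
def multiX {d : ℕ} (β : Fin d → ℕ) (F : E d → E d → ℝ) : E d → E d → ℝ :=
  (List.finRange d).foldr (fun i G => (partialX i)^[β i] G) F

/-- `∂_η^α F` for a multi-index `α`. -/
def multiEta {d : ℕ} (α : Fin d → ℕ) (F : E d → E d → ℝ) : E d → E d → ℝ :=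
  (List.finRange d).foldr (fun i G => (partialEta i)^[α i] G) F

/-- The radial derivative `⟨η, ∂_η⟩ F = ∑_i η_i ∂F/∂η_i`. -/
def radialEta {d : ℕ} (F : E d → E d → ℝ) : E d → E d → ℝ :=
  fun x η => ∑ i, η i * partialEta i F x η

end EikonalBounds

end

/-! Write r = 2^(-k/2). The solution is built by the method of characteristics for the smooth
Hamiltonian p_k, and the point is that no constant may depend on k. The obstacle is the Hessian of
p_k in x: it contains regularized second derivatives of the metric, which are controlled in BMO only
and hence not bounded uniformly in k. The bound on the curvature makes up for this. Up to a
curvature contraction and products of first derivatives, that Hessian is the derivative along the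
Hamiltonian flow of a small matrix M made of first derivatives of the metric
(`curvature_hamiltonian_le`). For a variation (u, v) of a trajectory, the corrected pair (u, v + M
u) therefore solves a linear equation with bounded coefficients, and Grönwall bounds the
differential of the flow uniformly in k (`norm_variation_le`).

Since the data are small, the map from the starting point y to the position x(t, y, η) differs from
the identity by a map with Lipschitz constant 1/2. It is a bijection of the whole space, so no
caustic forms up to time one. Because p_k is homogeneous of degree one, the action vanishes along
trajectories and the phase is simply ⟨y, η⟩; its gradients in x and η are the current covector and
the starting point (`fderiv_phase`). The bounds on the differential of the flow are thus bounds on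
the Hessian of the phase, which settles |α| + |β| = 2.

Higher derivatives are propagated along characteristics (`norm_iteratedFDeriv_step`) in the
variables x = r x', η = (r/τ) η', for times up to τ². Derivatives of the coefficients of order three
and more are mollifications of BMO functions with kernels of mean zero, so they have the scaled size
r². In the Faà di Bruno formula the term with the first derivative of p_k disappears because one
differentiates along a characteristic, and the Hessian of p_k never meets two position vectors,
because derivatives of order at least two of (x, ∇φ) have no position component. What remains is
linear in the derivative of top order, with rate of size τ⁻², and Grönwall over time τ² costs only a
constant. Taking τ = √t, or τ = r for t ≤ r², gives the two regimes of the estimate.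

Homogeneity in η reduces all bounds to |η| = 1 and turns each radial derivative into multiplication
by 1 - |α| (`abs_multi_le`). Uniqueness is a comparison principle with finite speed of propagation
(`eikonal_le`); it also identifies the local phase with its homogeneous extension
(`solution_eq_phase`). -/

namespace EikonalBounds

/-! ### Flows of smooth vector fields -/

section Flow

open Set Filter Topology

variable {F : Type} [NormedAddCommGroup F] [NormedSpace ℝ F]

/-- `α` is an integral curve of `V` over the time interval `[0, 1]` which starts at `z`. -/
structure IsUnitCurve (V : F → F) (z : F) (α : ℝ → F) : Prop where
  init : α 0 = z
  deriv : ∀ t ∈ Icc (0 : ℝ) 1, HasDerivWithinAt α (V (α t)) (Icc 0 1) t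

open Classical in
/-- The map which sends `z` to the value at time one of the integral curve of `V` from `z`. -/
noncomputable def timeOne (V : F → F) (z : F) : F :=
  if h : ∃ α, IsUnitCurve V z α then h.choose 1 else z

/-- A Grönwall inequality on the unit interval. -/
theorem norm_le_of_deriv_le {f f' : ℝ → F} {δ K ε : ℝ} (hK : 0 ≤ K) (hε : 0 ≤ ε) (hδ : 0 ≤ δ)
    (hf : ∀ t ∈ Icc (0 : ℝ) 1, HasDerivWithinAt f (f' t) (Icc 0 1) t) (h0 : ‖f 0‖ ≤ δ)
    (hb : ∀ t ∈ Icc (0 : ℝ) 1, ‖f' t‖ ≤ K * ‖f t‖ + ε) :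
    ∀ t ∈ Icc (0 : ℝ) 1, ‖f t‖ ≤ (δ + ε) * Real.exp (K + 1) := by
  intro t ht
  -- The rate is enlarged from `K` to `K + 1` to make it nonzero, so that `gronwallBound` has its
  -- closed form with a division by the rate.
  have h1 := norm_le_gronwallBound_of_norm_deriv_right_le (f := f) (f' := f') (δ := δ)
    (K := K + 1) (ε := ε) (a := 0) (b := 1)
    (fun s hs => (hf s hs).continuousWithinAt)
    (fun s hs => (hf s ⟨hs.1, hs.2.le⟩).mono_of_mem_nhdsWithin (Icc_mem_nhdsGE_of_mem hs)) h0
    (fun s hs => (hb s ⟨hs.1, hs.2.le⟩).trans (by nlinarith [norm_nonneg (f s)])) t ht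
  refine h1.trans ?_
  rw [gronwallBound_of_K_ne_0 (by positivity), sub_zero]
  have e1 : Real.exp ((K + 1) * t) ≤ Real.exp (K + 1) := by
    apply Real.exp_le_exp.2; nlinarith [ht.1, ht.2]
  have e2 : ε / (K + 1) ≤ ε := div_le_self hε (by linarith)
  have e3 : 1 ≤ Real.exp ((K + 1) * t) := Real.one_le_exp (by nlinarith [ht.1])
  have e4 : 0 ≤ ε / (K + 1) := by positivity
  nlinarith [mul_le_mul e2 (sub_le_self (Real.exp ((K + 1) * t)) zero_le_one)
    (by linarith) hε, mul_le_mul_of_nonneg_left e1 hδ, mul_le_mul_of_nonneg_left e1 hε]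

theorem IsUnitCurve.dist_le {V : F → F} {K : NNReal} (hV : LipschitzWith K V) {z z' : F}
    {α β : ℝ → F} (hα : IsUnitCurve V z α) (hβ : IsUnitCurve V z' β) :
    ∀ t ∈ Icc (0 : ℝ) 1, dist (α t) (β t) ≤ dist z z' * Real.exp K := by
  intro t ht
  have h := dist_le_of_trajectories_ODE (v := fun _ => V) (K := K) (f := α) (g := β) (a := 0)
    (b := 1) (δ := dist z z') (fun _ => hV)
    (fun s hs => (hα.deriv s hs).continuousWithinAt)
    (fun s hs => (hα.deriv s ⟨hs.1, hs.2.le⟩).mono_of_mem_nhdsWithin (Icc_mem_nhdsGE_of_mem hs))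
    (fun s hs => (hβ.deriv s hs).continuousWithinAt)
    (fun s hs => (hβ.deriv s ⟨hs.1, hs.2.le⟩).mono_of_mem_nhdsWithin (Icc_mem_nhdsGE_of_mem hs))
    (by rw [hα.init, hβ.init]) t ht
  refine h.trans (mul_le_mul_of_nonneg_left (Real.exp_le_exp.2 ?_) dist_nonneg)
  nlinarith [ht.1, ht.2, K.coe_nonneg]

theorem IsUnitCurve.unique {V : F → F} {K : NNReal} (hV : LipschitzWith K V) {z : F}
    {α β : ℝ → F} (hα : IsUnitCurve V z α) (hβ : IsUnitCurve V z β) :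
    ∀ t ∈ Icc (0 : ℝ) 1, α t = β t := fun t ht => by
  simpa using hα.dist_le hV hβ t ht

theorem timeOne_eq {V : F → F} {K : NNReal} (hV : LipschitzWith K V) {z : F}
    {α : ℝ → F} (hα : IsUnitCurve V z α) : timeOne V z = α 1 := by
  have h : ∃ α, IsUnitCurve V z α := ⟨α, hα⟩
  rw [timeOne, dif_pos h]
  exact h.choose_spec.unique hV hα 1 (by simp)

/-- The global speed bound `B` keeps a curve inside the ball of radius `B * (b - a)`, so a single
application of Picard–Lindelöf covers the whole interval and no continuation argument is needed. -/
theorem exists_curve [CompleteSpace F] {V : F → F} {K : NNReal} (hV : LipschitzWith K V) {B : ℝ}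
    (hB : ∀ x, ‖V x‖ ≤ B) (z : F) {a b : ℝ} (ha : a ≤ 0) (hb : 0 ≤ b) :
    ∃ α : ℝ → F, α 0 = z ∧ ∀ t ∈ Icc a b, HasDerivWithinAt α (V (α t)) (Icc a b) t := by
  have hB0 : 0 ≤ B := (norm_nonneg _).trans (hB z)
  have := IsPicardLindelof.of_time_independent (f := V) (tmin := a) (tmax := b)
    (t₀ := ⟨0, ha, hb⟩) (x₀ := z) (a := ⟨B * (b - a), mul_nonneg hB0 (by linarith)⟩) (r := 0)
    (L := ⟨B, hB0⟩) (K := K) (fun x _ => hB x) hV.lipschitzOnWith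
    (by
      simp only [NNReal.coe_zero, sub_zero, zero_sub]
      exact mul_le_mul_of_nonneg_left (max_le (by linarith) (by linarith)) hB0)
  exact this.exists_eq_forall_mem_Icc_hasDerivWithinAt₀

theorem exists_unitCurve [CompleteSpace F] {V : F → F} {K : NNReal} (hV : LipschitzWith K V)
    {B : ℝ} (hB : ∀ x, ‖V x‖ ≤ B) (z : F) : ∃ α, IsUnitCurve V z α := by
  obtain ⟨α, h0, h1⟩ := exists_curve hV hB z le_rfl zero_le_one
  exact ⟨α, h0, h1⟩

/-- First order Taylor estimate for a map with Lipschitz derivative. -/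
theorem norm_sub_sub_fderiv_le {G : Type*} [NormedAddCommGroup G] [NormedSpace ℝ G]
    {f : F → G} (hf : Differentiable ℝ f) {L : NNReal}
    (hL : LipschitzWith L (fderiv ℝ f)) (x y : F) :
    ‖f y - f x - fderiv ℝ f x (y - x)‖ ≤ L * ‖y - x‖ ^ 2 := by
  have := (convex_closedBall x ‖y - x‖).norm_image_sub_le_of_norm_fderiv_le' (𝕜 := ℝ) (f := f)
    (φ := fderiv ℝ f x) (C := L * ‖y - x‖) (x := x) (y := y) (fun z _ => hf z)
    (fun z hz => by
      rw [← dist_eq_norm]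
      refine (hL.dist_le_mul z x).trans ?_
      gcongr
      simpa [dist_eq_norm] using hz)
    (by simp) (by simp [dist_eq_norm])
  calc _ ≤ _ := this
    _ = _ := by ring

variable [FiniteDimensional ℝ F]

/-- The derivative solves the variational equation, hence is a component of the time one map of the
field `(V x, DV x ∘ A)` on `F × (F →L[ℝ] F)`. That field is cut off in `A`, which makes it again
smooth with compact support, so that the statement can be applied to `W` in turn. -/
theorem hasFDerivAt_timeOne {V : F → F} (hV : ContDiff ℝ ∞ V) (hc : HasCompactSupport V) :
    ∃ W : F × (F →L[ℝ] F) → F × (F →L[ℝ] F), ContDiff ℝ ∞ W ∧ HasCompactSupport W ∧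
      ∀ z, HasFDerivAt (timeOne V) (timeOne W (z, ContinuousLinearMap.id ℝ F)).2 z := by
  obtain ⟨K, hK⟩ := hV.lipschitzWith_of_hasCompactSupport hc (by simp)
  have hV' : ContDiff ℝ ∞ (fderiv ℝ V) := hV.fderiv_right (by simp)
  obtain ⟨L, hL⟩ := hV'.lipschitzWith_of_hasCompactSupport (hc.fderiv ℝ) (by simp)
  obtain ⟨B, hB⟩ := hc.exists_bound_of_continuous hV.continuous
  have hd : ∀ x, ‖fderiv ℝ V x‖ ≤ K := fun x => norm_fderiv_le_of_lipschitz ℝ hK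
  -- The inner radius exceeds `Real.exp (K + 1)`, the Grönwall bound for solutions of the
  -- variational equation.
  let θ : ContDiffBump (0 : F →L[ℝ] F) :=
    ⟨Real.exp (K + 1) + 1, Real.exp (K + 1) + 2, by positivity, by linarith⟩
  let W : F × (F →L[ℝ] F) → F × (F →L[ℝ] F) :=
    fun p => (θ p.2 • V p.1, θ p.2 • (fderiv ℝ V p.1).comp p.2)
  have hθ : ContDiff ℝ ∞ (fun p : F × (F →L[ℝ] F) => θ p.2) := θ.contDiff.comp contDiff_snd
  have hWs : ContDiff ℝ ∞ W := by
    refine (hθ.smul (hV.comp contDiff_fst)).prodMk (hθ.smul ?_)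
    exact (hV'.comp contDiff_fst).clm_comp contDiff_snd
  have hWc : HasCompactSupport W := by
    refine HasCompactSupport.intro (hc.isCompact.prod (isCompact_closedBall 0 θ.rOut)) ?_
    rintro ⟨x, A⟩ hx
    by_cases hA : A ∈ Metric.closedBall 0 θ.rOut
    · have hx' : x ∉ tsupport V := fun h => hx ⟨h, hA⟩
      have h2 : fderiv ℝ V x = 0 := by
        by_contra h; exact hx' (support_fderiv_subset ℝ h)
      simp [W, image_eq_zero_of_notMem_tsupport hx', h2]
    · have : θ A = 0 := θ.zero_of_le_dist (by
        simpa using (not_le.1 (fun h => hA (by simpa [Metric.mem_closedBall] using h))).le)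
      simp [W, this]
  obtain ⟨K', hK'⟩ := hWs.lipschitzWith_of_hasCompactSupport hWc (by simp)
  obtain ⟨B', hB'⟩ := hWc.exists_bound_of_continuous hWs.continuous
  refine ⟨W, hWs, hWc, fun z => ?_⟩
  obtain ⟨α, hα⟩ := exists_unitCurve hK' hB' (z, ContinuousLinearMap.id ℝ F)
  have hA' : ∀ t ∈ Icc (0 : ℝ) 1, HasDerivWithinAt (fun t => (α t).2)
      (θ (α t).2 • (fderiv ℝ V (α t).1).comp (α t).2) (Icc 0 1) t := fun t ht =>
    (hα.deriv t ht).snd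
  -- This bound uses only `0 ≤ θ ≤ 1`, so it is available before the cutoff is known to be inactive;
  -- `hθ1` then removes the cutoff along the curve.
  have hAn : ∀ t ∈ Icc (0 : ℝ) 1, ‖(α t).2‖ ≤ Real.exp (K + 1) := by
    intro t ht
    have := norm_le_of_deriv_le (δ := 1) (ε := 0) K.2 le_rfl zero_le_one hA'
      (by rw [hα.init]; exact ContinuousLinearMap.norm_id_le)
      (fun s hs => by
        rw [norm_smul, add_zero]
        have h1 : ‖θ (α s).2‖ ≤ 1 := by
          rw [Real.norm_of_nonneg θ.nonneg]; exact θ.le_one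
        calc _ ≤ 1 * (K * ‖(α s).2‖) := by
              gcongr
              exact (ContinuousLinearMap.opNorm_comp_le _ _).trans (by gcongr; exact hd _)
          _ = _ := by rw [one_mul]; rfl) t ht
    simpa using this
  have hθ1 : ∀ t ∈ Icc (0 : ℝ) 1, θ (α t).2 = 1 := fun t ht =>
    θ.one_of_mem_closedBall (by
      have := hAn t ht
      simp only [Metric.mem_closedBall, dist_zero_right]
      exact this.trans (by simp [θ]))
  have hx : IsUnitCurve V z (fun t => (α t).1) := ⟨by simp [hα.init], fun t ht => by
    have : HasDerivWithinAt (fun t => (α t).1) (W (α t)).1 (Icc 0 1) t := (hα.deriv t ht).fst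
    simpa [W, hθ1 t ht] using this⟩
  have hA : ∀ t ∈ Icc (0 : ℝ) 1, HasDerivWithinAt (fun t => (α t).2)
      ((fderiv ℝ V (α t).1).comp (α t).2) (Icc 0 1) t := fun t ht => by
    simpa [hθ1 t ht] using hA' t ht
  rw [timeOne_eq hK' hα, hasFDerivAt_iff_isLittleO_nhds_zero]
  refine Asymptotics.IsBigO.trans_isLittleO (g := fun h : F => ‖h‖ ^ 2) ?_
    (Asymptotics.isLittleO_norm_pow_id one_lt_two)
  refine Asymptotics.IsBigO.of_bound
    ((L * Real.exp K ^ 2) * Real.exp (K + 1)) (Eventually.of_forall fun h => ?_)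
  obtain ⟨β, hβ⟩ := exists_unitCurve hK hB (z + h)
  rw [timeOne_eq hK hβ, timeOne_eq hK hx]
  -- The error of the linearization starts at zero and satisfies the linearized equation up to a
  -- Taylor remainder quadratic in `h`, so Grönwall keeps it quadratic.
  have key := norm_le_of_deriv_le (f := fun t => β t - (α t).1 - (α t).2 h)
    (f' := fun t => V (β t) - V (α t).1 - (fderiv ℝ V (α t).1) ((α t).2 h))
    (δ := 0) (K := K) (ε := L * (‖h‖ * Real.exp K) ^ 2) K.2 (by positivity) le_rfl
    (fun t ht => by
      refine ((hβ.deriv t ht).sub (hx.deriv t ht)).sub ?_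
      exact (hA t ht).clm_apply (hasDerivWithinAt_const t (Icc 0 1) h) |>.congr_deriv (by simp))
    (by simp [hβ.init, hα.init])
    (fun t ht => by
      have h1 := norm_sub_sub_fderiv_le (hV.differentiable (by simp)) hL (α t).1 (β t)
      have h2 : ‖β t - (α t).1‖ ≤ ‖h‖ * Real.exp K := by
        have := hβ.dist_le hK hx t ht
        simpa [dist_eq_norm] using this
      have h3 : V (β t) - V (α t).1 - (fderiv ℝ V (α t).1) ((α t).2 h)
          = (fderiv ℝ V (α t).1) (β t - (α t).1 - (α t).2 h)
            + (V (β t) - V (α t).1 - fderiv ℝ V (α t).1 (β t - (α t).1)) := by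
        simp only [map_sub]; abel
      rw [h3]
      refine (norm_add_le _ _).trans (add_le_add ?_ (h1.trans (by gcongr)))
      exact ((fderiv ℝ V (α t).1).le_opNorm _).trans (by gcongr; exact hd _)) 1 (by simp)
  refine key.trans (le_of_eq ?_)
  rw [norm_pow, norm_norm]; ring

/-- The space is quantified inside the induction on `n`, because the derivative of a time one map is
a time one map on a larger space. -/
theorem contDiff_timeOne_nat (n : ℕ) : ∀ {F : Type} [NormedAddCommGroup F] [NormedSpace ℝ F]
    [FiniteDimensional ℝ F] {V : F → F}, ContDiff ℝ ∞ V → HasCompactSupport V →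
    ContDiff ℝ n (timeOne V) := by
  induction n with
  | zero =>
    intro F _ _ _ V hV hc
    obtain ⟨W, -, -, h⟩ := hasFDerivAt_timeOne hV hc
    exact contDiff_zero.2 (continuous_iff_continuousAt.2 fun z => (h z).continuousAt)
  | succ n ih =>
    intro F _ _ _ V hV hc
    obtain ⟨W, hW, hWc, h⟩ := hasFDerivAt_timeOne hV hc
    rw [Nat.cast_add, Nat.cast_one, contDiff_succ_iff_hasFDerivAt]
    exact ⟨_, (contDiff_snd.comp ((ih hW hWc).comp (contDiff_id.prodMk contDiff_const))), h⟩

theorem contDiff_timeOne {V : F → F} (hV : ContDiff ℝ ∞ V) (hc : HasCompactSupport V) :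
    ContDiff ℝ ∞ (timeOne V) :=
  contDiff_infty.2 fun n => contDiff_timeOne_nat n hV hc

/-- The flow of the vector field `V`. -/
noncomputable def flow (V : F → F) (t : ℝ) (z : F) : F := timeOne (fun x => t • V x) z

omit [FiniteDimensional ℝ F] in
theorem isUnitCurve_scale {V : F → F} {z : F} {α : ℝ → F} {T : ℝ} (h0 : α 0 = z)
    (h1 : ∀ t ∈ Icc (-T) T, HasDerivWithinAt α (V (α t)) (Icc (-T) T) t) {t : ℝ} (ht : |t| ≤ T) :
    IsUnitCurve (fun x => t • V x) z (fun s => α (s * t)) := by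
  refine ⟨by simpa using h0, fun s hs => ?_⟩
  have hm : ∀ s ∈ Icc (0 : ℝ) 1, s * t ∈ Icc (-T) T := fun s hs => by
    rw [mem_Icc, ← abs_le, abs_mul, abs_of_nonneg hs.1]
    nlinarith [abs_nonneg t, hs.2]
  have h2 : HasDerivWithinAt (fun s : ℝ => s * t) t (Icc 0 1) s := by
    simpa using (hasDerivAt_id s).mul_const t |>.hasDerivWithinAt
  exact (h1 (s * t) (hm s hs)).scomp s h2 hm

omit [FiniteDimensional ℝ F] in
theorem lipschitz_smul_field {V : F → F} {K : NNReal} (hV : LipschitzWith K V) (t : ℝ) :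
    LipschitzWith (‖t‖₊ * K) (fun x => t • V x) :=
  LipschitzWith.of_dist_le_mul fun x y => by
    rw [dist_smul₀, NNReal.coe_mul, coe_nnnorm, mul_assoc]
    gcongr
    exact hV.dist_le_mul x y

omit [FiniteDimensional ℝ F] in
theorem flow_zero (V : F → F) (z : F) :
    flow V 0 z = z := by
  have : IsUnitCurve (fun x => (0 : ℝ) • V x) z (fun _ => z) :=
    ⟨rfl, fun t _ => by simpa using hasDerivWithinAt_const t (Icc (0 : ℝ) 1) z⟩
  exact timeOne_eq (K := 0) (by simp) this

/-- The flow is defined through a different field `s • V` for each time `s`. Rescaling time shows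
that for all `s` near `t` its values lie on one integral curve of `V` over a symmetric interval. -/
theorem hasDerivAt_flow {V : F → F} {K : NNReal} (hV : LipschitzWith K V) {B : ℝ}
    (hB : ∀ x, ‖V x‖ ≤ B) (t : ℝ) (z : F) :
    HasDerivAt (fun s => flow V s z) (V (flow V t z)) t := by
  have hT : 0 ≤ |t| + 1 := by positivity
  obtain ⟨α, h0, h1⟩ := exists_curve hV hB z (neg_nonpos.2 hT) hT
  have h2 : ∀ s, |s| ≤ |t| + 1 → flow V s z = α s := fun s hs => by
    have := timeOne_eq (lipschitz_smul_field hV s) (isUnitCurve_scale h0 h1 hs)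
    simpa [flow] using this
  have h3 : Icc (-(|t| + 1)) (|t| + 1) ∈ 𝓝 t := by
    apply Icc_mem_nhds <;> [have := neg_abs_le t; have := le_abs_self t] <;> linarith
  have h4 := (h1 t (mem_of_mem_nhds h3)).hasDerivAt h3
  rw [h2 t (by linarith)]
  refine h4.congr_of_eventuallyEq ?_
  filter_upwards [h3] with s hs using h2 s (abs_le.2 hs)

/-- Time becomes part of the state: the field `(0, t • V z)` on `ℝ × F` has the flow as component of
its time one map. As `V` is only bounded, the field is cut off around `(t₀, z₀)`; trajectories
starting within distance one move at most `(|t₀| + 1) * B` and stay where the cutoff is one. -/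
theorem contDiff_flow {V : F → F} (hs : ContDiff ℝ ∞ V) {K : NNReal} (hV : LipschitzWith K V)
    {B : ℝ} (hB : ∀ x, ‖V x‖ ≤ B) : ContDiff ℝ ∞ (fun p : ℝ × F => flow V p.1 p.2) := by
  rw [contDiff_iff_contDiffAt]
  rintro ⟨t₀, z₀⟩
  have hB0 : 0 ≤ B := (norm_nonneg _).trans (hB z₀)
  let b : ContDiffBump ((t₀, z₀) : ℝ × F) :=
    ⟨(|t₀| + 1) * B + 1, (|t₀| + 1) * B + 2, by positivity, by linarith⟩
  let U : ℝ × F → ℝ × F := fun p => (0, b p • p.1 • V p.2)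
  have hUs : ContDiff ℝ ∞ U :=
    contDiff_const.prodMk (b.contDiff.smul (contDiff_fst.smul (hs.comp contDiff_snd)))
  have hUc : HasCompactSupport U := by
    refine HasCompactSupport.intro (isCompact_closedBall (t₀, z₀) b.rOut) fun p hp => ?_
    have : b p = 0 := b.zero_of_le_dist (not_le.1 fun h => hp h).le
    simp [U, this]
  obtain ⟨K', hK'⟩ := hUs.lipschitzWith_of_hasCompactSupport hUc (by simp)
  have h1 := (contDiff_timeOne hUs hUc).contDiffAt (x := (t₀, z₀))
  refine (contDiffAt_snd.comp _ h1).congr_of_eventuallyEq ?_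
  filter_upwards [Metric.ball_mem_nhds (t₀, z₀) one_pos] with p hp
  obtain ⟨t, z⟩ := p
  have ht : |t - t₀| < 1 := by
    have := (max_lt_iff.1 (by simpa [Prod.dist_eq] using hp)).1
    rwa [← Real.dist_eq]
  have hz : dist z z₀ < 1 := (max_lt_iff.1 (by simpa [Prod.dist_eq] using hp)).2
  have htB : ∀ x, ‖t • V x‖ ≤ (|t₀| + 1) * B := fun x => by
    rw [norm_smul, Real.norm_eq_abs]
    have : |t| ≤ |t₀| + 1 := by
      have := abs_sub_abs_le_abs_sub t t₀; linarith
    exact mul_le_mul this (hB x) (norm_nonneg _) (by positivity)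
  obtain ⟨γ, hγ⟩ := exists_unitCurve (lipschitz_smul_field hV t) htB z
  have hγb : ∀ s ∈ Icc (0 : ℝ) 1, ‖γ s - z‖ ≤ (|t₀| + 1) * B := fun s hs => by
    have := norm_image_sub_le_of_norm_deriv_le_segment_01' (f := fun u => γ (u * s))
      (f' := fun u => s • t • V (γ (u * s))) (C := (|t₀| + 1) * B)
      (fun u hu => by
        have hm : MapsTo (fun u : ℝ => u * s) (Icc 0 1) (Icc 0 1) := fun u hu =>
          ⟨mul_nonneg hu.1 hs.1, mul_le_one₀ hu.2 hs.1 hs.2⟩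
        exact (hγ.deriv (u * s) (hm hu)).scomp u
          (by simpa using ((hasDerivAt_id u).mul_const s).hasDerivWithinAt) hm)
      (fun u hu => by
        rw [norm_smul, Real.norm_of_nonneg hs.1]
        have := htB (γ (u * s))
        nlinarith [norm_nonneg (t • V (γ (u * s))), hs.2])
    simpa [hγ.init] using this
  have hU : IsUnitCurve U (t, z) (fun s => (t, γ s)) := by
    refine ⟨by simp [hγ.init], fun s hs => ?_⟩
    have : b (t, γ s) = 1 := b.one_of_mem_closedBall (by
      rw [Metric.mem_closedBall, Prod.dist_eq]
      refine max_le ?_ ?_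
      · have : (0:ℝ) ≤ (|t₀| + 1) * B := by positivity
        rw [Real.dist_eq]; simp only [b]; linarith
      · have h1 := dist_triangle (γ s) z z₀
        have h2 := hγb s hs
        rw [← dist_eq_norm] at h2
        simp only [b]; linarith)
    simpa [U, this] using (hasDerivWithinAt_const s (Icc (0:ℝ) 1) t).prodMk (hγ.deriv s hs)
  simp only [Function.comp, timeOne_eq hK' hU, flow,
    timeOne_eq (lipschitz_smul_field hV t) hγ]

end Flow

end EikonalBounds

namespace EikonalBounds

/-! ### Iterated derivatives -/

section IteratedDerivatives

open Set Filter Topology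

theorem natCast_le_infty (n : ℕ) : (n : WithTop ℕ∞) ≤ ∞ := by exact_mod_cast le_top

theorem two_le_infty : (2 : WithTop ℕ∞) ≤ ∞ := by exact_mod_cast natCast_le_infty 2

variable {Z W G : Type} [NormedAddCommGroup Z] [NormedSpace ℝ Z] [NormedAddCommGroup W]
  [NormedSpace ℝ W] [NormedAddCommGroup G] [NormedSpace ℝ G]

theorem _root_.OrderedFinpartition.sum_partSize {n : ℕ} (c : OrderedFinpartition n) :
    ∑ i, c.partSize i = n := by
  simpa using Fintype.card_congr c.equivSigma

theorem _root_.OrderedFinpartition.partSize_add_le {n : ℕ} (c : OrderedFinpartition n)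
    {i j : Fin c.length} (h : i ≠ j) : c.partSize i + c.partSize j ≤ n := by
  rw [← Finset.sum_pair h]
  exact (Finset.sum_le_sum_of_subset (Finset.subset_univ _)).trans c.sum_partSize.le

/-- Bound for the Faà di Bruno formula, from bounds for each of its terms. -/
theorem norm_iteratedFDeriv_comp_le_card {g : W → G} {f : Z → W} {x : Z}
    (hg : ContDiffAt ℝ ∞ g (f x)) (hf : ContDiffAt ℝ ∞ f x) {n : ℕ} {B : ℝ}
    (hB : ∀ c : OrderedFinpartition n, ∃ K, 0 ≤ K ∧ K * ∏ i, ‖iteratedFDeriv ℝ (c.partSize i) f x‖ ≤ B ∧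
      ∀ v : Fin n → Z, ‖iteratedFDeriv ℝ c.length g (f x)
        (fun i => iteratedFDeriv ℝ (c.partSize i) f x (v ∘ c.emb i))‖ ≤
        K * ∏ i, ‖iteratedFDeriv ℝ (c.partSize i) f x (v ∘ c.emb i)‖) :
    ‖iteratedFDeriv ℝ n (g ∘ f) x‖ ≤ Fintype.card (OrderedFinpartition n) * B := by
  rw [iteratedFDeriv_comp hg hf (natCast_le_infty n), FormalMultilinearSeries.taylorComp]
  have hsum : ∑ _c : OrderedFinpartition n, B = Fintype.card (OrderedFinpartition n) * B := by simp
  rw [← hsum]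
  refine norm_sum_le_of_le Finset.univ fun c _ => ?_
  obtain ⟨K, hK, h1, h2⟩ := hB c
  refine le_trans ?_ h1
  refine ContinuousMultilinearMap.opNorm_le_bound (by positivity) fun v => ?_
  rw [mul_assoc, ← c.prod_sigma_eq_prod, ← Finset.prod_mul_distrib]
  refine (h2 v).trans (mul_le_mul_of_nonneg_left ?_ hK)
  exact Finset.prod_le_prod (fun _ _ => norm_nonneg _) fun i _ =>
      (iteratedFDeriv ℝ (c.partSize i) f x).le_opNorm _

/-- If the first two derivatives of `f` are of size `δ` and the higher ones of size `δ²`, then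
the derivatives of order at least three of `g ∘ f` are of size `δ²`. -/
theorem norm_iteratedFDeriv_comp_le_sq {g : W → G} {f : Z → W} {x : Z}
    (hg : ContDiffAt ℝ ∞ g (f x)) (hf : ContDiffAt ℝ ∞ f x) {n : ℕ} (hn : 3 ≤ n) {K B δ : ℝ}
    (hB : 1 ≤ B) (hδ : 0 ≤ δ) (hδ1 : δ ≤ 1)
    (hgK : ∀ m, m ≤ n → ‖iteratedFDeriv ℝ m g (f x)‖ ≤ K)
    (h1 : ∀ m, 1 ≤ m → m ≤ 2 → ‖iteratedFDeriv ℝ m f x‖ ≤ B * δ)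
    (h2 : ∀ m, 3 ≤ m → m ≤ n → ‖iteratedFDeriv ℝ m f x‖ ≤ B * δ ^ 2) :
    ‖iteratedFDeriv ℝ n (g ∘ f) x‖ ≤
      Fintype.card (OrderedFinpartition n) * (K * (B ^ n * δ ^ 2)) := by
  have hK : 0 ≤ K := (norm_nonneg _).trans (hgK 0 (by omega))
  have hδ2 : δ ^ 2 ≤ δ := by nlinarith
  refine norm_iteratedFDeriv_comp_le_card hg hf fun c => ⟨K, hK, ?_, fun v => ?_⟩
  · refine mul_le_mul_of_nonneg_left ?_ hK
    have hBn : B ^ c.length ≤ B ^ n := pow_le_pow_right₀ hB c.length_le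
    -- A partition with one block contributes the derivative of `f` of order `n ≥ 3`, already of
    -- size `δ ^ 2`. With two or more blocks there are at least two factors, each of size `δ`.
    rcases Nat.lt_or_ge c.length 2 with hc | hc
    · have hpos := c.length_pos (by omega)
      let i0 : Fin c.length := ⟨0, hpos⟩
      have hu : ∀ i, i = i0 := fun i => Fin.ext (by have := i.2; simp [i0]; omega)
      have hs : c.partSize i0 = n := by
        exact (Fintype.sum_eq_single i0 fun j hj => absurd (hu j) hj).symm.trans c.sum_partSize
      rw [Fintype.prod_eq_single i0 fun j hj => absurd (hu j) hj, hs]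
      refine (h2 n hn le_rfl).trans ?_
      gcongr
      exact le_self_pow₀ hB (by omega)
    · calc ∏ i, ‖iteratedFDeriv ℝ (c.partSize i) f x‖ ≤ ∏ _i : Fin c.length, (B * δ) := by
            refine Finset.prod_le_prod (fun _ _ => norm_nonneg _) fun i _ => ?_
            rcases Nat.lt_or_ge (c.partSize i) 3 with h | h
            · exact h1 _ (c.partSize_pos i) (by omega)
            · exact (h2 _ h (c.partSize_le i)).trans (by gcongr)
        _ = B ^ c.length * δ ^ c.length := by simp [mul_pow]
        _ ≤ B ^ n * δ ^ 2 := by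
            have : δ ^ c.length ≤ δ ^ 2 := pow_le_pow_of_le_one hδ hδ1 hc
            gcongr
  · exact ((iteratedFDeriv ℝ c.length g (f x)).le_opNorm _).trans
      (mul_le_mul_of_nonneg_right (hgK _ c.length_le)
        (Finset.prod_nonneg fun _ _ => norm_nonneg _))

/-- A bound for the derivative of order `n` of `g ∘ f` which is linear in the derivative of order
`n - 1` of `f`, when the first derivative of `g` vanishes and its second derivative is bounded
whenever one of the arguments lies in the set `S`. -/
theorem norm_iteratedFDeriv_comp_le_linear {g : W → G} {f : Z → W} {x : Z}
    (hg : ContDiffAt ℝ ∞ g (f x)) (hf : ContDiffAt ℝ ∞ f x) {n : ℕ} (hn : 3 ≤ n) {K A N : ℝ}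
    (hK : 0 ≤ K) (hA : 1 ≤ A) (hN : 1 ≤ N) (hg1 : fderiv ℝ g (f x) = 0) {S : Set W}
    (hg2 : ∀ a b, a ∈ S ∨ b ∈ S → ‖fderiv ℝ (fderiv ℝ g) (f x) a b‖ ≤ K * (‖a‖ * ‖b‖))
    (hg3 : ∀ m, 3 ≤ m → m ≤ n → ‖iteratedFDeriv ℝ m g (f x)‖ ≤ K)
    (hfS : ∀ m, 2 ≤ m → ∀ v, iteratedFDeriv ℝ m f x v ∈ S)
    (hf1 : ∀ m, 1 ≤ m → m + 2 ≤ n → ‖iteratedFDeriv ℝ m f x‖ ≤ A)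
    (hf2 : ∀ m, m + 1 = n → ‖iteratedFDeriv ℝ m f x‖ ≤ A * N) :
    ‖iteratedFDeriv ℝ n (g ∘ f) x‖ ≤
      Fintype.card (OrderedFinpartition n) * (K * (A ^ n * N)) := by
  refine norm_iteratedFDeriv_comp_le_card hg hf fun c => ?_
  -- With one block the outer derivative is the first derivative of `g`, which vanishes. With two or
  -- more blocks each block has size at most `n - 1`.
  rcases Nat.lt_or_ge c.length 2 with hc | hc
  · have hl : c.length = 1 := by have := c.length_pos (by omega); omega
    refine ⟨0, le_rfl, by rw [zero_mul]; positivity, fun v => ?_⟩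
    have key : ∀ m, m = 1 → ∀ w : Fin m → W, iteratedFDeriv ℝ m g (f x) w = 0 := by
      rintro m rfl w; simp [hg1]
    rw [key _ hl]; simp
  · refine ⟨K, hK, ?_, fun v => ?_⟩
    · refine mul_le_mul_of_nonneg_left ?_ hK
      calc ∏ i, ‖iteratedFDeriv ℝ (c.partSize i) f x‖
          ≤ ∏ i, A * (if c.partSize i + 1 = n then N else 1) := by
            refine Finset.prod_le_prod (fun _ _ => norm_nonneg _) fun i _ => ?_
            split_ifs with h
            · exact hf2 _ h
            · rw [mul_one]
              refine hf1 _ (c.partSize_pos i) ?_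
              have : Nontrivial (Fin c.length) := Fin.nontrivial_iff_two_le.2 hc
              obtain ⟨j, hj⟩ := exists_ne i
              have h1 := c.partSize_add_le hj
              have h2 := c.partSize_pos j
              omega
        _ = A ^ c.length * ∏ i, (if c.partSize i + 1 = n then N else 1) := by
            rw [Finset.prod_mul_distrib]; simp
        _ ≤ A ^ n * N := by
            -- The factor `N` occurs at most once: two blocks of size `n - 1` would need `2 * (n -
            -- 1) ≤ n`, which is false for `n ≥ 3`.
            rw [Finset.prod_ite_one]
            · have : A ^ c.length ≤ A ^ n := pow_le_pow_right₀ hA c.length_le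
              have h0 : (0 : ℝ) ≤ A ^ c.length := by positivity
              refine mul_le_mul this ?_ (by split_ifs <;> linarith) (by positivity)
              split_ifs <;> linarith
            · intro i _ j _ hi hj
              by_contra hij
              have h1 := c.partSize_add_le hij
              omega
    · rcases hc.lt_or_eq with hc | hc
      · exact ((iteratedFDeriv ℝ c.length g (f x)).le_opNorm _).trans
          (mul_le_mul_of_nonneg_right (hg3 _ hc c.length_le)
            (Finset.prod_nonneg fun _ _ => norm_nonneg _))
      · have key : ∀ m, 2 = m → ∀ w : Fin m → W, (∃ i, w i ∈ S) →
            ‖iteratedFDeriv ℝ m g (f x) w‖ ≤ K * ∏ i, ‖w i‖ := by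
          rintro m rfl w ⟨i, hi⟩
          rw [iteratedFDeriv_two_apply, Fin.prod_univ_two]
          refine hg2 _ _ ?_
          fin_cases i
          · exact Or.inl hi
          · exact Or.inr hi
        refine key _ hc _ ?_
        -- With exactly two blocks and `n ≥ 3`, one block has size at least two, so one argument of
        -- the second derivative lies in `S`.
        by_contra! hcon
        have : ∀ i, c.partSize i ≤ 1 := fun i => by
          by_contra! h
          exact hcon i (hfS _ h _)
        have h2 : ∑ i, c.partSize i ≤ ∑ _i : Fin c.length, 1 :=
          Finset.sum_le_sum fun i _ => this i
        rw [c.sum_partSize] at h2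
        simp at h2
        omega

theorem iteratedFDeriv_clm (L : Z →L[ℝ] G) {n : ℕ} (hn : 2 ≤ n) (x : Z) :
    iteratedFDeriv ℝ n L x = 0 := by
  obtain ⟨m, rfl⟩ := Nat.exists_eq_add_of_le' hn
  rw [← norm_eq_zero, show m + 2 = (m + 1) + 1 from rfl, ← norm_iteratedFDeriv_fderiv]
  have : fderiv ℝ L = fun _ => L := by ext1 z; exact L.fderiv
  rw [this, iteratedFDeriv_succ_const]; simp

theorem iteratedFDeriv_bilinear {Z' : Type} [NormedAddCommGroup Z'] [NormedSpace ℝ Z']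
    (B : Z →L[ℝ] Z' →L[ℝ] G) {n : ℕ} (hn : 3 ≤ n) (x : Z × Z') :
    iteratedFDeriv ℝ n (fun z : Z × Z' => B z.1 z.2) x = 0 := by
  obtain ⟨m, rfl⟩ := Nat.exists_eq_add_of_le' hn
  rw [← norm_eq_zero, show m + 3 = (m + 2) + 1 from rfl, ← norm_iteratedFDeriv_fderiv]
  have : fderiv ℝ (fun z : Z × Z' => B z.1 z.2) = B.deriv₂ := by
    ext1 z
    exact (B.isBoundedBilinearMap.hasFDerivAt z).fderiv
  rw [this, iteratedFDeriv_clm _ (by omega), norm_zero]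

theorem contDiffAt_fderiv {f : Z → G} {x : Z} (hf : ContDiffAt ℝ ∞ f x) :
    ContDiffAt ℝ ∞ (fderiv ℝ f) x := hf.fderiv_right (by simp)

/-- The derivative of a function on `ℝ × Z` in the direction of the second factor. -/
theorem hasFDerivAt_slice {f : ℝ × Z → G} {p : ℝ × Z} (hf : DifferentiableAt ℝ f p) :
    HasFDerivAt (fun z => f (p.1, z)) ((fderiv ℝ f p).comp (ContinuousLinearMap.inr ℝ ℝ Z)) p.2 :=
  HasFDerivAt.comp p.2 (g := f) (f := fun z => (p.1, z)) hf.hasFDerivAt (hasFDerivAt_prodMk_right p.1 p.2)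

/-- Iterated derivatives in the second factor commute with directional derivatives. -/
theorem iteratedFDeriv_slice (n : ℕ) : ∀ {G : Type} [NormedAddCommGroup G] [NormedSpace ℝ G]
    {f : ℝ × Z → G} {Ω : Set (ℝ × Z)}, IsOpen Ω → (∀ p ∈ Ω, ContDiffAt ℝ ∞ f p) → ∀ p ∈ Ω,
    ContDiffAt ℝ ∞ (fun p : ℝ × Z => iteratedFDeriv ℝ n (fun z => f (p.1, z)) p.2) p ∧
    ∀ w, fderiv ℝ (fun p : ℝ × Z => iteratedFDeriv ℝ n (fun z => f (p.1, z)) p.2) p w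
      = iteratedFDeriv ℝ n (fun z => fderiv ℝ f (p.1, z) w) p.2 := by
  induction n with
  | zero =>
    intro G _ _ f Ω hΩ hf p hp
    have : (fun p : ℝ × Z => iteratedFDeriv ℝ 0 (fun z => f (p.1, z)) p.2)
        = (continuousMultilinearCurryFin0 ℝ Z G).symm ∘ f := by
      ext p; simp
    rw [this]
    refine ⟨(LinearIsometryEquiv.contDiff _).contDiffAt.comp p (hf p hp), fun w => ?_⟩
    rw [LinearIsometryEquiv.comp_fderiv]
    ext; simp
  | succ n ih =>
    intro G _ _ f Ω hΩ hf p hp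
    let f1 : ℝ × Z → Z →L[ℝ] G := fun p => fderiv ℝ (fun z => f (p.1, z)) p.2
    have hf1 : ∀ p ∈ Ω, f1 p = (fderiv ℝ f p).comp (ContinuousLinearMap.inr ℝ ℝ Z) := fun p hp =>
      (hasFDerivAt_slice ((hf p hp).differentiableAt (by simp))).fderiv
    have hf1e : ∀ p ∈ Ω, f1 =ᶠ[𝓝 p] fun p => (fderiv ℝ f p).comp (ContinuousLinearMap.inr ℝ ℝ Z) :=
      fun p hp => by filter_upwards [hΩ.mem_nhds hp] with q hq using hf1 q hq
    have hf1s : ∀ p ∈ Ω, ContDiffAt ℝ ∞ f1 p := fun p hp => by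
      refine ContDiffAt.congr_of_eventuallyEq ?_ (hf1e p hp)
      exact (contDiffAt_fderiv (hf p hp)).clm_comp contDiffAt_const
    have h := ih hΩ hf1s p hp
    have hW : (fun p : ℝ × Z => iteratedFDeriv ℝ (n + 1) (fun z => f (p.1, z)) p.2) =
        (continuousMultilinearCurryRightEquiv' ℝ n Z G).symm ∘
          (fun p : ℝ × Z => iteratedFDeriv ℝ n (fun z => f1 (p.1, z)) p.2) := by
      ext1 p
      rw [iteratedFDeriv_succ_eq_comp_right]; rfl
    rw [hW]
    refine ⟨(LinearIsometryEquiv.contDiff _).contDiffAt.comp p h.1, fun w => ?_⟩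
    rw [((continuousMultilinearCurryRightEquiv' ℝ n Z G).symm.hasFDerivAt.comp p
      (h.1.differentiableAt (by simp)).hasFDerivAt).fderiv, iteratedFDeriv_succ_eq_comp_right]
    simp only [ContinuousLinearMap.comp_apply, Function.comp_apply]
    refine congrArg (continuousMultilinearCurryRightEquiv' ℝ n Z G).symm ?_
    refine (h.2 w).trans ?_
    refine (Filter.EventuallyEq.iteratedFDeriv ℝ ?_ n).eq_of_nhds
    have : ∀ᶠ z in 𝓝 p.2, (p.1, z) ∈ Ω :=
      (Continuous.prodMk_right p.1).continuousAt.eventually (hΩ.mem_nhds hp)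
    filter_upwards [this] with z hz
    have hd : DifferentiableAt ℝ (fderiv ℝ f) (p.1, z) :=
      (contDiffAt_fderiv (hf _ hz)).differentiableAt (by simp)
    rw [(hf1e _ hz).fderiv_eq]
    ext k
    have e1 := hasFDerivAt_slice (f := fun q => fderiv ℝ f q w) (p := (p.1, z))
      (hd.clm_apply (differentiableAt_const w))
    rw [e1.fderiv, fderiv_clm_comp hd (differentiableAt_const _),
      fderiv_clm_apply hd (differentiableAt_const w)]
    -- Symmetry of the second derivative is what lets the direction `w` pass through the derivative
    -- along the slice.
    have e2 := (hf _ hz).isSymmSndFDerivAt (by simpa using two_le_infty) w (0, k)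
    simpa using e2

/-- The derivative of an iterated derivative along a curve. -/
theorem hasDerivAt_iteratedFDeriv_curve (n : ℕ) {f : ℝ × Z → G} {Ω : Set (ℝ × Z)} (hΩ : IsOpen Ω)
    (hf : ∀ p ∈ Ω, ContDiffAt ℝ ∞ f p) {γ : ℝ → Z} {v : Z} {t : ℝ} (hγ : HasDerivAt γ v t)
    (ht : (t, γ t) ∈ Ω) :
    HasDerivAt (fun s => iteratedFDeriv ℝ n (fun z => f (s, z)) (γ s))
      (iteratedFDeriv ℝ n (fun z => fderiv ℝ f (t, z) (1, v)) (γ t)) t := by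
  obtain ⟨h1, h2⟩ := iteratedFDeriv_slice n hΩ hf _ ht
  rw [← h2]
  exact (h1.differentiableAt (by simp)).hasFDerivAt.comp_hasDerivAt t
    ((hasDerivAt_id t).prodMk hγ)

end IteratedDerivatives

end EikonalBounds

namespace EikonalBounds

/-! ### Hamiltonian flows -/

section Hamiltonian

open Set Filter Topology

variable {d : ℕ}

/-- The gradient of `q (x, ξ)` in `ξ`. -/
noncomputable def gradXi (q : E d × E d → ℝ) (z : E d × E d) : E d :=
  (InnerProductSpace.toDual ℝ (E d)).symm
    ((fderiv ℝ q z).comp (ContinuousLinearMap.inr ℝ (E d) (E d)))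

/-- The gradient of `q (x, ξ)` in `x`. -/
noncomputable def gradX (q : E d × E d → ℝ) (z : E d × E d) : E d :=
  (InnerProductSpace.toDual ℝ (E d)).symm
    ((fderiv ℝ q z).comp (ContinuousLinearMap.inl ℝ (E d) (E d)))

/-- The Hamiltonian vector field of `q`. -/
noncomputable def hamField (q : E d × E d → ℝ) (z : E d × E d) : E d × E d :=
  (gradXi q z, -gradX q z)

theorem inner_gradXi (q : E d × E d → ℝ) (z : E d × E d) (v : E d) :
    inner ℝ (gradXi q z) v = fderiv ℝ q z (0, v) := by
  simp [gradXi, InnerProductSpace.toDual_symm_apply]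

theorem inner_gradX (q : E d × E d → ℝ) (z : E d × E d) (u : E d) :
    inner ℝ (gradX q z) u = fderiv ℝ q z (u, 0) := by
  simp [gradX, InnerProductSpace.toDual_symm_apply]

theorem contDiff_hamField {q : E d × E d → ℝ} (hq : ContDiff ℝ ∞ q) :
    ContDiff ℝ ∞ (hamField q) := by
  have h : ContDiff ℝ ∞ (fderiv ℝ q) := hq.fderiv_right (by simp)
  have h1 : ContDiff ℝ ∞ (gradXi q) :=
    ((InnerProductSpace.toDual ℝ (E d)).symm.contDiff).comp (h.clm_comp contDiff_const)
  have h2 : ContDiff ℝ ∞ (gradX q) :=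
    ((InnerProductSpace.toDual ℝ (E d)).symm.contDiff).comp (h.clm_comp contDiff_const)
  exact h1.prodMk h2.neg

/-- The region of phase space in which the covectors have length comparable to one. -/
def shell (d : ℕ) : Set (E d × E d) := {z | 1 / 2 < ‖z.2‖ ∧ ‖z.2‖ < 2}

/-- The set of parameters `(t, x, η)` of the local solution of the eikonal equation. -/
def slab (d : ℕ) : Set (ℝ × (E d × E d)) := {p | |p.1| < 2 ∧ 3 / 4 < ‖p.2.2‖ ∧ ‖p.2.2‖ < 4 / 3}

theorem isOpen_shell : IsOpen (shell d) :=
  (isOpen_lt continuous_const (continuous_norm.comp continuous_snd)).inter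
    (isOpen_lt (continuous_norm.comp continuous_snd) continuous_const)

theorem isOpen_slab : IsOpen (slab d) := by
  have h : Continuous fun p : ℝ × (E d × E d) => ‖p.2.2‖ := by fun_prop
  exact (isOpen_lt (continuous_abs.comp continuous_fst) continuous_const).inter
    ((isOpen_lt continuous_const h).inter (isOpen_lt h continuous_const))

/-- A Hamiltonian `q` which is homogeneous of degree one in the shell and whose second derivatives
in `x` are small up to the derivative of a small matrix `M` along the flow. -/
structure IsAdmissible (q : E d × E d → ℝ) (M : E d × E d → E d →L[ℝ] E d) (ε Λ : ℝ) : Prop where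
  smooth : ContDiff ℝ ∞ q
  bounded : ∃ B, ∀ z, ‖hamField q z‖ ≤ B
  lipschitz : ∃ K : NNReal, LipschitzWith K (hamField q)
  gradX_le : ∀ z, ‖gradX q z‖ ≤ ε
  homogeneous : ∀ z ∈ shell d, inner ℝ z.2 (gradXi q z) = q z
  mixed₁ : ∀ z ∈ shell d, ∀ u, ‖(fderiv ℝ (hamField q) z (u, 0)).1‖ ≤ ε * ‖u‖
  pure₁ : ∀ z ∈ shell d, ∀ v, ‖(fderiv ℝ (hamField q) z (0, v)).1‖ ≤ Λ * ‖v‖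
  mixed₂ : ∀ z ∈ shell d, ∀ v, ‖(fderiv ℝ (hamField q) z (0, v)).2‖ ≤ ε * ‖v‖
  smoothM : Differentiable ℝ M
  smallM : ∀ z ∈ shell d, ‖M z‖ ≤ ε
  curvature : ∀ z ∈ shell d, ∀ u,
    ‖(fderiv ℝ (hamField q) z (u, 0)).2 + fderiv ℝ M z (hamField q z) u‖ ≤ ε * ‖u‖

namespace IsAdmissible

variable {q : E d × E d → ℝ} {M : E d × E d → E d →L[ℝ] E d} {ε Λ : ℝ}

theorem contDiff_flow (h : IsAdmissible q M ε Λ) :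
    ContDiff ℝ ∞ (fun p : ℝ × (E d × E d) => flow (hamField q) p.1 p.2) := by
  obtain ⟨B, hB⟩ := h.bounded
  obtain ⟨K, hK⟩ := h.lipschitz
  exact EikonalBounds.contDiff_flow (contDiff_hamField h.smooth) hK hB

theorem hasDerivAt_flow (h : IsAdmissible q M ε Λ) (t : ℝ) (z : E d × E d) :
    HasDerivAt (fun s => flow (hamField q) s z) (hamField q (flow (hamField q) t z)) t := by
  obtain ⟨B, hB⟩ := h.bounded
  obtain ⟨K, hK⟩ := h.lipschitz
  exact EikonalBounds.hasDerivAt_flow hK hB t z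

theorem eps_nonneg (h : IsAdmissible q M ε Λ) : 0 ≤ ε := (norm_nonneg _).trans (h.gradX_le 0)

theorem norm_flow_snd_sub_le (h : IsAdmissible q M ε Λ) {t : ℝ} (ht : |t| ≤ 2) (z : E d × E d) :
    ‖(flow (hamField q) t z).2 - z.2‖ ≤ 2 * ε := by
  have h1 : ∀ s, HasDerivAt (fun s => (flow (hamField q) s z).2)
      (-gradX q (flow (hamField q) s z)) s := fun s => (h.hasDerivAt_flow s z).snd
  have h2 := Convex.norm_image_sub_le_of_norm_hasDerivWithin_le (s := univ) (x := 0) (y := t)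
    (fun s _ => (h1 s).hasDerivWithinAt) (C := ε)
    (fun s _ => by rw [norm_neg]; exact h.gradX_le _) convex_univ trivial trivial
  rw [flow_zero, sub_zero, Real.norm_eq_abs] at h2
  nlinarith [h.eps_nonneg]

/-- The covector moves by at most `2 * ε ≤ 1/8`, which the margins between 3/4 and 1/2 and between
4/3 and 2 absorb. -/
theorem flow_mem_shell (h : IsAdmissible q M ε Λ) (hε : ε ≤ 1 / 16) {t : ℝ} {z : E d × E d}
    (hz : (t, z) ∈ slab d) : flow (hamField q) t z ∈ shell d := by
  have h1 := h.norm_flow_snd_sub_le hz.1.le z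
  have h2 := hz.2.1
  have h3 := hz.2.2
  have h4 := norm_sub_norm_le (flow (hamField q) t z).2 z.2
  have h5 := norm_sub_norm_le z.2 (flow (hamField q) t z).2
  rw [norm_sub_rev] at h5
  simp only at h2 h3
  exact ⟨by linarith, by linarith⟩

/-- This is the linearized equation. It is the exchange of time and space derivatives of
`hasDerivAt_iteratedFDeriv_curve`, for derivatives of order one and the constant curve at `z`. -/
theorem hasDerivAt_fderiv_flow (h : IsAdmissible q M ε Λ) (t : ℝ) (z w : E d × E d) :
    HasDerivAt (fun s => fderiv ℝ (flow (hamField q) s) z w)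
      (fderiv ℝ (hamField q) (flow (hamField q) t z) (fderiv ℝ (flow (hamField q) t) z w)) t := by
  have h1 := hasDerivAt_iteratedFDeriv_curve 1 (Ω := univ) (t := t) isOpen_univ
    (fun p _ => h.contDiff_flow.contDiffAt) (hasDerivAt_const t z) trivial
  let ev : ((E d × E d) [×1]→L[ℝ] (E d × E d)) →L[ℝ] (E d × E d) :=
    ContinuousMultilinearMap.apply ℝ (fun _ : Fin 1 => E d × E d) (E d × E d) (fun _ => w)
  have h2 := ev.hasFDerivAt.comp_hasDerivAt t h1
  have e1 : (fun z' => fderiv ℝ (fun p : ℝ × (E d × E d) => flow (hamField q) p.1 p.2) (t, z')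
      (1, 0)) = fun z' => hamField q (flow (hamField q) t z') := by
    ext1 z'
    have h3 := (h.contDiff_flow.differentiable (by simp) (t, z')).hasFDerivAt.comp_hasDerivAt t
      ((hasDerivAt_id t).prodMk (hasDerivAt_const t z'))
    exact h3.unique (h.hasDerivAt_flow t z')
  have h4 : DifferentiableAt ℝ (flow (hamField q) t) z :=
    (hasFDerivAt_slice (p := (t, z)) (h.contDiff_flow.differentiable (by simp) _)).differentiableAt
  refine (h2.congr_deriv ?_).congr_of_eventuallyEq ?_
  · rw [e1]
    simp only [ev, ContinuousMultilinearMap.apply_apply, iteratedFDeriv_one_apply]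
    rw [fderiv_fun_comp z ((contDiff_hamField h.smooth).differentiable (by simp) _) h4]
    rfl
  · exact Eventually.of_forall fun s => by simp [ev]

theorem differentiableAt_flow (h : IsAdmissible q M ε Λ) (t : ℝ) (z : E d × E d) :
    DifferentiableAt ℝ (flow (hamField q) t) z :=
  (hasFDerivAt_slice (p := (t, z)) (h.contDiff_flow.differentiable (by simp) _)).differentiableAt

theorem fderiv_flow_zero (z w : E d × E d) :
    fderiv ℝ (flow (hamField q) 0) z w = w := by
  have : flow (hamField q) 0 = id := by ext1 z; exact flow_zero _ z
  rw [this]; simp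

/-- Trajectories up to time `t` are run as `s ↦ s * t` over the unit interval, which treats both
signs of `t` at once. -/
theorem scaled_mem_slab {t s : ℝ} {z : E d × E d} (hz : (t, z) ∈ slab d) (hs : s ∈ Icc (0 : ℝ) 1) :
    (s * t, z) ∈ slab d := by
  refine ⟨?_, hz.2⟩
  have := hz.1
  simp only at this ⊢
  rw [abs_mul, abs_of_nonneg hs.1]
  nlinarith [abs_nonneg t, hs.2]

/-- The pairing of the covector with the variation of the position is constant along the flow. -/
theorem inner_variation (h : IsAdmissible q M ε Λ) (hε : ε ≤ 1 / 16) {t : ℝ} {z : E d × E d}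
    (hz : (t, z) ∈ slab d) (w : E d × E d) :
    inner ℝ (flow (hamField q) t z).2 (fderiv ℝ (flow (hamField q) t) z w).1
      = inner ℝ z.2 w.1 := by
  have hV := contDiff_hamField h.smooth
  -- This is Euler's identity `⟨ξ, ∂_ξ q⟩ = q` differentiated in the direction `w`; the terms with
  -- `w.2` cancel. Along the flow it balances the derivative of the covector, which is why the
  -- pairing is conserved.
  have key : ∀ y ∈ shell d, ∀ w : E d × E d,
      inner ℝ y.2 (fderiv ℝ (hamField q) y w).1 = inner ℝ (gradX q y) w.1 := by
    intro y hy w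
    have h1 : HasFDerivAt (fun y : E d × E d => inner ℝ y.2 (hamField q y).1) (fderiv ℝ q y) y := by
      refine ((h.smooth.differentiable (by simp)) y).hasFDerivAt.congr_of_eventuallyEq ?_
      filter_upwards [isOpen_shell.mem_nhds hy] with y' hy' using h.homogeneous y' hy'
    have h2 := (hasFDerivAt_snd (𝕜 := ℝ) (p := y)).inner ℝ
      (hV.differentiable (by simp) y).hasFDerivAt.fst
    have h3 := DFunLike.congr_fun (h2.unique h1) w
    simp only [ContinuousLinearMap.comp_apply, ContinuousLinearMap.prod_apply,
      fderivInnerCLM_apply, ContinuousLinearMap.coe_fst', ContinuousLinearMap.coe_snd'] at h3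
    have h4 : fderiv ℝ q y w = inner ℝ (gradX q y) w.1 + inner ℝ (gradXi q y) w.2 := by
      rw [inner_gradX, inner_gradXi, ← map_add]; simp
    rw [h4, real_inner_comm] at h3
    have h5 : inner ℝ w.2 (hamField q y).1 = inner ℝ (gradXi q y) w.2 := real_inner_comm _ _
    rw [real_inner_comm] at h3
    linarith
  have hd : ∀ s ∈ Icc (0 : ℝ) 1, HasDerivWithinAt (fun s => inner ℝ (flow (hamField q) (s * t) z).2
      (fderiv ℝ (flow (hamField q) (s * t)) z w).1) 0 (Icc 0 1) s := by
    intro s hs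
    have e : HasDerivAt (fun s : ℝ => s * t) t s := by simpa using (hasDerivAt_id s).mul_const t
    have h1 : HasDerivAt (fun s => (flow (hamField q) (s * t) z).2)
        (t • hamField q (flow (hamField q) (s * t) z)).2 s := (HasDerivAt.scomp (g₁ := fun s => flow (hamField q) s z) s
      (h.hasDerivAt_flow (s * t) z) e).snd
    have h2 : HasDerivAt (fun s => (fderiv ℝ (flow (hamField q) (s * t)) z w).1)
        (t • fderiv ℝ (hamField q) (flow (hamField q) (s * t) z)
          (fderiv ℝ (flow (hamField q) (s * t)) z w)).1 s := (HasDerivAt.scomp (g₁ := fun s => fderiv ℝ (flow (hamField q) s) z w) s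
      (h.hasDerivAt_fderiv_flow (s * t) z w) e).fst
    refine ((h1.inner ℝ h2).congr_deriv ?_).hasDerivWithinAt
    have := key _ (h.flow_mem_shell hε (scaled_mem_slab hz hs))
      (fderiv ℝ (flow (hamField q) (s * t)) z w)
    simp only [Prod.smul_fst, Prod.smul_snd, inner_smul_right, inner_smul_left,
      this, hamField, inner_neg_left]
    simp
  have h1 := Convex.norm_image_sub_le_of_norm_hasDerivWithin_le hd (C := 0) (by simp)
    (convex_Icc 0 1) (x := 0) (y := 1) (by simp) (by simp)
  simp only [one_mul, zero_mul, norm_le_zero_iff, sub_eq_zero] at h1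
  rw [h1, flow_zero, fderiv_flow_zero]

/-- Bound for the variation of the flow, in terms of the variable which is corrected by `M`. -/
theorem norm_variation_le (h : IsAdmissible q M ε Λ) (hε : ε ≤ 1 / 16) (hΛ : 1 ≤ Λ) {t : ℝ}
    {z : E d × E d} (hz : (t, z) ∈ slab d) (w : E d × E d) :
    ‖(fderiv ℝ (flow (hamField q) t) z w).1 - w.1‖
      ≤ 9 * Λ * Real.exp (16 * Λ + 1) * (‖w.2‖ + ε * ‖w.1‖) ∧
    ‖(fderiv ℝ (flow (hamField q) t) z w).2 + M (flow (hamField q) t z)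
      (fderiv ℝ (flow (hamField q) t) z w).1‖
      ≤ 9 * Λ * Real.exp (16 * Λ + 1) * (‖w.2‖ + ε * ‖w.1‖) := by
  have hε0 := h.eps_nonneg
  let Zf : ℝ → E d × E d := fun s => flow (hamField q) (s * t) z
  let D : ℝ → E d × E d := fun s => fderiv ℝ (flow (hamField q) (s * t)) z w
  have hsh : ∀ s ∈ Icc (0 : ℝ) 1, Zf s ∈ shell d := fun s hs =>
    h.flow_mem_shell hε (scaled_mem_slab hz hs)
  have e : ∀ s, HasDerivAt (fun s : ℝ => s * t) t s := fun s => by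
    simpa using (hasDerivAt_id s).mul_const t
  have hZ : ∀ s, HasDerivAt Zf (t • hamField q (Zf s)) s := fun s =>
    HasDerivAt.scomp (g₁ := fun s => flow (hamField q) s z) s (h.hasDerivAt_flow (s * t) z) (e s)
  have hD : ∀ s, HasDerivAt D (t • fderiv ℝ (hamField q) (Zf s) (D s)) s := fun s =>
    HasDerivAt.scomp (g₁ := fun s => fderiv ℝ (flow (hamField q) s) z w) s
      (h.hasDerivAt_fderiv_flow (s * t) z w) (e s)
  -- The equation for the covector variation contains the Hessian of `q` in `x`, which is not small.
  -- Adding `M u` produces the term `(DM · V) u`, and the sum of the two is what `curvature` bounds;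
  -- the remaining term `M u'` is of order `ε`. Subtracting `w.1` makes the first component start at
  -- zero.
  let a : ℝ → E d × E d := fun s => ((D s).1 - w.1, (D s).2 + M (Zf s) (D s).1)
  let a' : ℝ → E d × E d := fun s =>
    (t • (fderiv ℝ (hamField q) (Zf s) (D s)).1,
      t • (fderiv ℝ (hamField q) (Zf s) (D s)).2 +
        ((fderiv ℝ M (Zf s) (t • hamField q (Zf s))) (D s).1 +
          M (Zf s) (t • (fderiv ℝ (hamField q) (Zf s) (D s)).1)))
  have ha : ∀ s, HasDerivAt a (a' s) s := fun s => by
    have h1 : HasDerivAt (fun s => M (Zf s)) (fderiv ℝ M (Zf s) (t • hamField q (Zf s))) s :=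
      (h.smoothM (Zf s)).hasFDerivAt.comp_hasDerivAt s (hZ s)
    have h2 : HasDerivAt (fun s => (D s).1) (t • (fderiv ℝ (hamField q) (Zf s) (D s)).1) s :=
      (hD s).fst
    have h3 : HasDerivAt (fun s => (D s).2) (t • (fderiv ℝ (hamField q) (Zf s) (D s)).2) s :=
      (hD s).snd
    exact (h2.sub_const w.1).prodMk (h3.add (h1.clm_apply h2))
  have ht2 : |t| ≤ 2 := hz.1.le
  have hb : ∀ s ∈ Icc (0 : ℝ) 1, ‖a' s‖ ≤ 16 * Λ * ‖a s‖ + 8 * Λ * ε * ‖w.1‖ := by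
    intro s hs
    have hM := h.smallM _ (hsh s hs)
    set u := (D s).1
    set v := (D s).2
    set y := Zf s
    have hu : ‖u‖ ≤ ‖a s‖ + ‖w.1‖ := by
      have h1 : ‖u - w.1‖ ≤ ‖a s‖ := norm_fst_le (a s)
      have h2 := norm_sub_norm_le u w.1
      linarith
    have hw : ‖v + M y u‖ ≤ ‖a s‖ := norm_snd_le (a s)
    have hMu : ∀ u, ‖M y u‖ ≤ ε * ‖u‖ := fun u =>
      (ContinuousLinearMap.le_opNorm _ _).trans (by gcongr)
    have hv : ‖v‖ ≤ ‖a s‖ + ε * ‖u‖ := by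
      have h1 := norm_sub_norm_le v (-(M y u))
      rw [sub_neg_eq_add, norm_neg] at h1
      linarith [hMu u]
    have hsplit : ∀ w : E d × E d, fderiv ℝ (hamField q) y w =
        fderiv ℝ (hamField q) y (w.1, 0) + fderiv ℝ (hamField q) y (0, w.2) := fun w => by
      rw [← map_add]; simp
    have f1 : ‖(fderiv ℝ (hamField q) y (D s)).1‖ ≤ ε * ‖u‖ + Λ * ‖v‖ := by
      rw [hsplit, Prod.fst_add]
      exact (norm_add_le _ _).trans (add_le_add (h.mixed₁ _ (hsh s hs) _) (h.pure₁ _ (hsh s hs) _))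
    have f2 : ‖(fderiv ℝ (hamField q) y (D s)).2 + fderiv ℝ M y (hamField q y) u‖
        ≤ ε * ‖u‖ + ε * ‖v‖ := by
      rw [hsplit, Prod.snd_add, add_right_comm]
      exact (norm_add_le _ _).trans
        (add_le_add (h.curvature _ (hsh s hs) _) (h.mixed₂ _ (hsh s hs) _))
    have n1 : 0 ≤ ‖u‖ := norm_nonneg _
    have n2 : 0 ≤ ‖a s‖ := norm_nonneg _
    have n3 : 0 ≤ ‖v‖ := norm_nonneg _
    have hεΛ : ε * ‖u‖ ≤ Λ * (ε * ‖u‖) := le_mul_of_one_le_left (by positivity) hΛ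
    have haΛ : ‖a s‖ ≤ Λ * ‖a s‖ := le_mul_of_one_le_left n2 hΛ
    have hΛv : Λ * ‖v‖ ≤ Λ * ‖a s‖ + Λ * (ε * ‖u‖) := by
      have := mul_le_mul_of_nonneg_left hv (by linarith : 0 ≤ Λ); linarith
    have hεu : ε * ‖u‖ ≤ ε * ‖a s‖ + ε * ‖w.1‖ := by
      have := mul_le_mul_of_nonneg_left hu hε0; linarith
    have hεa : ε * ‖a s‖ ≤ 1 / 16 * ‖a s‖ := by gcongr
    have hεv : ε * ‖v‖ ≤ ‖v‖ / 16 := by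
      have := mul_le_mul_of_nonneg_right hε n3; linarith
    have tot : Λ * (ε * ‖u‖) ≤ Λ * ‖a s‖ / 16 + Λ * (ε * ‖w.1‖) := by
      have := mul_le_mul_of_nonneg_left (hεu.trans (add_le_add_left hεa _))
        (by linarith : 0 ≤ Λ)
      linarith
    have f3 : ‖(fderiv ℝ (hamField q) y (D s)).1‖ ≤ 2 * (Λ * (ε * ‖u‖)) + Λ * ‖a s‖ := by linarith
    have f4 : ‖M y (fderiv ℝ (hamField q) y (D s)).1‖ ≤
        ‖(fderiv ℝ (hamField q) y (D s)).1‖ / 16 := by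
      have := (hMu (fderiv ℝ (hamField q) y (D s)).1).trans
        (mul_le_mul_of_nonneg_right hε (norm_nonneg _))
      linarith
    have g1 : ‖(fderiv ℝ (hamField q) y (D s)).1‖ ≤ 8 * Λ * ‖a s‖ + 4 * Λ * ε * ‖w.1‖ := by
      nlinarith [mul_nonneg (by linarith : 0 ≤ Λ) n2,
        mul_nonneg (by linarith : 0 ≤ Λ) (mul_nonneg hε0 (norm_nonneg w.1))]
    have g2 : ‖((fderiv ℝ (hamField q) y (D s)).2 + fderiv ℝ M y (hamField q y) u)
        + M y (fderiv ℝ (hamField q) y (D s)).1‖ ≤ 8 * Λ * ‖a s‖ + 4 * Λ * ε * ‖w.1‖ := by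
      refine (norm_add_le _ _).trans ?_
      nlinarith [mul_nonneg (by linarith : 0 ≤ Λ) n2,
        mul_nonneg (by linarith : 0 ≤ Λ) (mul_nonneg hε0 (norm_nonneg w.1))]
    have g0 : 0 ≤ 8 * Λ * ‖a s‖ + 4 * Λ * ε * ‖w.1‖ := (norm_nonneg _).trans g1
    rw [Prod.norm_def]
    refine max_le ?_ ?_
    · simp only [a', norm_smul, Real.norm_eq_abs]
      calc _ ≤ 2 * (8 * Λ * ‖a s‖ + 4 * Λ * ε * ‖w.1‖) :=
            mul_le_mul ht2 g1 (norm_nonneg _) zero_le_two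
        _ = _ := by ring
    · have : (a' s).2 = t • (((fderiv ℝ (hamField q) y (D s)).2 + fderiv ℝ M y (hamField q y) u)
        + M y (fderiv ℝ (hamField q) y (D s)).1) := by
        simp only [a', map_smul, smul_add, _root_.smul_apply]; abel
      rw [this, norm_smul, Real.norm_eq_abs]
      calc _ ≤ 2 * (8 * Λ * ‖a s‖ + 4 * Λ * ε * ‖w.1‖) :=
            mul_le_mul ht2 g2 (norm_nonneg _) zero_le_two
        _ = _ := by ring
  have h0 : ‖a 0‖ ≤ ‖w.2‖ + ε * ‖w.1‖ := by
    have hz0 := hsh 0 (by simp)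
    simp only [a, D, zero_mul, fderiv_flow_zero, sub_self, Prod.norm_def, norm_zero]
    refine max_le (by positivity) ((norm_add_le _ _).trans ?_)
    gcongr
    exact (ContinuousLinearMap.le_opNorm _ _).trans (by gcongr; exact h.smallM _ hz0)
  have key := norm_le_of_deriv_le (by positivity) (by positivity) (by positivity)
    (fun s _ => (ha s).hasDerivWithinAt) h0 hb 1 (by simp)
  have hfin : ‖a 1‖ ≤ 9 * Λ * Real.exp (16 * Λ + 1) * (‖w.2‖ + ε * ‖w.1‖) := by
    refine key.trans ?_
    have n1 : 0 ≤ ε * ‖w.1‖ := by positivity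
    have n2 := norm_nonneg w.2
    have : ‖w.2‖ + ε * ‖w.1‖ + 8 * Λ * ε * ‖w.1‖ ≤ 9 * Λ * (‖w.2‖ + ε * ‖w.1‖) := by nlinarith
    calc _ ≤ 9 * Λ * (‖w.2‖ + ε * ‖w.1‖) * Real.exp (16 * Λ + 1) := by gcongr
      _ = _ := by ring
  have e1 : (1 : ℝ) * t = t := one_mul t
  simp only [a, D, Zf, e1] at hfin
  exact ⟨(norm_fst_le _).trans hfin, (norm_snd_le _).trans hfin⟩

end IsAdmissible

end Hamiltonian

end EikonalBounds

/-! ### The local solution by the method of characteristics. -/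

namespace EikonalBounds

section LocalSolution

open Set Filter Topology

variable {d : ℕ}

/-- The starting point of the trajectory with initial covector `η` which is at `x` at time `t`. -/
noncomputable def basePoint (q : E d × E d → ℝ) (p : ℝ × (E d × E d)) : E d :=
  Function.invFun (fun y => (flow (hamField q) p.1 (y, p.2.2)).1) p.2.1

/-- The covector at time `t` of the trajectory with initial covector `η` which is at `x`. -/
noncomputable def covector (q : E d × E d → ℝ) (p : ℝ × (E d × E d)) : E d :=
  (flow (hamField q) p.1 (basePoint q p, p.2.2)).2

/-- The solution of the eikonal equation given by the method of characteristics. -/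
noncomputable def phase (q : E d × E d → ℝ) (p : ℝ × (E d × E d)) : ℝ :=
  inner ℝ (basePoint q p) p.2.2

/-- The constant in the bounds for the variation of the flow. -/
noncomputable def varConst (Λ : ℝ) : ℝ := 9 * Λ * Real.exp (16 * Λ + 1)

theorem one_le_varConst {Λ : ℝ} (hΛ : 1 ≤ Λ) : 1 ≤ varConst Λ := by
  have : 1 ≤ Real.exp (16 * Λ + 1) := Real.one_le_exp (by linarith)
  unfold varConst; nlinarith

namespace IsAdmissible

variable {q : E d × E d → ℝ} {M : E d × E d → E d →L[ℝ] E d} {ε Λ : ℝ}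

/-- Smallness of `varConst Λ * ε` turns the Grönwall bound into a perturbation of the identity for
the position. The factor `|t|` in the last bound comes from integrating the position equation from
time zero, where a change of the initial covector leaves the position fixed; it is the source of the
gain in time for the Hessian of the phase in `η`. -/
theorem variation_bounds (h : IsAdmissible q M ε Λ) (hε : ε ≤ 1 / 16) (hΛ : 1 ≤ Λ)
    (hεC : varConst Λ * ε ≤ 1 / 2) {t : ℝ} {z : E d × E d} (hz : (t, z) ∈ slab d) :
    (∀ e, ‖(fderiv ℝ (flow (hamField q) t) z (e, 0)).1 - e‖ ≤ 1 / 2 * ‖e‖) ∧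
    (∀ w, ‖(fderiv ℝ (flow (hamField q) t) z w).2‖ ≤ 3 * varConst Λ * (‖w.1‖ + ‖w.2‖)) ∧
    (∀ b, ‖(fderiv ℝ (flow (hamField q) t) z (0, b)).1‖ ≤ 4 * Λ * varConst Λ * |t| * ‖b‖) := by
  have hε0 := h.eps_nonneg
  have hC := one_le_varConst hΛ
  have hV2 : ∀ {t : ℝ} (_ : (t, z) ∈ slab d) w, ‖(fderiv ℝ (flow (hamField q) t) z w).2‖
      ≤ 3 * varConst Λ * (‖w.1‖ + ‖w.2‖) := by
    intro t hz w
    obtain ⟨h1, h2⟩ := h.norm_variation_le hε hΛ hz w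
    rw [← varConst] at h1 h2
    set u := (fderiv ℝ (flow (hamField q) t) z w).1
    set v := (fderiv ℝ (flow (hamField q) t) z w).2
    have n1 := norm_nonneg w.1
    have n2 := norm_nonneg w.2
    have h3 : ‖M (flow (hamField q) t z) u‖ ≤ 1 * ‖u‖ :=
      (ContinuousLinearMap.le_opNorm _ _).trans
        (by gcongr; exact (h.smallM _ (h.flow_mem_shell hε hz)).trans (by linarith))
    have h4 := norm_sub_norm_le v (-(M (flow (hamField q) t z) u))
    rw [sub_neg_eq_add, norm_neg] at h4
    have h5 := norm_sub_norm_le u w.1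
    nlinarith [mul_nonneg (by linarith : 0 ≤ varConst Λ) n2, mul_nonneg hε0 n1]
  refine ⟨fun e => ?_, hV2 hz, fun b => ?_⟩
  · have h1 := (h.norm_variation_le hε hΛ hz (e, 0)).1
    rw [← varConst] at h1
    simp only [norm_zero, zero_add] at h1
    nlinarith [norm_nonneg e]
  · have h1 : ∀ s ∈ Ioo (-2 : ℝ) 2, HasDerivWithinAt
        (fun s => (fderiv ℝ (flow (hamField q) s) z (0, b)).1)
        (fderiv ℝ (hamField q) (flow (hamField q) s z)
          (fderiv ℝ (flow (hamField q) s) z (0, b))).1 (Ioo (-2 : ℝ) 2) s := fun s _ =>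
      HasDerivAt.hasDerivWithinAt (h.hasDerivAt_fderiv_flow s z (0, b)).fst
    have h2 : ∀ s ∈ Ioo (-2 : ℝ) 2, ‖(fderiv ℝ (hamField q) (flow (hamField q) s z)
          (fderiv ℝ (flow (hamField q) s) z (0, b))).1‖ ≤ 4 * Λ * varConst Λ * ‖b‖ := by
      intro s hs
      have hzs : (s, z) ∈ slab d := ⟨abs_lt.2 hs, hz.2⟩
      have hsh := h.flow_mem_shell hε hzs
      have h3 := (h.norm_variation_le hε hΛ hzs (0, b)).1
      have h4 := hV2 hzs (0, b)
      rw [← varConst] at h3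
      simp only [norm_zero, zero_add, sub_zero, mul_zero, add_zero] at h3 h4
      set u := (fderiv ℝ (flow (hamField q) s) z (0, b)).1 with hu
      set v := (fderiv ℝ (flow (hamField q) s) z (0, b)).2 with hv
      have h5 : fderiv ℝ (flow (hamField q) s) z (0, b) = (u, 0) + (0, v) := by simp [hu, hv]
      rw [h5, map_add, Prod.fst_add]
      refine (norm_add_le _ _).trans ((add_le_add (h.mixed₁ _ hsh u) (h.pure₁ _ hsh v)).trans ?_)
      have e1 : ε * ‖u‖ ≤ Λ * ‖u‖ := by gcongr; linarith
      nlinarith [norm_nonneg u, norm_nonneg v, norm_nonneg b]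
    have h3 := Convex.norm_image_sub_le_of_norm_hasDerivWithin_le h1 h2 (convex_Ioo _ _)
      (x := 0) (y := t) (by norm_num) (abs_lt.1 hz.1)
    rw [fderiv_flow_zero, sub_zero, sub_zero, Real.norm_eq_abs] at h3
    linarith

theorem hasFDerivAt_flow_uncurry (h : IsAdmissible q M ε Λ) (p : ℝ × (E d × E d)) :
    HasFDerivAt (fun p : ℝ × (E d × E d) => flow (hamField q) p.1 p.2)
      ((ContinuousLinearMap.fst ℝ ℝ (E d × E d)).smulRight (hamField q (flow (hamField q) p.1 p.2))
        + (fderiv ℝ (flow (hamField q) p.1) p.2).comp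
          (ContinuousLinearMap.snd ℝ ℝ (E d × E d))) p := by
  have h0 := (h.contDiff_flow.differentiable (by simp) p).hasFDerivAt
  refine h0.congr_fderiv ?_
  have h1 := (hasFDerivAt_slice (p := p) (h.contDiff_flow.differentiable (by simp) p)).fderiv
  have h2 := (HasFDerivAt.comp_hasDerivAt (l := fun p : ℝ × (E d × E d) => flow (hamField q) p.1 p.2)
    (f := fun s : ℝ => (s, p.2)) p.1 h0 ((hasDerivAt_id p.1).prodMk (hasDerivAt_const p.1 p.2))).unique
    (h.hasDerivAt_flow p.1 p.2)
  refine ContinuousLinearMap.ext fun w => ?_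
  have h3 : w = w.1 • ((1 : ℝ), (0 : E d × E d)) + (0, w.2) := by
    ext1 <;> simp
  have h4 := DFunLike.congr_fun h1 w.2
  simp only [ContinuousLinearMap.comp_apply, ContinuousLinearMap.inr_apply] at h4
  conv_lhs => rw [h3, map_add, map_smul, h2, ← h4]
  rfl

section

variable (h : IsAdmissible q M ε Λ) (hε : ε ≤ 1 / 16) (hΛ : 1 ≤ Λ) (hεC : varConst Λ * ε ≤ 1 / 2)
include h hε hΛ hεC

theorem approximatesLinearOn {t : ℝ} {η : E d} (hz : (t, ((0 : E d), η)) ∈ slab d) :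
    ApproximatesLinearOn (fun y => (flow (hamField q) t (y, η)).1)
      (ContinuousLinearEquiv.refl ℝ (E d) : E d →L[ℝ] E d) univ (1 / 2) := by
  intro x _ y _
  have h1 : ∀ y, HasFDerivAt (fun y => (flow (hamField q) t (y, η)).1 - y)
      (((ContinuousLinearMap.fst ℝ (E d) (E d)).comp ((fderiv ℝ (flow (hamField q) t) (y, η)).comp
        (ContinuousLinearMap.inl ℝ (E d) (E d)))) - ContinuousLinearMap.id ℝ (E d)) y := fun y => by
    have h2 := HasFDerivAt.comp (f := fun e => (e, η)) y (h.differentiableAt_flow t (y, η)).hasFDerivAt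
      (hasFDerivAt_prodMk_left y η)
    exact h2.fst.sub (hasFDerivAt_id y)
  have h2 := Convex.norm_image_sub_le_of_norm_hasFDerivWithin_le (C := 1 / 2) (𝕜 := ℝ)
    (fun y _ => (h1 y).hasFDerivWithinAt (s := univ)) (fun y _ => by
      refine ContinuousLinearMap.opNorm_le_bound _ (by norm_num) fun e => ?_
      exact (h.variation_bounds hε hΛ hεC (t := t) (z := (y, η)) hz).1 e)
    convex_univ (x := y) (y := x) trivial trivial
  have e1 : (flow (hamField q) t (x, η)).1 - (flow (hamField q) t (y, η)).1 - (x - y)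
      = ((flow (hamField q) t (x, η)).1 - x) - ((flow (hamField q) t (y, η)).1 - y) := by abel
  simpa [e1] using h2

/-- The position map minus the identity has Lipschitz constant 1/2 on the whole space, so
injectivity and surjectivity are global and no properness argument is needed. -/
theorem bijective_position {t : ℝ} {η : E d} (hz : (t, ((0 : E d), η)) ∈ slab d) :
    Function.Bijective (fun y => (flow (hamField q) t (y, η)).1) := by
  have h1 := h.approximatesLinearOn hε hΛ hεC hz
  -- In dimension zero the identity has norm zero, so the comparison with its inverse norm is only
  -- available in positive dimension.
  have hc : Subsingleton (E d) ∨
      (1 / 2 : NNReal) < ‖((ContinuousLinearEquiv.refl ℝ (E d)).symm : E d →L[ℝ] E d)‖₊⁻¹ := by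
    rcases subsingleton_or_nontrivial (E d) with hs | hs
    · exact Or.inl hs
    · right
      have : ‖((ContinuousLinearEquiv.refl ℝ (E d)).symm : E d →L[ℝ] E d)‖₊ = 1 := by
        rw [← NNReal.coe_inj, coe_nnnorm]
        exact ContinuousLinearMap.norm_id
      rw [this, inv_one]
      exact NNReal.half_lt_self one_ne_zero
  exact ⟨fun x y hxy => h1.injOn hc trivial trivial hxy, h1.surjective hc⟩

theorem flow_basePoint {p : ℝ × (E d × E d)} (hp : p ∈ slab d) :
    (flow (hamField q) p.1 (basePoint q p, p.2.2)).1 = p.2.1 :=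
  Function.invFun_eq (f := fun y => (flow (hamField q) p.1 (y, p.2.2)).1)
    ((h.bijective_position hε hΛ hεC (t := p.1) (η := p.2.2) hp).2 p.2.1)

theorem basePoint_flow {t : ℝ} {y η : E d} (hp : (t, (y, η)) ∈ slab d) :
    basePoint q (t, ((flow (hamField q) t (y, η)).1, η)) = y :=
  Function.leftInverse_invFun (h.bijective_position hε hΛ hεC (t := t) (η := η) hp).1 y

/-- This is the inverse function theorem for `(t, y, η) ↦ (t, x(t, y, η), η)`. Its derivative is
triangular, and injective because the block for `y` is within 1/2 of the identity. -/
theorem contDiffAt_basePoint {p : ℝ × (E d × E d)} (hp : p ∈ slab d) :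
    ContDiffAt ℝ ∞ (basePoint q) p := by
  let F : ℝ × (E d × E d) → ℝ × (E d × E d) := fun p =>
    (p.1, ((flow (hamField q) p.1 p.2).1, p.2.2))
  have hF : ContDiff ℝ ∞ F := contDiff_fst.prodMk (h.contDiff_flow.fst.prodMk contDiff_snd.snd)
  let a : ℝ × (E d × E d) := (p.1, (basePoint q p, p.2.2))
  have ha : a ∈ slab d := hp
  have hFa : F a = p := by
    have := h.flow_basePoint hε hΛ hεC hp
    simp only [F, a, this]
  have hd : HasFDerivAt F ((ContinuousLinearMap.fst ℝ ℝ (E d × E d)).prod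
      (((ContinuousLinearMap.fst ℝ (E d) (E d)).comp
        ((ContinuousLinearMap.fst ℝ ℝ (E d × E d)).smulRight
          (hamField q (flow (hamField q) a.1 a.2))
        + (fderiv ℝ (flow (hamField q) a.1) a.2).comp
          (ContinuousLinearMap.snd ℝ ℝ (E d × E d)))).prod
        ((ContinuousLinearMap.snd ℝ (E d) (E d)).comp
          (ContinuousLinearMap.snd ℝ ℝ (E d × E d))))) a :=
    hasFDerivAt_fst.prodMk ((h.hasFDerivAt_flow_uncurry a).fst.prodMk hasFDerivAt_snd.snd)
  set D := ((ContinuousLinearMap.fst ℝ ℝ (E d × E d)).prod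
      (((ContinuousLinearMap.fst ℝ (E d) (E d)).comp
        ((ContinuousLinearMap.fst ℝ ℝ (E d × E d)).smulRight
          (hamField q (flow (hamField q) a.1 a.2))
        + (fderiv ℝ (flow (hamField q) a.1) a.2).comp
          (ContinuousLinearMap.snd ℝ ℝ (E d × E d)))).prod
        ((ContinuousLinearMap.snd ℝ (E d) (E d)).comp
          (ContinuousLinearMap.snd ℝ ℝ (E d × E d))))) with hD
  have hinj : Function.Injective D := by
    rw [injective_iff_map_eq_zero]
    rintro ⟨s, b, c⟩ hw
    simp only [hD, ContinuousLinearMap.prod_apply, ContinuousLinearMap.comp_apply,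
      ContinuousLinearMap.coe_fst', ContinuousLinearMap.coe_snd', Prod.mk_eq_zero,
      _root_.add_apply, ContinuousLinearMap.smulRight_apply] at hw
    obtain ⟨rfl, h2, rfl⟩ := hw
    rw [zero_smul, zero_add] at h2
    have h3 := (h.variation_bounds hε hΛ hεC ha).1 b
    rw [h2, zero_sub, norm_neg] at h3
    have : ‖b‖ = 0 := by linarith [norm_nonneg b]
    simp [norm_eq_zero.1 this]
  let L : (ℝ × (E d × E d)) ≃L[ℝ] (ℝ × (E d × E d)) :=
    (LinearEquiv.ofInjectiveEndo (D : (ℝ × (E d × E d)) →ₗ[ℝ] _) hinj).toContinuousLinearEquiv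
  have hL : (L : (ℝ × (E d × E d)) →L[ℝ] (ℝ × (E d × E d))) = D :=
    ContinuousLinearMap.ext fun _ => rfl
  have hdL : HasFDerivAt F (L : (ℝ × (E d × E d)) →L[ℝ] (ℝ × (E d × E d))) a := by rwa [hL]
  have hn : (∞ : WithTop ℕ∞) ≠ 0 := by simp
  let g := hF.contDiffAt.localInverse hdL hn
  have hg : ContDiffAt ℝ ∞ g (F a) := hF.contDiffAt.to_localInverse hdL hn
  have hst : HasStrictFDerivAt F (L : (ℝ × (E d × E d)) →L[ℝ] (ℝ × (E d × E d))) a :=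
    hF.contDiffAt.hasStrictFDerivAt' hdL hn
  have hr : ∀ᶠ y in 𝓝 (F a), F (g y) = y := hst.eventually_right_inverse
  have hga : g (F a) = a := hF.contDiffAt.localInverse_apply_image hdL hn
  rw [hFa] at hg hr hga
  refine ContDiffAt.congr_of_eventuallyEq (f := fun p => (g p).2.1) hg.snd.fst ?_
  have hs : ∀ᶠ y in 𝓝 p, g y ∈ slab d := hg.continuousAt.eventually
    (by rw [hga]; exact isOpen_slab.mem_nhds ha)
  -- The local inverse takes values in the slab near `p`, and there global injectivity forces it to
  -- agree with `basePoint`.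
  filter_upwards [hr, hs] with y hy hys
  have := h.basePoint_flow hε hΛ hεC (t := (g y).1) (y := (g y).2.1) (η := (g y).2.2) hys
  conv_lhs => rw [← hy]
  exact this

theorem contDiffAt_covector {p : ℝ × (E d × E d)} (hp : p ∈ slab d) :
    ContDiffAt ℝ ∞ (covector q) p := by
  have h1 := h.contDiffAt_basePoint hε hΛ hεC hp
  have h2 : ContDiffAt ℝ ∞ (fun p : ℝ × (E d × E d) => (p.1, (basePoint q p, p.2.2))) p :=
    contDiffAt_fst.prodMk (h1.prodMk contDiffAt_snd.snd)
  exact (h.contDiff_flow.contDiffAt.comp p h2).snd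

theorem contDiffAt_phase {p : ℝ × (E d × E d)} (hp : p ∈ slab d) :
    ContDiffAt ℝ ∞ (phase q) p :=
  (h.contDiffAt_basePoint hε hΛ hεC hp).inner ℝ contDiffAt_snd.snd

theorem phase_zero {x η : E d} (hp : ((0 : ℝ), (x, η)) ∈ slab d) :
    phase q (0, (x, η)) = inner ℝ x η := by
  have := h.flow_basePoint hε hΛ hεC hp
  rw [flow_zero] at this
  simp only at this
  simp [phase, this]

omit hε hΛ hεC in
theorem norm_covector_sub_le {p : ℝ × (E d × E d)} (hp : p ∈ slab d) :
    ‖covector q p - p.2.2‖ ≤ 2 * ε := h.norm_flow_snd_sub_le hp.1.le _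

theorem flow_basePoint_eq {p : ℝ × (E d × E d)} (hp : p ∈ slab d) :
    flow (hamField q) p.1 (basePoint q p, p.2.2) = (p.2.1, covector q p) := by
  ext1
  · exact h.flow_basePoint hε hΛ hεC hp
  · rfl

/-- The derivatives of the base point and of the covector. -/
theorem fderiv_basePoint {p : ℝ × (E d × E d)} (hp : p ∈ slab d) (w : ℝ × (E d × E d)) :
    w.1 • (hamField q (p.2.1, covector q p)) + fderiv ℝ (flow (hamField q) p.1)
      (basePoint q p, p.2.2) (fderiv ℝ (basePoint q) p w, w.2.2)
      = (w.2.1, fderiv ℝ (covector q) p w) := by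
  have hY := ((h.contDiffAt_basePoint hε hΛ hεC hp).differentiableAt (by simp)).hasFDerivAt
  have hP := ((h.contDiffAt_covector hε hΛ hεC hp).differentiableAt (by simp)).hasFDerivAt
  have h1 := (h.hasFDerivAt_flow_uncurry (p.1, (basePoint q p, p.2.2))).comp p
    ((hasFDerivAt_fst (𝕜 := ℝ) (p := p)).prodMk (hY.prodMk (hasFDerivAt_snd (𝕜 := ℝ) (p := p)).snd))
  have h2 := (hasFDerivAt_snd (𝕜 := ℝ) (p := p)).fst.prodMk hP
  have h3 := h1.congr_of_eventuallyEq (f₁ := fun p : ℝ × (E d × E d) => (p.2.1, covector q p)) (by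
    filter_upwards [isOpen_slab.mem_nhds hp] with p' hp'
    exact (h.flow_basePoint_eq hε hΛ hεC hp').symm)
  have h4 := DFunLike.congr_fun (h3.unique h2) w
  rw [← h.flow_basePoint_eq hε hΛ hεC hp]
  exact h4

/-- These are the generating function identities: the derivatives in `x`, `t` and `η` are the
covector, minus the Hamiltonian and the starting point. The variation of the starting point paired
with `η` is carried to time `t` by `inner_variation`, and Euler's identity turns the pairing of
covector and velocity into `q`. -/
theorem fderiv_phase {p : ℝ × (E d × E d)} (hp : p ∈ slab d) (w : ℝ × (E d × E d)) :
    fderiv ℝ (phase q) p w = inner ℝ (covector q p) w.2.1 - w.1 * q (p.2.1, covector q p)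
      + inner ℝ (basePoint q p) w.2.2 := by
  have hY := ((h.contDiffAt_basePoint hε hΛ hεC hp).differentiableAt (by simp)).hasFDerivAt
  have h1 := (hY.inner ℝ (hasFDerivAt_snd (𝕜 := ℝ) (p := p)).snd).fderiv
  have h2 : fderiv ℝ (phase q) p w = inner ℝ (basePoint q p) w.2.2
      + inner ℝ (fderiv ℝ (basePoint q) p w) p.2.2 := DFunLike.congr_fun h1 w
  have h3 := h.fderiv_basePoint hε hΛ hεC hp w
  have hp' : (p.1, (basePoint q p, p.2.2)) ∈ slab d := hp
  have h4 := h.inner_variation hε hp' (fderiv ℝ (basePoint q) p w, w.2.2)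
  have h5 := h.flow_mem_shell hε hp'
  rw [h.flow_basePoint_eq hε hΛ hεC hp] at h4 h5
  have h6 := h.homogeneous _ h5
  have h7 := congrArg (fun z => inner ℝ (covector q p) z.1) h3
  simp only [Prod.fst_add, Prod.smul_fst, inner_add_right, inner_smul_right, h4, hamField,
    h6] at h7
  rw [h2, real_inner_comm p.2.2 _, ← h7]
  ring

/-- Differentiating the identity `x(t, y, η) = x` expresses the variation of `y` through itself with
a factor 1/2, which is absorbed. The factor `|p.1|` in the `η` part is kept for the gain in time. -/
theorem norm_fderiv_basePoint_le {p : ℝ × (E d × E d)} (hp : p ∈ slab d) (z : E d × E d) :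
    ‖fderiv ℝ (basePoint q) p (0, z)‖ ≤ 2 * ‖z.1‖ + 8 * Λ * varConst Λ * |p.1| * ‖z.2‖ := by
  have h1 := h.fderiv_basePoint hε hΛ hεC hp (0, z)
  have hp' : (p.1, (basePoint q p, p.2.2)) ∈ slab d := hp
  obtain ⟨b1, -, b3⟩ := h.variation_bounds hε hΛ hεC hp'
  set y := fderiv ℝ (basePoint q) p (0, z)
  have h2 : ((y, z.2) : E d × E d) = (y, 0) + (0, z.2) := by simp
  rw [zero_smul, zero_add, h2, map_add] at h1
  have h3 := congrArg Prod.fst h1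
  simp only [Prod.fst_add] at h3
  have c1 := b1 y
  have c3 := b3 z.2
  have c4 : ‖y‖ ≤ ‖(fderiv ℝ (flow (hamField q) p.1) (basePoint q p, p.2.2) (y, 0)).1 - y‖
      + ‖z.1‖ + ‖(fderiv ℝ (flow (hamField q) p.1) (basePoint q p, p.2.2) (0, z.2)).1‖ := by
    have : y = -((fderiv ℝ (flow (hamField q) p.1) (basePoint q p, p.2.2) (y, 0)).1 - y)
      + z.1 - (fderiv ℝ (flow (hamField q) p.1) (basePoint q p, p.2.2) (0, z.2)).1 := by
      rw [← h3]; abel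
    calc ‖y‖ = _ := congrArg norm this
      _ ≤ _ := (norm_sub_le _ _).trans (add_le_add_left ((norm_add_le _ _).trans (by rw [norm_neg])) _)
  linarith

theorem norm_fderiv_covector_le {p : ℝ × (E d × E d)} (hp : p ∈ slab d) (z : E d × E d) :
    ‖fderiv ℝ (covector q) p (0, z)‖ ≤ 60 * Λ * varConst Λ ^ 2 * ‖z‖ := by
  have h1 := h.fderiv_basePoint hε hΛ hεC hp (0, z)
  have hp' : (p.1, (basePoint q p, p.2.2)) ∈ slab d := hp
  obtain ⟨-, b2, -⟩ := h.variation_bounds hε hΛ hεC hp'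
  have h2 := h.norm_fderiv_basePoint_le hε hΛ hεC hp z
  rw [zero_smul, zero_add] at h1
  have h3 := congrArg Prod.snd h1
  simp only at h3
  rw [← h3]
  refine (b2 _).trans ?_
  have hC := one_le_varConst hΛ
  have ht : |p.1| ≤ 2 := hp.1.le
  have n1 := norm_fst_le z
  have n2 := norm_snd_le z
  have hCΛ : 1 ≤ Λ * varConst Λ := by nlinarith
  have h4 : ‖fderiv ℝ (basePoint q) p (0, z)‖ + ‖z.2‖ ≤ 19 * (Λ * varConst Λ) * ‖z‖ := by
    have e1 : 8 * Λ * varConst Λ * |p.1| * ‖z.2‖ ≤ 8 * Λ * varConst Λ * 2 * ‖z‖ := by gcongr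
    nlinarith [norm_nonneg z]
  calc _ ≤ 3 * varConst Λ * (19 * (Λ * varConst Λ) * ‖z‖) := by gcongr
    _ ≤ _ := by
      have : 0 ≤ Λ * varConst Λ ^ 2 * ‖z‖ := by positivity
      nlinarith

/-- The trajectories of the Hamiltonian flow are the characteristics of the solution. -/
theorem exists_characteristic {p : ℝ × (E d × E d)} (hp : p ∈ slab d) :
    ∃ γ : ℝ → E d, γ p.1 = p.2.1 ∧ ∀ t, |t| < 2 →
      HasDerivAt γ (gradXi q (γ t, covector q (t, (γ t, p.2.2)))) t := by
  refine ⟨fun t => (flow (hamField q) t (basePoint q p, p.2.2)).1,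
    h.flow_basePoint hε hΛ hεC hp, fun t ht => ?_⟩
  have hs : (t, (basePoint q p, p.2.2)) ∈ slab d := ⟨ht, hp.2⟩
  have h1 := h.basePoint_flow hε hΛ hεC hs
  have h2 : HasDerivAt (fun t => (flow (hamField q) t (basePoint q p, p.2.2)).1)
    (hamField q (flow (hamField q) t (basePoint q p, p.2.2))).1 t :=
    (h.hasDerivAt_flow t (basePoint q p, p.2.2)).fst
  refine h2.congr_deriv ?_
  simp only [covector, h1, hamField]

end

end IsAdmissible

end LocalSolution

end EikonalBounds

namespace EikonalBounds

/-! ### Propagation of higher derivatives along characteristics -/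

section Transport

open Set Filter Topology

variable {d : ℕ}

/-- The map `(x, η) ↦ (a x, b η)`. -/
noncomputable def scale (d : ℕ) (a b : ℝ) : E d × E d →L[ℝ] E d × E d :=
  (a • ContinuousLinearMap.fst ℝ (E d) (E d)).prod (b • ContinuousLinearMap.snd ℝ (E d) (E d))

@[simp]
theorem scale_apply (a b : ℝ) (z : E d × E d) : scale d a b z = (a • z.1, b • z.2) := rfl

/-- The vector which represents a linear form. -/
noncomputable def dualVec (d : ℕ) : (E d →L[ℝ] ℝ) →L[ℝ] E d :=
  LinearMap.toContinuousLinearMap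
    { toFun := fun l => (InnerProductSpace.toDual ℝ (E d)).symm l
      map_add' := fun _ _ => map_add _ _ _
      map_smul' := fun _ _ => by simp }

theorem dualVec_apply (l : E d →L[ℝ] ℝ) :
    dualVec d l = (InnerProductSpace.toDual ℝ (E d)).symm l := rfl

theorem dualVec_eq {l : E d →L[ℝ] ℝ} {v : E d} (h : ∀ u, l u = inner ℝ v u) : dualVec d l = v := by
  refine ext_inner_right ℝ fun u => ?_
  rw [dualVec_apply, InnerProductSpace.toDual_symm_apply, h]

/-- An admissible Hamiltonian whose derivatives satisfy the bounds for a Hamiltonian with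
coefficients which are regularized at scale `r`. -/
structure IsRegularized (q : E d × E d → ℝ) (M : E d × E d → E d →L[ℝ] E d) (ε Λ r : ℝ)
    (K : ℕ → ℝ) : Prop extends IsAdmissible q M ε Λ where
  eps_le : ε ≤ 1 / 16
  one_le : 1 ≤ Λ
  varConst_mul_le : varConst Λ * ε ≤ 1 / 2
  pos : 0 < r
  second_le : ∀ δ, r ≤ δ → δ ≤ 1 → ∀ z a b, a.1 = 0 ∨ b.1 = 0 →
    ‖fderiv ℝ (fderiv ℝ (q ∘ scale d r δ)) z a b‖ ≤ K 2 * δ ^ 2 * (‖a‖ * ‖b‖)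
  higher_le : ∀ δ, r ≤ δ → δ ≤ 1 → ∀ n, 3 ≤ n → ∀ z,
    ‖iteratedFDeriv ℝ n (q ∘ scale d r δ) z‖ ≤ K n * δ ^ 2

namespace IsRegularized

variable {q : E d × E d → ℝ} {M : E d × E d → E d →L[ℝ] E d} {ε Λ r : ℝ} {K : ℕ → ℝ}

/-- The phase as a function of the time and the scaled variables. -/
noncomputable def scaledPhase (q : E d × E d → ℝ) (r δ : ℝ) (p : ℝ × (E d × E d)) : ℝ :=
  phase q (p.1, scale d r δ p.2)

/-- The point of phase space, in scaled variables, at which the Hamiltonian is evaluated in the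
eikonal equation. -/
noncomputable def scaledGraph (q : E d × E d → ℝ) (r δ t : ℝ) (z : E d × E d) : E d × E d :=
  (z.1, δ⁻¹ • covector q (t, scale d r δ z))

variable (h : IsRegularized q M ε Λ r K)
include h

theorem contDiffAt_scaledPhase {δ : ℝ} {p : ℝ × (E d × E d)}
    (hp : (p.1, scale d r δ p.2) ∈ slab d) : ContDiffAt ℝ ∞ (scaledPhase q r δ) p := by
  have h1 : ContDiff ℝ ∞ (fun p : ℝ × (E d × E d) => (p.1, scale d r δ p.2)) :=
    contDiff_fst.prodMk ((scale d r δ).contDiff.comp contDiff_snd)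
  exact (h.contDiffAt_phase h.eps_le h.one_le h.varConst_mul_le hp).comp p h1.contDiffAt

theorem fderiv_scaledPhase {δ : ℝ} {p : ℝ × (E d × E d)}
    (hp : (p.1, scale d r δ p.2) ∈ slab d) (w : ℝ × (E d × E d)) :
    fderiv ℝ (scaledPhase q r δ) p w = r * inner ℝ (covector q (p.1, scale d r δ p.2)) w.2.1
      - w.1 * q (r • p.2.1, covector q (p.1, scale d r δ p.2))
      + δ * inner ℝ (basePoint q (p.1, scale d r δ p.2)) w.2.2 := by
  have h1 := ((h.contDiffAt_phase h.eps_le h.one_le h.varConst_mul_le hp).differentiableAt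
    (by simp)).hasFDerivAt
  have h2 : HasFDerivAt (fun p : ℝ × (E d × E d) => (p.1, scale d r δ p.2))
      ((ContinuousLinearMap.fst ℝ ℝ (E d × E d)).prod ((scale d r δ).comp
        (ContinuousLinearMap.snd ℝ ℝ (E d × E d)))) p :=
    hasFDerivAt_fst.prodMk ((scale d r δ).hasFDerivAt.comp p hasFDerivAt_snd)
  have h3 : HasFDerivAt (scaledPhase q r δ) _ p := h1.comp p h2
  rw [h3.fderiv, ContinuousLinearMap.comp_apply,
    h.fderiv_phase h.eps_le h.one_le h.varConst_mul_le hp]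
  simp [inner_smul_right]

theorem contDiffAt_scaledGraph {δ t : ℝ} {z : E d × E d}
    (hp : (t, scale d r δ z) ∈ slab d) : ContDiffAt ℝ ∞ (scaledGraph q r δ t) z := by
  have h1 : ContDiff ℝ ∞ (fun z : E d × E d => (t, scale d r δ z)) :=
    contDiff_const.prodMk (scale d r δ).contDiff
  have h2 := (h.contDiffAt_covector h.eps_le h.one_le h.varConst_mul_le hp).comp z h1.contDiffAt
  exact contDiffAt_fst.prodMk (show ContDiffAt ℝ ∞
    (fun z : E d × E d => δ⁻¹ • covector q (t, scale d r δ z)) z from h2.const_smul δ⁻¹)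

omit h in
theorem eventually_mem_slab {δ t : ℝ} {z : E d × E d} (hp : (t, scale d r δ z) ∈ slab d) :
    ∀ᶠ y in 𝓝 z, (t, scale d r δ y) ∈ slab d := by
  have h1 : Continuous (fun z : E d × E d => (t, scale d r δ z)) :=
    continuous_const.prodMk (scale d r δ).continuous
  exact h1.continuousAt.eventually (isOpen_slab.mem_nhds hp)

theorem iteratedFDeriv_scaledGraph_fst {δ t : ℝ} {z : E d × E d}
    (hp : (t, scale d r δ z) ∈ slab d) {m : ℕ} (hm : 2 ≤ m) (v : Fin m → E d × E d) :
    (iteratedFDeriv ℝ m (scaledGraph q r δ t) z v).1 = 0 := by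
  have h1 := (ContinuousLinearMap.fst ℝ (E d) (E d)).iteratedFDeriv_comp_left
    (h.contDiffAt_scaledGraph hp) (natCast_le_infty m)
  have h2 : (ContinuousLinearMap.fst ℝ (E d) (E d)) ∘ scaledGraph q r δ t
      = ContinuousLinearMap.fst ℝ (E d) (E d) := rfl
  rw [h2, iteratedFDeriv_clm _ hm] at h1
  exact (DFunLike.congr_fun h1 v).symm

/-- The covector is the gradient of the phase in `x`, so near `z` the graph is a linear map plus a
linear image of the derivative of the scaled phase. The two inverse factors undo the scaling of `x`
and normalize the covector. -/
theorem norm_iteratedFDeriv_scaledGraph_le {δ t : ℝ} (hδ : 0 < δ) {z : E d × E d}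
    (hp : (t, scale d r δ z) ∈ slab d) {m : ℕ} (hm : 2 ≤ m) :
    ‖iteratedFDeriv ℝ m (scaledGraph q r δ t) z‖ ≤
      δ⁻¹ * (r⁻¹ * ‖iteratedFDeriv ℝ (m + 1) (fun y => scaledPhase q r δ (t, y)) z‖) := by
  have hs : ContDiffAt ℝ ∞ (fun y => scaledPhase q r δ (t, y)) z :=
    (h.contDiffAt_scaledPhase (p := (t, z)) hp).comp z
      (contDiff_const.prodMk contDiff_id).contDiffAt
  have hs' : ContDiffAt ℝ ∞ (fderiv ℝ (fun y => scaledPhase q r δ (t, y))) z := contDiffAt_fderiv hs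
  let R : (E d × E d →L[ℝ] ℝ) →L[ℝ] E d :=
    (dualVec d).comp ((ContinuousLinearMap.compL ℝ (E d) (E d × E d) ℝ).flip
      (ContinuousLinearMap.inl ℝ (E d) (E d)))
  have hR : ‖R‖ ≤ 1 := by
    refine ContinuousLinearMap.opNorm_le_bound _ zero_le_one fun l => ?_
    have e1 : R l = dualVec d (l.comp (ContinuousLinearMap.inl ℝ (E d) (E d))) := rfl
    rw [e1, dualVec_apply, LinearIsometryEquiv.norm_map]
    refine (ContinuousLinearMap.opNorm_comp_le _ _).trans ?_
    rw [mul_comm]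
    gcongr
    exact ContinuousLinearMap.norm_inl_le_one ℝ (E d) (E d)
  let L2 : (E d × E d →L[ℝ] ℝ) →L[ℝ] E d × E d :=
    (δ⁻¹ * r⁻¹) • (ContinuousLinearMap.inr ℝ (E d) (E d)).comp R
  have hL2 : ‖L2‖ ≤ δ⁻¹ * r⁻¹ := by
    have hr := h.pos
    refine ContinuousLinearMap.opNorm_le_bound _ (by positivity) fun l => ?_
    change ‖(δ⁻¹ * r⁻¹) • ((0 : E d), R l)‖ ≤ _
    rw [norm_smul, Real.norm_of_nonneg (by positivity), Prod.norm_def, norm_zero,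
      max_eq_right (norm_nonneg _)]
    gcongr
    exact (R.le_of_opNorm_le hR l).trans_eq (one_mul _)
  let L1 : E d × E d →L[ℝ] E d × E d :=
    (ContinuousLinearMap.inl ℝ (E d) (E d)).comp (ContinuousLinearMap.fst ℝ (E d) (E d))
  have hev : scaledGraph q r δ t =ᶠ[𝓝 z]
      (L1 : E d × E d → E d × E d) + L2 ∘ fderiv ℝ (fun y => scaledPhase q r δ (t, y)) := by
    filter_upwards [eventually_mem_slab hp] with y hy
    have h1 := hasFDerivAt_slice (p := (t, y))
      ((h.contDiffAt_scaledPhase (p := (t, y)) hy).differentiableAt (by simp))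
    have h2 : R (fderiv ℝ (fun y => scaledPhase q r δ (t, y)) y)
        = r • covector q (t, scale d r δ y) := by
      refine dualVec_eq fun u => ?_
      have h3 := h.fderiv_scaledPhase (p := (t, y)) hy (0, (u, 0))
      simp only at h1
      change fderiv ℝ (fun y => scaledPhase q r δ (t, y)) y (u, 0) = _
      rw [h1.fderiv, inner_smul_left]
      simpa using h3
    have hr := h.pos.ne'
    simp only [Pi.add_apply, Function.comp_apply, L2, _root_.smul_apply,
      ContinuousLinearMap.comp_apply, h2, L1, ContinuousLinearMap.coe_fst',
      ContinuousLinearMap.inl_apply, ContinuousLinearMap.inr_apply, scaledGraph, Prod.smul_mk,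
      smul_zero, Prod.mk_add_mk, add_zero, zero_add, smul_smul]
    rw [mul_assoc, inv_mul_cancel₀ hr, mul_one]
  rw [(hev.iteratedFDeriv ℝ m).eq_of_nhds, iteratedFDeriv_add_apply L1.contDiff.contDiffAt
    (L2.contDiff.contDiffAt.comp z (hs'.of_le (natCast_le_infty m))), iteratedFDeriv_clm L1 hm,
    zero_add]
  refine (L2.norm_iteratedFDeriv_comp_left hs' (natCast_le_infty m)).trans ?_
  rw [norm_iteratedFDeriv_fderiv, ← mul_assoc]
  gcongr

/-- The assumption `r ≤ δ` bounds the scaling map by `δ`, which the factor `δ⁻¹` in the graph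
cancels. -/
theorem norm_fderiv_scaledGraph_le {δ t : ℝ} (hδ : 0 < δ) (hrδ : r ≤ δ) {z : E d × E d}
    (hp : (t, scale d r δ z) ∈ slab d) :
    ‖fderiv ℝ (scaledGraph q r δ t) z‖ ≤ 60 * Λ * varConst Λ ^ 2 := by
  have hC := one_le_varConst h.one_le
  have hΛ := h.one_le
  have h1C : 1 ≤ 60 * Λ * varConst Λ ^ 2 := by nlinarith [sq_nonneg (varConst Λ - 1)]
  refine ContinuousLinearMap.opNorm_le_bound _ (by linarith) fun v => ?_
  have h1 := ((h.contDiffAt_covector h.eps_le h.one_le h.varConst_mul_le hp).differentiableAt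
    (by simp)).hasFDerivAt
  have h2 : HasFDerivAt (fun z : E d × E d => (t, scale d r δ z))
      ((0 : E d × E d →L[ℝ] ℝ).prod (scale d r δ)) z :=
    (hasFDerivAt_const t z).prodMk (scale d r δ).hasFDerivAt
  have h3 := HasFDerivAt.comp (f := fun z : E d × E d => (t, scale d r δ z)) z h1 h2
  have h4 : HasFDerivAt (scaledGraph q r δ t) _ z :=
    (hasFDerivAt_fst (𝕜 := ℝ) (p := z)).prodMk (h3.const_smul δ⁻¹)
  rw [h4.fderiv]
  have h5 := h.norm_fderiv_covector_le h.eps_le h.one_le h.varConst_mul_le hp (scale d r δ v)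
  have h6 : ‖scale d r δ v‖ ≤ δ * ‖v‖ := by
    rw [scale_apply, Prod.norm_def, norm_smul, norm_smul, Real.norm_of_nonneg h.pos.le,
      Real.norm_of_nonneg hδ.le]
    exact max_le (mul_le_mul hrδ (norm_fst_le v) (norm_nonneg _) hδ.le)
      (mul_le_mul_of_nonneg_left (norm_snd_le v) hδ.le)
  rw [ContinuousLinearMap.prod_apply, Prod.norm_def]
  refine max_le ((norm_fst_le v).trans (le_mul_of_one_le_left (norm_nonneg _) h1C)) ?_
  change ‖δ⁻¹ • fderiv ℝ (covector q) (t, scale d r δ z) (0, scale d r δ v)‖ ≤ _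
  rw [norm_smul, Real.norm_of_nonneg (by positivity)]
  calc _ ≤ δ⁻¹ * (60 * Λ * varConst Λ ^ 2 * (δ * ‖v‖)) := by gcongr; exact h5.trans (by gcongr)
    _ = _ := by field_simp

/-- The derivative of the phase along a characteristic, near a point of the characteristic. -/
theorem fderiv_scaledPhase_characteristic {δ t : ℝ} (hδ : 0 < δ) {z₀ : E d × E d}
    {z : E d × E d} (hp : (t, scale d r δ z) ∈ slab d) :
    fderiv ℝ (scaledPhase q r δ) (t, z)
      (1, (r⁻¹ • gradXi q (scale d r δ (scaledGraph q r δ t z₀)), 0)) =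
    -(((q ∘ scale d r δ) - (fderiv ℝ (q ∘ scale d r δ) (scaledGraph q r δ t z₀) : _ → ℝ))
        ∘ scaledGraph q r δ t) z
    - (fderiv ℝ (q ∘ scale d r δ) (scaledGraph q r δ t z₀)).comp
        ((ContinuousLinearMap.inl ℝ (E d) (E d)).comp (ContinuousLinearMap.fst ℝ (E d) (E d))) z := by
  have hr := h.pos.ne'
  rw [h.fderiv_scaledPhase (p := (t, z)) hp]
  have h1 : ∀ v, fderiv ℝ (q ∘ scale d r δ) (scaledGraph q r δ t z₀) v
      = fderiv ℝ q (scale d r δ (scaledGraph q r δ t z₀)) (scale d r δ v) := fun v => by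
    rw [fderiv_comp _ ((h.smooth.differentiable (by simp)) _) (scale d r δ).differentiableAt,
      ContinuousLinearMap.fderiv, ContinuousLinearMap.comp_apply]
  have h2 : scale d r δ (scaledGraph q r δ t z)
      = (r • z.1, covector q (t, scale d r δ z)) := by
    simp [scaledGraph, smul_smul, hδ.ne']
  simp only [Function.comp_apply, Pi.sub_apply, h1, h2, ContinuousLinearMap.comp_apply,
    inner_smul_right, inner_zero_right, mul_zero, add_zero, one_mul, ContinuousLinearMap.coe_fst',
    ContinuousLinearMap.inl_apply]
  -- The direction is frozen at `z₀`, so pairing it with the covector at `z` evaluates the linear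
  -- map `D(q ∘ scale)`, frozen at the graph point of `z₀`, at the graph point of `z`. It thereby
  -- subtracts the linear part of the Hamiltonian, up to a term linear in `z`.
  rw [← mul_assoc, mul_inv_cancel₀ hr, one_mul, real_inner_comm, inner_gradXi]
  have h3 : ((r • z.1, covector q (t, scale d r δ z)) : E d × E d)
      = (0, covector q (t, scale d r δ z)) + scale d r δ (z.1, 0) := by simp
  conv_rhs => rw [h3, map_add]
  simp only [← h3]
  ring

/-- Along a characteristic the derivative of order `n` satisfies a linear inequality with rate `κ *
δ² / r²` and source `κ * δ²`. With `δ = r / τ` and times up to `τ²`, the accumulated rate is at most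
`κ` and the accumulated source at most `κ * r²`. -/
theorem norm_iteratedFDeriv_step {n : ℕ} (hn : 3 ≤ n) {A : ℝ} (hA : 1 ≤ A)
    (hA0 : 60 * Λ * varConst Λ ^ 2 ≤ A) (hK : ∀ m, 2 ≤ m → m ≤ n → K m ≤ A) {τ : ℝ} (hrτ : r ≤ τ) (hτ1 : τ ≤ 1)
    (hlow : ∀ m, 3 ≤ m → m < n → ∀ t z, 0 ≤ t → t ≤ τ ^ 2 → (t, scale d r (r / τ) z) ∈ slab d →
      ‖iteratedFDeriv ℝ m (fun y => scaledPhase q r (r / τ) (t, y)) z‖ ≤ A * r ^ 2)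
    {T : ℝ} (hT0 : 0 ≤ T) (hT : T ≤ τ ^ 2) {z : E d × E d}
    (hz : (T, scale d r (r / τ) z) ∈ slab d) :
    ‖iteratedFDeriv ℝ n (fun y => scaledPhase q r (r / τ) (T, y)) z‖ ≤
      Fintype.card (OrderedFinpartition n) * (A * A ^ n) *
        Real.exp (Fintype.card (OrderedFinpartition n) * (A * A ^ n) + 1) * r ^ 2 := by
  have hr := h.pos
  have hτ : 0 < τ := hr.trans_le hrτ
  set δ := r / τ with hδd
  have hδ : 0 < δ := by positivity
  have hrδ : r ≤ δ := by rw [hδd, le_div_iff₀ hτ]; nlinarith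
  have hδ1 : δ ≤ 1 := by rw [hδd, div_le_one hτ]; exact hrτ
  set κ : ℝ := Fintype.card (OrderedFinpartition n) * (A * A ^ n) with hκ
  have hκ0 : 0 ≤ κ := by positivity
  obtain ⟨g, hg0, hg⟩ := h.exists_characteristic h.eps_le h.one_le h.varConst_mul_le hz
  let Ω : Set (ℝ × (E d × E d)) := {p | (p.1, scale d r δ p.2) ∈ slab d}
  have hΩ : IsOpen Ω := isOpen_slab.preimage
    (continuous_fst.prodMk ((scale d r δ).continuous.comp continuous_snd))
  let γ : ℝ → E d × E d := fun t => (r⁻¹ • g t, z.2)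
  have hLγ : ∀ t, scale d r δ (γ t) = (g t, δ • z.2) := fun t => by
    simp [γ, smul_smul, hr.ne']
  have hγΩ : ∀ t, |t| < 2 → (t, γ t) ∈ Ω := fun t ht => by
    change (t, scale d r δ (γ t)) ∈ slab d
    rw [hLγ]; exact ⟨ht, hz.2⟩
  have hLs : ∀ t, scale d r δ (scaledGraph q r δ t (γ t))
      = (g t, covector q (t, (g t, δ • z.2))) := fun t => by
    simp [scaledGraph, hLγ, smul_smul, hδ.ne', γ, hr.ne']
  have hγ : ∀ t, |t| < 2 → HasDerivAt γ
      (r⁻¹ • gradXi q (scale d r δ (scaledGraph q r δ t (γ t))), 0) t := fun t ht => by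
    rw [hLs]
    exact ((hg t ht).const_smul r⁻¹).prodMk (hasDerivAt_const t z.2)
  have hγT : γ T = z := by
    ext1
    · simp only [γ, hg0, scale_apply, smul_smul, inv_mul_cancel₀ hr.ne', one_smul]
    · rfl
  let Θ : ℝ → (E d × E d) [×n]→L[ℝ] ℝ := fun t =>
    iteratedFDeriv ℝ n (fun y => scaledPhase q r δ (t, y)) (γ t)
  let Θ' : ℝ → (E d × E d) [×n]→L[ℝ] ℝ := fun t =>
    iteratedFDeriv ℝ n (fun y => fderiv ℝ (scaledPhase q r δ) (t, y)
      (1, (r⁻¹ • gradXi q (scale d r δ (scaledGraph q r δ t (γ t))), 0))) (γ t)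
  have hΘ : ∀ t, |t| < 2 → HasDerivAt Θ (Θ' t) t := fun t ht =>
    hasDerivAt_iteratedFDeriv_curve n hΩ (fun p hp => h.contDiffAt_scaledPhase hp) (hγ t ht)
      (hγΩ t ht)
  have hΘ' : ∀ t, 0 ≤ t → t ≤ τ ^ 2 → |t| < 2 →
      ‖Θ' t‖ ≤ κ * δ ^ 2 * (1 + (r ^ 2)⁻¹ * ‖Θ t‖) := by
    intro t ht0 htτ ht
    have hs := hγΩ t ht
    set w₀ := scaledGraph q r δ t (γ t)
    set P := q ∘ scale d r δ
    have hP : ContDiff ℝ ∞ P := h.smooth.comp (scale d r δ).contDiff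
    let D := fderiv ℝ P w₀
    have hg1 : ContDiff ℝ ∞ (P - (D : E d × E d → ℝ)) := hP.sub D.contDiff
    have hGr := h.contDiffAt_scaledGraph hs
    have hev : (fun y => fderiv ℝ (scaledPhase q r δ) (t, y)
        (1, (r⁻¹ • gradXi q (scale d r δ w₀), 0))) =ᶠ[𝓝 (γ t)]
        (-((P - (D : E d × E d → ℝ)) ∘ scaledGraph q r δ t)) -
          (D.comp ((ContinuousLinearMap.inl ℝ (E d) (E d)).comp
            (ContinuousLinearMap.fst ℝ (E d) (E d))) : E d × E d → ℝ) := by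
      filter_upwards [eventually_mem_slab hs] with y hy
      exact h.fderiv_scaledPhase_characteristic hδ hy
    have hcs : ContDiffAt ℝ ∞ ((P - (D : E d × E d → ℝ)) ∘ scaledGraph q r δ t) (γ t) :=
      hg1.contDiffAt.comp _ hGr
    have e1 : Θ' t = -iteratedFDeriv ℝ n ((P - (D : E d × E d → ℝ)) ∘ scaledGraph q r δ t) (γ t) := by
      have hneg : ContDiffAt ℝ n (-((P - (D : E d × E d → ℝ)) ∘ scaledGraph q r δ t)) (γ t) :=
        (hcs.of_le (natCast_le_infty n)).neg
      simp only [Θ']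
      rw [(hev.iteratedFDeriv ℝ n).eq_of_nhds, iteratedFDeriv_sub_apply
        hneg (ContinuousLinearMap.contDiff _).contDiffAt,
        iteratedFDeriv_clm _ (by omega), sub_zero, iteratedFDeriv_neg_apply]
    rw [e1, norm_neg]
    have hfd : fderiv ℝ (P - (D : E d × E d → ℝ)) = fun y => fderiv ℝ P y - D := by
      ext1 y
      rw [fderiv_sub ((hP.differentiable (by simp)) y) D.differentiableAt, D.fderiv]
    have hpos : 0 ≤ (r ^ 2)⁻¹ * ‖Θ t‖ := by positivity
    -- The set `S` consists of the vectors without position component. Second and higher derivatives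
    -- of the graph lie in it, so only those entries of the Hessian of the Hamiltonian occur that
    -- have at least one covector argument.
    have key := norm_iteratedFDeriv_comp_le_linear (x := γ t) hg1.contDiffAt hGr hn
      (K := A * δ ^ 2) (A := A) (N := 1 + (r ^ 2)⁻¹ * ‖Θ t‖) (S := {w | w.1 = 0})
      (by positivity) hA (by linarith)
      (by rw [hfd]; simp [D, w₀])
      (fun a b hab => by
        rw [hfd, fderiv_sub_const]
        refine (h.second_le δ hrδ hδ1 _ a b hab).trans ?_
        gcongr
        exact hK 2 le_rfl (by omega))
      (fun m hm3 hm => by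
        rw [iteratedFDeriv_sub_apply (hP.of_le (natCast_le_infty m)).contDiffAt
          D.contDiff.contDiffAt, iteratedFDeriv_clm _ (by omega), sub_zero]
        refine (h.higher_le δ hrδ hδ1 m hm3 _).trans ?_
        gcongr
        exact hK m (by omega) hm)
      (fun m hm v => h.iteratedFDeriv_scaledGraph_fst hs hm v)
      (fun m hm1 hm => by
        rcases hm1.eq_or_lt with rfl | hm1
        · rw [← norm_iteratedFDeriv_fderiv, norm_iteratedFDeriv_zero]
          exact (h.norm_fderiv_scaledGraph_le hδ hrδ hs).trans hA0
        · refine (h.norm_iteratedFDeriv_scaledGraph_le hδ hs hm1).trans ?_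
          have h1 := hlow (m + 1) (by omega) (by omega) t (γ t) ht0 htτ hs
          -- A derivative of the graph of order `m` costs a derivative of the phase of order `m + 1
          -- < n`, already bounded by `A * r²`; since `δ * r = r² / τ`, the result is `A * τ ≤ A`.
          calc _ ≤ δ⁻¹ * (r⁻¹ * (A * r ^ 2)) := by gcongr
            _ = A * τ := by rw [hδd]; field_simp
            _ ≤ A := by nlinarith)
      (fun m hm => by
        refine (h.norm_iteratedFDeriv_scaledGraph_le hδ hs (by omega)).trans ?_
        subst hm
        change δ⁻¹ * (r⁻¹ * ‖Θ t‖) ≤ _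
        calc _ = (r ^ 2)⁻¹ * ‖Θ t‖ * τ := by rw [hδd]; field_simp
          _ ≤ (r ^ 2)⁻¹ * ‖Θ t‖ * 1 := by gcongr
          _ ≤ 1 * (1 + (r ^ 2)⁻¹ * ‖Θ t‖) := by linarith
          _ ≤ _ := by gcongr)
    refine key.trans (le_of_eq ?_)
    rw [hκ]; ring
  -- The initial phase is bilinear in `(x, η)`, so its derivatives of order at least three vanish.
  have hΘ0 : Θ 0 = 0 := by
    have hs := hγΩ 0 (by simp)
    let B : E d →L[ℝ] E d →L[ℝ] ℝ := (r * δ) • (isBoundedBilinearMap_inner (𝕜 := ℝ) (E := E d)).toContinuousLinearMap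
    have hev : (fun y => scaledPhase q r δ (0, y)) =ᶠ[𝓝 (γ 0)] fun y => B y.1 y.2 := by
      filter_upwards [eventually_mem_slab hs] with y hy
      have h1 := h.phase_zero h.eps_le h.one_le h.varConst_mul_le (x := r • y.1) (η := δ • y.2) hy
      have h2 : B y.1 y.2 = r * δ * inner ℝ y.1 y.2 := rfl
      rw [h2, scaledPhase, scale_apply, h1, inner_smul_left, inner_smul_right]
      simp; ring
    simp only [Θ]
    rw [(hev.iteratedFDeriv ℝ n).eq_of_nhds, iteratedFDeriv_bilinear B hn]
  have hT2 : T < 2 := (le_abs_self T).trans_lt hz.1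
  have hsT : ∀ s ∈ Icc (0 : ℝ) 1, 0 ≤ s * T ∧ s * T ≤ τ ^ 2 ∧ |s * T| < 2 := fun s hs => by
    have h1 : 0 ≤ s * T := mul_nonneg hs.1 hT0
    have h2 : s * T ≤ T := mul_le_of_le_one_left hT0 hs.2
    exact ⟨h1, h2.trans hT, by rw [abs_of_nonneg h1]; linarith⟩
  have hfin := norm_le_of_deriv_le (f := fun s => Θ (s * T)) (f' := fun s => T • Θ' (s * T))
    (δ := 0) (K := κ) (ε := κ * r ^ 2) hκ0 (by positivity) le_rfl
    (fun s hs => (HasDerivAt.scomp (g₁ := Θ) s (hΘ _ (hsT s hs).2.2)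
      (by simpa using (hasDerivAt_id s).mul_const T)).hasDerivWithinAt)
    (by simp [hΘ0])
    (fun s hs => by
      obtain ⟨a1, a2, a3⟩ := hsT s hs
      rw [norm_smul, Real.norm_of_nonneg hT0]
      calc _ ≤ τ ^ 2 * (κ * δ ^ 2 * (1 + (r ^ 2)⁻¹ * ‖Θ (s * T)‖)) := by
            gcongr; exact hΘ' _ a1 a2 a3
        _ = _ := by rw [hδd]; field_simp; ring) 1 (by simp)
  simp only [one_mul, zero_add, Θ, hγT] at hfin
  refine hfin.trans (le_of_eq (by ring))

end IsRegularized

/-- Bounds for the derivatives of order at least three of the phase in the scaled variables. -/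
theorem exists_bound_scaledPhase (d : ℕ) (Λ : ℝ) (K : ℕ → ℝ) (n : ℕ) : ∃ C : ℝ, 1 ≤ C ∧
    ∀ {q : E d × E d → ℝ} {M : E d × E d → E d →L[ℝ] E d} {ε r : ℝ},
      IsRegularized q M ε Λ r K → ∀ τ, r ≤ τ → τ ≤ 1 → ∀ m, 3 ≤ m → m < n → ∀ t z, 0 ≤ t →
      t ≤ τ ^ 2 → (t, scale d r (r / τ) z) ∈ slab d →
      ‖iteratedFDeriv ℝ m (fun y => phase q (t, scale d r (r / τ) y)) z‖ ≤ C * r ^ 2 := by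
  induction n with
  | zero => exact ⟨1, le_rfl, fun _ _ _ _ m _ hm => by omega⟩
  | succ n ih =>
    obtain ⟨C, hC1, hC⟩ := ih
    -- One constant dominates the inductive bound, the bound for the first derivative of the graph
    -- and the constants `K m` for `m ≤ n`.
    let A : ℝ := max (max C (60 * Λ * varConst Λ ^ 2)) (∑ m ∈ Finset.range (n + 1), |K m|)
    have hAC : C ≤ A := (le_max_left _ _).trans (le_max_left _ _)
    have hA1 : 1 ≤ A := hC1.trans hAC
    refine ⟨max A (Fintype.card (OrderedFinpartition n) * (A * A ^ n) *
        Real.exp (Fintype.card (OrderedFinpartition n) * (A * A ^ n) + 1)),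
      hA1.trans (le_max_left _ _), ?_⟩
    intro q M ε r h τ hrτ hτ1 m hm3 hm t z ht0 htτ hz
    rcases Nat.lt_or_ge m n with hmn | hmn
    · exact (hC h τ hrτ hτ1 m hm3 hmn t z ht0 htτ hz).trans
        (by gcongr; exact hAC.trans (le_max_left _ _))
    · obtain rfl : m = n := by omega
      refine (h.norm_iteratedFDeriv_step hm3 hA1
        ((le_max_right _ _).trans (le_max_left _ _)) (fun k _ hk => ?_) hrτ hτ1
        (fun k hk3 hk t z ht0 htτ hz => ?_) ht0 htτ hz).trans ?_
      · refine (le_abs_self _).trans (le_trans ?_ (le_max_right _ _))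
        exact Finset.single_le_sum (f := fun m => |K m|) (fun _ _ => abs_nonneg _)
          (Finset.mem_range.2 (by omega))
      · exact (hC h τ hrτ hτ1 k hk3 hk t z ht0 htτ hz).trans (by gcongr)
      · gcongr; exact le_max_right _ _

end Transport

end EikonalBounds

namespace EikonalBounds

/-! ### Uniqueness of solutions of the eikonal equation -/

section Uniqueness

open Set Filter Topology

variable {d : ℕ}

theorem differentiableAt_of_contDiffOn_slice {u : ℝ → E d → ℝ}
    (hu : ContDiffOn ℝ 1 (fun z : ℝ × E d => u z.1 z.2) (Icc 0 1 ×ˢ univ)) {t : ℝ}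
    (ht : t ∈ Icc (0 : ℝ) 1) (x : E d) : DifferentiableAt ℝ (u t) x := by
  have h1 := (hu.differentiableOn (by simp)) (t, x) ⟨ht, trivial⟩
  have h2 : HasFDerivWithinAt (fun y : E d => (t, y)) _ univ x :=
    (hasFDerivAt_prodMk_right (𝕜 := ℝ) t x).hasFDerivWithinAt
  have h3 : HasFDerivWithinAt (u t) _ univ x := h1.hasFDerivWithinAt.comp x h2
    (fun y _ => ⟨ht, trivial⟩)
  exact (hasFDerivWithinAt_univ.1 h3).differentiableAt

/-- The weight `exp (a (L (t - t₁) + (1 + |x - x₀|²)^{1/2}))`. -/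
noncomputable def coneWeight (a L t₁ : ℝ) (x₀ : E d) (t : ℝ) (x : E d) : ℝ :=
  Real.exp (a * (L * (t - t₁) + Real.sqrt (1 + ‖x - x₀‖ ^ 2)))

theorem hasDerivAt_coneWeight (a L t₁ : ℝ) (x₀ : E d) (t : ℝ) (x : E d) :
    HasDerivAt (fun s => coneWeight a L t₁ x₀ s x) (a * L * coneWeight a L t₁ x₀ t x) t := by
  have h1 : HasDerivAt (fun s => a * (L * (s - t₁) + Real.sqrt (1 + ‖x - x₀‖ ^ 2)))
      (a * (L * 1)) t :=
    ((((hasDerivAt_id t).sub_const t₁).const_mul L).add_const _).const_mul a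
  have h2 := h1.exp
  have e1 : Real.exp (a * (L * (t - t₁) + Real.sqrt (1 + ‖x - x₀‖ ^ 2)))
      = coneWeight a L t₁ x₀ t x := rfl
  refine h2.congr_deriv ?_
  rw [e1]; ring

/-- The function `(1 + |x - x₀|²)^{1/2}` is a smooth substitute for the distance with gradient at
most one. Hence `L` times the gradient of the weight is at most its time derivative, as a barrier
for propagation speed `L` requires. -/
theorem exists_hasFDerivAt_coneWeight {a : ℝ} (ha : 0 ≤ a) (L t₁ : ℝ) (x₀ : E d) (t : ℝ)
    (x : E d) : ∃ l : E d →L[ℝ] ℝ, HasFDerivAt (coneWeight a L t₁ x₀ t) l x ∧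
      ‖l‖ ≤ a * coneWeight a L t₁ x₀ t x := by
  have h0 : HasFDerivAt (fun y => y - x₀) (ContinuousLinearMap.id ℝ (E d)) x :=
    (hasFDerivAt_id x).sub_const x₀
  have hs : 0 < 1 + ‖x - x₀‖ ^ 2 := by positivity
  have h1 := ((h0.norm_sq.const_add 1).sqrt hs.ne')
  have h2 : HasFDerivAt (coneWeight a L t₁ x₀ t) _ x :=
    ((h1.const_add (L * (t - t₁))).const_mul a).exp
  refine ⟨_, h2, ?_⟩
  rw [norm_smul, Real.norm_of_nonneg (Real.exp_pos _).le, mul_comm]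
  refine mul_le_mul_of_nonneg_right ?_ (Real.exp_pos _).le
  refine ContinuousLinearMap.opNorm_le_bound _ ha fun v => ?_
  have h3 : ‖x - x₀‖ ≤ Real.sqrt (1 + ‖x - x₀‖ ^ 2) := Real.le_sqrt_of_sq_le (by linarith)
  have h4 := abs_real_inner_le_norm (x - x₀) v
  have h5 : 0 < Real.sqrt (1 + ‖x - x₀‖ ^ 2) := Real.sqrt_pos.2 hs
  simp only [_root_.smul_apply, smul_eq_mul, ContinuousLinearMap.comp_apply, innerSL_apply_apply,
    ContinuousLinearMap.id_apply, nsmul_eq_mul, Nat.cast_ofNat]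
  rw [Real.norm_eq_abs, abs_mul, abs_of_nonneg ha]
  refine mul_le_mul_of_nonneg_left ?_ ha
  rw [abs_mul, abs_mul, abs_of_pos (by positivity : (0 : ℝ) < 1 / (2 * √(1 + ‖x - x₀‖ ^ 2))),
    abs_two]
  calc _ ≤ 1 / (2 * √(1 + ‖x - x₀‖ ^ 2)) * (2 * (√(1 + ‖x - x₀‖ ^ 2) * ‖v‖)) := by
        gcongr; exact h4.trans (by gcongr)
    _ = ‖v‖ := by field_simp

/-- At a maximum of `u - v - ε t - κ · weight` in the interior of the ball and at positive time, the
gradients of `u` and `v` differ by at most `κ` times the gradient of the weight. The Lipschitz bound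
on `p` then shows that the time derivative of `u - v` is at most that of `κ · weight`, which the
term `ε t` contradicts. No growth condition on the solutions is needed, because the weight controls
the lateral boundary. -/
theorem eikonal_le {p : E d → E d → ℝ} {L : ℝ} (hL : 0 ≤ L)
    (hp : ∀ x ξ ξ', |p x ξ - p x ξ'| ≤ L * ‖ξ - ξ'‖) {u v : ℝ → E d → ℝ}
    (hu : ContDiffOn ℝ 1 (fun z : ℝ × E d => u z.1 z.2) (Icc 0 1 ×ˢ univ))
    (hv : ContDiffOn ℝ 1 (fun z : ℝ × E d => v z.1 z.2) (Icc 0 1 ×ˢ univ))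
    (hu' : ∀ t ∈ Icc (0 : ℝ) 1, ∀ x,
      HasDerivWithinAt (fun s => u s x) (-p x (gradient (u t) x)) (Icc 0 1) t)
    (hv' : ∀ t ∈ Icc (0 : ℝ) 1, ∀ x,
      HasDerivWithinAt (fun s => v s x) (-p x (gradient (v t) x)) (Icc 0 1) t)
    (h0 : ∀ x, u 0 x = v 0 x) {t₁ : ℝ} (ht₁ : t₁ ∈ Icc (0 : ℝ) 1) (x₀ : E d) :
    u t₁ x₀ ≤ v t₁ x₀ := by
  set Q : Set (ℝ × E d) := Icc 0 t₁ ×ˢ Metric.closedBall x₀ (L + 2)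
  have hQc : IsCompact Q := isCompact_Icc.prod (isCompact_closedBall _ _)
  have hsub : Icc 0 t₁ ⊆ Icc (0 : ℝ) 1 := Icc_subset_Icc_right ht₁.2
  have hcont : ContinuousOn (fun z : ℝ × E d => u z.1 z.2 - v z.1 z.2) Q :=
    (hu.continuousOn.sub hv.continuousOn).mono (prod_mono hsub (subset_univ _))
  obtain ⟨B, hB⟩ := hQc.exists_bound_of_continuousOn hcont
  have hx₀ : x₀ ∈ Metric.closedBall x₀ (L + 2) := Metric.mem_closedBall_self (by linarith)
  have hB0 : 0 ≤ B := (norm_nonneg _).trans (hB (t₁, x₀) ⟨right_mem_Icc.2 ht₁.1, hx₀⟩)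
  have key : ∀ a > 0, ∀ ε > 0, u t₁ x₀ - v t₁ x₀ ≤ ε + B * Real.exp (-a) := by
    intro a ha ε hε
    -- On the lateral boundary, at distance `L + 2`, the weight is at least `exp (2a)`, as `L * (s -
    -- t₁) ≥ -L`; there `κ · weight` dominates `B`. At `(t₁, x₀)` the weight is only `exp a`, which
    -- leaves an error `B * exp (-a)`.
    set κ := B * Real.exp (-(2 * a)) with hκ
    have hκ0 : 0 ≤ κ := by positivity
    let Ψ : ℝ × E d → ℝ := fun z =>
      u z.1 z.2 - v z.1 z.2 - ε * z.1 - κ * coneWeight a L t₁ x₀ z.1 z.2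
    have hΨc : ContinuousOn Ψ Q := by
      refine (hcont.sub (by fun_prop)).sub ?_
      unfold coneWeight
      fun_prop
    obtain ⟨⟨s, y⟩, ⟨hs, hy⟩, hmax⟩ := hQc.exists_isMaxOn
      ⟨(t₁, x₀), right_mem_Icc.2 ht₁.1, hx₀⟩ hΨc
    have hcw : ∀ t x, 0 < coneWeight a L t₁ x₀ t x := fun t x => Real.exp_pos _
    have hle : Ψ (s, y) ≤ 0 := by
      simp only at hs hy
      rcases hs.1.eq_or_lt with rfl | hs0
      · simp only [Ψ, h0, sub_self, mul_zero, zero_sub]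
        have := mul_nonneg hκ0 (hcw 0 y).le
        linarith
      rcases (Metric.mem_closedBall.1 hy).eq_or_lt with hyR | hyR
      · have h1 := (le_abs_self _).trans (hB (s, y) ⟨hs, hy⟩)
        have h2 : Real.exp (2 * a) ≤ coneWeight a L t₁ x₀ s y := by
          refine Real.exp_le_exp.2 ?_
          rw [mul_comm 2 a]
          refine mul_le_mul_of_nonneg_left ?_ ha.le
          have h3 : L + 2 ≤ Real.sqrt (1 + ‖y - x₀‖ ^ 2) := by
            rw [← dist_eq_norm, hyR]; exact Real.le_sqrt_of_sq_le (by linarith)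
          nlinarith [ht₁.2]
        have h4 : B ≤ κ * coneWeight a L t₁ x₀ s y := by
          calc B = κ * Real.exp (2 * a) := by
                rw [hκ, mul_assoc, ← Real.exp_add]; simp
            _ ≤ _ := by gcongr
        have h5 : 0 ≤ ε * s := by positivity
        simp only [Ψ]
        simp only at h1
        linarith
      · exfalso
        have hs1 : s ∈ Icc (0 : ℝ) 1 := hsub hs
        obtain ⟨l, hl, hln⟩ := exists_hasFDerivAt_coneWeight ha.le L t₁ x₀ s y
        have hgu := (differentiableAt_of_contDiffOn_slice hu hs1 y).hasGradientAt
        have hgv := (differentiableAt_of_contDiffOn_slice hv hs1 y).hasGradientAt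
        have hx : HasFDerivAt (fun x => Ψ (s, x)) _ y :=
          ((hgu.hasFDerivAt.sub hgv.hasFDerivAt).sub_const (ε * s)).sub (hl.const_mul κ)
        have hxmax : IsLocalMax (fun x => Ψ (s, x)) y := by
          filter_upwards [Metric.isOpen_ball.mem_nhds (Metric.mem_ball.2 hyR)] with x hx
          exact hmax ⟨hs, Metric.ball_subset_closedBall hx⟩
        have hx0 := hxmax.hasFDerivAt_eq_zero hx
        have hgrad : ‖gradient (u s) y - gradient (v s) y‖ ≤
            κ * (a * coneWeight a L t₁ x₀ s y) := by
          rw [← (InnerProductSpace.toDual ℝ (E d)).norm_map, map_sub, sub_eq_zero.1 hx0, norm_smul,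
            Real.norm_of_nonneg hκ0]
          gcongr
        have ht : HasDerivWithinAt (fun t => Ψ (t, y)) _ (Icc 0 s) s :=
          ((((hu' s hs1 y).sub (hv' s hs1 y)).mono (Icc_subset_Icc_right hs1.2)).sub
            ((hasDerivAt_id s).const_mul ε).hasDerivWithinAt).sub
            ((hasDerivAt_coneWeight a L t₁ x₀ s y).const_mul κ).hasDerivWithinAt
        have ht0 := ht.hasFDerivWithinAt
        have hloc : IsLocalMaxOn (fun t => Ψ (t, y)) (Icc 0 s) s := by
          refine IsMaxOn.localize fun t ht => ?_
          exact hmax ⟨⟨ht.1, ht.2.trans hs.2⟩, hy⟩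
        -- The maximum may be attained at the final time, so only earlier times are compared and the
        -- derivative is tested in the backward direction.
        have htan : (-s : ℝ) ∈ posTangentConeAt (Icc 0 s) s := by
          refine mem_posTangentConeAt_of_segment_subset ?_
          rw [add_neg_cancel, segment_symm, segment_eq_Icc hs.1]
        have hneg := hloc.hasFDerivWithinAt_nonpos ht0 htan
        simp only [ContinuousLinearMap.toSpanSingleton_apply, smul_eq_mul] at hneg
        have hpp := (abs_le.1 (hp y (gradient (u s) y) (gradient (v s) y))).1
        have hpp2 := mul_le_mul_of_nonneg_left hgrad hL
        nlinarith [hcw s y]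
    have h1 := (hmax (⟨right_mem_Icc.2 ht₁.1, hx₀⟩ : (t₁, x₀) ∈ Q)).trans hle
    have h2 : coneWeight a L t₁ x₀ t₁ x₀ = Real.exp a := by simp [coneWeight]
    have h3 : κ * Real.exp a = B * Real.exp (-a) := by
      rw [hκ, mul_assoc, ← Real.exp_add]; congr 2; ring
    simp only [Ψ, h2, h3] at h1
    nlinarith [ht₁.2]
  have hlim : Tendsto (fun a : ℝ => a⁻¹ + B * Real.exp (-a)) atTop (𝓝 (0 + B * 0)) :=
    tendsto_inv_atTop_zero.add (Real.tendsto_exp_neg_atTop_nhds_zero.const_mul B)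
  have h1 := ge_of_tendsto hlim (b := u t₁ x₀ - v t₁ x₀)
    ((eventually_gt_atTop 0).mono fun a ha => key a ha a⁻¹ (inv_pos.2 ha))
  linarith

/-- Two solutions of the eikonal equation with the same initial value agree. -/
theorem eikonal_unique {p : E d → E d → ℝ} {L : ℝ} (hL : 0 ≤ L)
    (hp : ∀ x ξ ξ', |p x ξ - p x ξ'| ≤ L * ‖ξ - ξ'‖) {u v : ℝ → E d → ℝ}
    (hu : ContDiffOn ℝ 1 (fun z : ℝ × E d => u z.1 z.2) (Icc 0 1 ×ˢ univ))
    (hv : ContDiffOn ℝ 1 (fun z : ℝ × E d => v z.1 z.2) (Icc 0 1 ×ˢ univ))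
    (hu' : ∀ t ∈ Icc (0 : ℝ) 1, ∀ x,
      HasDerivWithinAt (fun s => u s x) (-p x (gradient (u t) x)) (Icc 0 1) t)
    (hv' : ∀ t ∈ Icc (0 : ℝ) 1, ∀ x,
      HasDerivWithinAt (fun s => v s x) (-p x (gradient (v t) x)) (Icc 0 1) t)
    (h0 : ∀ x, u 0 x = v 0 x) {t : ℝ} (ht : t ∈ Icc (0 : ℝ) 1) (x : E d) :
    u t x = v t x :=
  (eikonal_le hL hp hu hv hu' hv' h0 ht x).antisymm
    (eikonal_le hL hp hv hu hv' hu' (fun x => (h0 x).symm) ht x)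

end Uniqueness

end EikonalBounds

namespace EikonalBounds

/-! ### Derivatives of functions of `(x, η)` which are homogeneous in `η` -/

section Homogeneous

open Set Filter Topology

variable {d : ℕ}

/-- Smoothness away from `η = 0`. -/
def IsSmooth (F : E d → E d → ℝ) : Prop :=
  ∀ z : E d × E d, z.2 ≠ 0 → ContDiffAt ℝ ∞ (Function.uncurry F) z

/-- Homogeneity of degree `m` in `η`. -/
def IsHomogeneous (m : ℤ) (F : E d → E d → ℝ) : Prop :=
  ∀ c : ℝ, 0 < c → ∀ x η : E d, η ≠ 0 → F x (c • η) = c ^ m * F x η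

theorem norm_e (i : Fin d) : ‖e i‖ = 1 := by simp [e]

theorem isOpen_snd_ne_zero : IsOpen {z : E d × E d | z.2 ≠ 0} :=
  isOpen_ne_fun continuous_snd continuous_const

namespace IsSmooth

variable {F : E d → E d → ℝ}

theorem partialX_eq (hF : IsSmooth F) (i : Fin d) {z : E d × E d} (hz : z.2 ≠ 0) :
    Function.uncurry (partialX i F) z = fderiv ℝ (Function.uncurry F) z (e i, 0) := by
  have h1 := ((hF z hz).differentiableAt (by simp)).hasFDerivAt
  have h2 : HasFDerivAt (fun x => F x z.2) _ z.1 :=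
    HasFDerivAt.comp z.1 (f := fun x => (x, z.2)) h1 (hasFDerivAt_prodMk_left z.1 z.2)
  change fderiv ℝ (fun x => F x z.2) z.1 (e i) = _
  rw [h2.fderiv]; rfl

theorem partialEta_eq (hF : IsSmooth F) (i : Fin d) {z : E d × E d} (hz : z.2 ≠ 0) :
    Function.uncurry (partialEta i F) z = fderiv ℝ (Function.uncurry F) z (0, e i) := by
  have h1 := ((hF z hz).differentiableAt (by simp)).hasFDerivAt
  have h2 : HasFDerivAt (fun η => F z.1 η) _ z.2 :=
    HasFDerivAt.comp z.2 (f := fun η => (z.1, η)) h1 (hasFDerivAt_prodMk_right z.1 z.2)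
  change fderiv ℝ (fun η => F z.1 η) z.2 (e i) = _
  rw [h2.fderiv]; rfl

theorem of_fderiv (hF : IsSmooth F) {G : E d → E d → ℝ} {v : E d × E d}
    (hG : ∀ z : E d × E d, z.2 ≠ 0 →
      Function.uncurry G z = fderiv ℝ (Function.uncurry F) z v) : IsSmooth G := fun z hz => by
  refine ((contDiffAt_fderiv (hF z hz)).clm_apply contDiffAt_const).congr_of_eventuallyEq
    (f := fun z => fderiv ℝ (Function.uncurry F) z v) ?_
  filter_upwards [isOpen_snd_ne_zero.mem_nhds hz] with y hy using hG y hy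

theorem partialX (hF : IsSmooth F) (i : Fin d) : IsSmooth (partialX i F) :=
  hF.of_fderiv fun _ hz => hF.partialX_eq i hz

theorem partialEta (hF : IsSmooth F) (i : Fin d) : IsSmooth (partialEta i F) :=
  hF.of_fderiv fun _ hz => hF.partialEta_eq i hz

theorem differentiableAt_right (hF : IsSmooth F) (x : E d) {η : E d} (hη : η ≠ 0) :
    DifferentiableAt ℝ (F x) η :=
  (((hF (x, η) hη).differentiableAt (by simp)).hasFDerivAt.comp η
    (f := fun η => (x, η)) (hasFDerivAt_prodMk_right x η)).differentiableAt

theorem differentiableAt_left (hF : IsSmooth F) (x : E d) {η : E d} (hη : η ≠ 0) :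
    DifferentiableAt ℝ (fun x' => F x' η) x :=
  (((hF (x, η) hη).differentiableAt (by simp)).hasFDerivAt.comp x
    (f := fun x' => (x', η)) (hasFDerivAt_prodMk_left x η)).differentiableAt

/-- A partial derivative along `v` is evaluation of the full derivative in scaled variables at the
vector `w` of norm at most one, divided by the scaling factor `c`; so it costs one order and a
factor `c⁻¹`. -/
theorem norm_iteratedFDeriv_of_fderiv (hF : IsSmooth F) {G : E d → E d → ℝ} {v w : E d × E d}
    {a b c : ℝ} (hG : ∀ z : E d × E d, z.2 ≠ 0 →
      Function.uncurry G z = fderiv ℝ (Function.uncurry F) z v) (hc : 0 < c)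
    (hw : scale d a b w = c • v) (hw1 : ‖w‖ ≤ 1)
    {y : E d × E d} (hy : (scale d a b y).2 ≠ 0) (n : ℕ) :
    ‖iteratedFDeriv ℝ n (Function.uncurry G ∘ scale d a b) y‖ ≤
      c⁻¹ * ‖iteratedFDeriv ℝ (n + 1) (Function.uncurry F ∘ scale d a b) y‖ := by
  have hs : ContDiffAt ℝ ∞ (Function.uncurry F ∘ scale d a b) y :=
    (hF _ hy).comp y (scale d a b).contDiff.contDiffAt
  let ev : (E d × E d →L[ℝ] ℝ) →L[ℝ] ℝ := c⁻¹ • ContinuousLinearMap.apply ℝ ℝ w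
  have hev : ‖ev‖ ≤ c⁻¹ := by
    refine ContinuousLinearMap.opNorm_le_bound _ (by positivity) fun l => ?_
    change ‖c⁻¹ • l w‖ ≤ _
    rw [norm_smul, Real.norm_of_nonneg (by positivity)]
    gcongr
    exact (l.le_opNorm w).trans (mul_le_of_le_one_right (norm_nonneg _) hw1)
  have hO : ∀ᶠ y' in 𝓝 y, (scale d a b y').2 ≠ 0 :=
    (scale d a b).continuous.continuousAt.eventually (isOpen_snd_ne_zero.mem_nhds hy)
  have heq : Function.uncurry G ∘ scale d a b =ᶠ[𝓝 y]
      ev ∘ fderiv ℝ (Function.uncurry F ∘ scale d a b) := by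
    filter_upwards [hO] with y' hy'
    have h1 := ((hF _ hy').differentiableAt (by simp))
    rw [Function.comp_apply, hG _ hy', Function.comp_apply, fderiv_comp _ h1
      (scale d a b).differentiableAt, ContinuousLinearMap.fderiv]
    change _ = c⁻¹ • (fderiv ℝ (Function.uncurry F) (scale d a b y') (scale d a b w))
    rw [hw, map_smul, smul_smul, inv_mul_cancel₀ hc.ne', one_smul]
  rw [(heq.iteratedFDeriv ℝ n).eq_of_nhds]
  refine (ev.norm_iteratedFDeriv_comp_left (contDiffAt_fderiv hs) (natCast_le_infty n)).trans ?_
  rw [norm_iteratedFDeriv_fderiv]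
  gcongr

theorem norm_iteratedFDeriv_partialX (hF : IsSmooth F) (i : Fin d) {a b : ℝ} (ha : 0 < a)
    {y : E d × E d} (hy : (scale d a b y).2 ≠ 0) (n : ℕ) :
    ‖iteratedFDeriv ℝ n (Function.uncurry (EikonalBounds.partialX i F) ∘ scale d a b) y‖ ≤
      a⁻¹ * ‖iteratedFDeriv ℝ (n + 1) (Function.uncurry F ∘ scale d a b) y‖ :=
  hF.norm_iteratedFDeriv_of_fderiv (v := (e i, 0)) (w := (e i, 0))
    (fun _ hz => hF.partialX_eq i hz) ha (by simp) (by simp [Prod.norm_def, norm_e]) hy n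

theorem norm_iteratedFDeriv_partialEta (hF : IsSmooth F) (i : Fin d) {a b : ℝ} (hb : 0 < b)
    {y : E d × E d} (hy : (scale d a b y).2 ≠ 0) (n : ℕ) :
    ‖iteratedFDeriv ℝ n (Function.uncurry (EikonalBounds.partialEta i F) ∘ scale d a b) y‖ ≤
      b⁻¹ * ‖iteratedFDeriv ℝ (n + 1) (Function.uncurry F ∘ scale d a b) y‖ :=
  hF.norm_iteratedFDeriv_of_fderiv (v := (0, e i)) (w := (0, e i))
    (fun _ hz => hF.partialEta_eq i hz) hb (by simp) (by simp [Prod.norm_def, norm_e]) hy n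

end IsSmooth

namespace IsHomogeneous

variable {F : E d → E d → ℝ} {m : ℤ}

theorem partialX (hF : IsHomogeneous m F) (hs : IsSmooth F) (i : Fin d) : IsHomogeneous m (partialX i F) := by
  intro c hc x η hη
  simp only [EikonalBounds.partialX]
  have h1 : (fun x' => F x' (c • η)) = fun x' => (c ^ m) • F x' η := by
    ext1 x'; exact hF c hc x' η hη
  rw [h1, fderiv_fun_const_smul (hs.differentiableAt_left x hη)]
  rfl

theorem partialEta (hF : IsHomogeneous m F) (hs : IsSmooth F) (i : Fin d) :
    IsHomogeneous (m - 1) (partialEta i F) := by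
  intro c hc x η hη
  have h1 : (fun η' => F x (c • η')) =ᶠ[𝓝 η] fun η' => (c ^ m) • F x η' := by
    filter_upwards [isOpen_ne.mem_nhds hη] with y hy using hF c hc x y hy
  have h2 := h1.fderiv_eq (𝕜 := ℝ)
  have h3' : HasFDerivAt (fun η' : E d => c • η') (c • ContinuousLinearMap.id ℝ (E d)) η :=
    (hasFDerivAt_id (𝕜 := ℝ) η).const_smul c
  have h3 : HasFDerivAt (fun η' => F x (c • η')) _ η :=
    HasFDerivAt.comp η (hs.differentiableAt_right x (smul_ne_zero hc.ne' hη)).hasFDerivAt h3'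
  rw [fderiv_fun_const_smul (hs.differentiableAt_right x hη), h3.fderiv] at h2
  have h4 := DFunLike.congr_fun h2 (e i)
  simp only [ContinuousLinearMap.comp_apply, _root_.smul_apply, ContinuousLinearMap.id_apply,
    map_smul, smul_eq_mul] at h4
  change fderiv ℝ (fun η' => F x η') (c • η) (e i) = _ * fderiv ℝ (fun η' => F x η') η (e i)
  rw [zpow_sub_one₀ hc.ne', mul_assoc, mul_left_comm, ← h4]
  field_simp

/-- Euler's identity. -/
theorem radialEta_eq (hF : IsHomogeneous m F) (hs : IsSmooth F) (x : E d) {η : E d}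
    (hη : η ≠ 0) : radialEta F x η = m * F x η := by
  have hd := (hs.differentiableAt_right x hη).hasFDerivAt
  have h1 : radialEta F x η = fderiv ℝ (F x) η η := by
    have h2 : η = ∑ i, η i • e i := by
      have := (EuclideanSpace.basisFun (Fin d) ℝ).sum_repr η
      simpa [e] using this.symm
    conv_rhs => rw [h2, map_sum]
    simp only [map_smul, smul_eq_mul]
    rw [← h2]; rfl
  have h3 : HasDerivAt (fun c : ℝ => F x (c • η)) (fderiv ℝ (F x) η η) 1 := by
    have h4 : HasDerivAt (fun c : ℝ => c • η) ((1 : ℝ) • η) 1 := (hasDerivAt_id 1).smul_const η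
    rw [one_smul] at h4
    have h5 : HasFDerivAt (F x) (fderiv ℝ (F x) η) ((1 : ℝ) • η) := by rwa [one_smul]
    exact h5.comp_hasDerivAt 1 h4
  have h6 : HasDerivAt (fun c : ℝ => F x (c • η)) (m * (1 : ℝ) ^ (m - 1) * F x η) 1 := by
    refine ((hasDerivAt_zpow m 1 (Or.inl one_ne_zero)).mul_const (F x η)).congr_of_eventuallyEq ?_
    filter_upwards [lt_mem_nhds (zero_lt_one (α := ℝ))] with c hc using hF c hc x η hη
  rw [h1, h3.unique h6]; simp

/-- Euler's identity is available away from `η = 0` only, so the induction carries an identity valid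
near `η`, which can be differentiated again. -/
theorem radialEta_iterate_eq (hF : IsHomogeneous m F) (hs : IsSmooth F) (j : ℕ) (x : E d)
    {η : E d} (hη : η ≠ 0) : radialEta^[j] F x η = (m : ℝ) ^ j * F x η := by
  induction j generalizing η with
  | zero => simp
  | succ j ih =>
    rw [Function.iterate_succ_apply']
    have h1 : (fun η' => radialEta^[j] F x η') =ᶠ[𝓝 η] fun η' => (m : ℝ) ^ j • F x η' := by
      filter_upwards [isOpen_ne.mem_nhds hη] with y hy using ih hy
    have h2 : radialEta (radialEta^[j] F) x η = (m : ℝ) ^ j * radialEta F x η := by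
      simp only [radialEta, Finset.mul_sum]
      refine Finset.sum_congr rfl fun i _ => ?_
      rw [mul_left_comm]
      congr 1
      change fderiv ℝ (fun η' => radialEta^[j] F x η') η (e i) = _ * fderiv ℝ (fun η' => F x η') η (e i)
      rw [h1.fderiv_eq, fderiv_fun_const_smul (hs.differentiableAt_right x hη)]; rfl
    rw [h2, hF.radialEta_eq hs x hη]; ring

end IsHomogeneous

/-- The properties of `multiX β (multiEta α F)`. -/
theorem multiEta_properties {F : E d → E d → ℝ} {m : ℤ} (hs : IsSmooth F) (hF : IsHomogeneous m F)
    {a b : ℝ} (hb : 0 < b) {y : E d × E d} (hy : (scale d a b y).2 ≠ 0)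
    (α : Fin d → ℕ) :
    IsSmooth (multiEta α F) ∧ IsHomogeneous (m - (∑ i, α i : ℕ)) (multiEta α F) ∧
    ∀ n, ‖iteratedFDeriv ℝ n (Function.uncurry (multiEta α F) ∘ scale d a b) y‖ ≤
      b⁻¹ ^ (∑ i, α i) *
        ‖iteratedFDeriv ℝ (n + ∑ i, α i) (Function.uncurry F ∘ scale d a b) y‖ := by
  have step : ∀ (i : Fin d) (k : ℕ) {G : E d → E d → ℝ} {l : ℤ}, IsSmooth G → IsHomogeneous l G →
      IsSmooth ((partialEta i)^[k] G) ∧ IsHomogeneous (l - k) ((partialEta i)^[k] G) ∧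
      ∀ n, ‖iteratedFDeriv ℝ n (Function.uncurry ((partialEta i)^[k] G) ∘ scale d a b) y‖ ≤
      b⁻¹ ^ k * ‖iteratedFDeriv ℝ (n + k) (Function.uncurry G ∘ scale d a b) y‖ := by
    intro i k G l hG hl
    induction k with
    | zero => simpa using ⟨hG, hl⟩
    | succ k ih =>
      obtain ⟨h1, h2, h3⟩ := ih
      rw [Function.iterate_succ_apply']
      refine ⟨h1.partialEta i, ?_, fun n => ?_⟩
      · have := h2.partialEta h1 i
        push_cast
        rwa [← sub_sub]
      · refine (h1.norm_iteratedFDeriv_partialEta i hb hy n).trans ?_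
        rw [pow_succ', mul_assoc]
        gcongr
        refine (h3 (n + 1)).trans_eq ?_
        rw [show n + 1 + k = n + (k + 1) by ring]
  -- Written over `List.finRange d`, the order of the multi-index and the fold defining the
  -- derivative lose the same index in an induction on the list.
  rw [Fin.sum_univ_def]
  unfold multiEta
  induction List.finRange d with
  | nil => exact ⟨hs, by simpa using hF, fun n => by
    rw [List.map_nil, List.sum_nil, pow_zero, one_mul]; exact le_rfl⟩
  | cons i L ih =>
    obtain ⟨h1, h2, h3⟩ := ih
    obtain ⟨g1, g2, g3⟩ := step i (α i) h1 h2
    simp only [List.foldr_cons, List.map_cons, List.sum_cons]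
    refine ⟨g1, ?_, fun n => (g3 n).trans ?_⟩
    · convert g2 using 1; push_cast; ring
    · rw [pow_add, mul_assoc]
      gcongr
      refine (h3 _).trans_eq ?_
      rw [add_assoc, List.map_cons, List.sum_cons]

theorem multiX_properties {F : E d → E d → ℝ} {m : ℤ} (hs : IsSmooth F) (hF : IsHomogeneous m F)
    {a b : ℝ} (ha : 0 < a) {y : E d × E d} (hy : (scale d a b y).2 ≠ 0)
    (β : Fin d → ℕ) :
    IsSmooth (multiX β F) ∧ IsHomogeneous m (multiX β F) ∧
    ∀ n, ‖iteratedFDeriv ℝ n (Function.uncurry (multiX β F) ∘ scale d a b) y‖ ≤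
      a⁻¹ ^ (∑ i, β i) *
        ‖iteratedFDeriv ℝ (n + ∑ i, β i) (Function.uncurry F ∘ scale d a b) y‖ := by
  have step : ∀ (i : Fin d) (k : ℕ) {G : E d → E d → ℝ}, IsSmooth G → IsHomogeneous m G →
      IsSmooth ((partialX i)^[k] G) ∧ IsHomogeneous m ((partialX i)^[k] G) ∧
      ∀ n, ‖iteratedFDeriv ℝ n (Function.uncurry ((partialX i)^[k] G) ∘ scale d a b) y‖ ≤
      a⁻¹ ^ k * ‖iteratedFDeriv ℝ (n + k) (Function.uncurry G ∘ scale d a b) y‖ := by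
    intro i k G hG hl
    induction k with
    | zero => simpa using ⟨hG, hl⟩
    | succ k ih =>
      obtain ⟨h1, h2, h3⟩ := ih
      rw [Function.iterate_succ_apply']
      refine ⟨h1.partialX i, h2.partialX h1 i, fun n => ?_⟩
      refine (h1.norm_iteratedFDeriv_partialX i ha hy n).trans ?_
      rw [pow_succ', mul_assoc]
      gcongr
      refine (h3 (n + 1)).trans_eq ?_
      rw [show n + 1 + k = n + (k + 1) by ring]
  rw [Fin.sum_univ_def]
  unfold multiX
  induction List.finRange d with
  | nil => exact ⟨hs, by simpa using hF, fun n => by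
    rw [List.map_nil, List.sum_nil, pow_zero, one_mul]; exact le_rfl⟩
  | cons i L ih =>
    obtain ⟨h1, h2, h3⟩ := ih
    obtain ⟨g1, g2, g3⟩ := step i (β i) h1 h2
    simp only [List.foldr_cons, List.map_cons, List.sum_cons]
    refine ⟨g1, g2, fun n => (g3 n).trans ?_⟩
    rw [pow_add, mul_assoc]
    gcongr
    refine (h3 _).trans_eq ?_
    rw [add_assoc, List.map_cons, List.sum_cons]

/-- Bounds for derivatives of homogeneous functions from bounds for derivatives at `|η| = 1`. -/
theorem abs_multi_le {F : E d → E d → ℝ} (hs : IsSmooth F) (hF : IsHomogeneous 1 F)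
    {a b B : ℝ} (ha : 0 < a) (hb : 0 < b) (α β : Fin d → ℕ) (x : E d)
    (hB : ∀ y : E d × E d, (scale d a b y).1 = x → ‖(scale d a b y).2‖ = 1 →
      ‖iteratedFDeriv ℝ (∑ i, α i + ∑ i, β i) (Function.uncurry F ∘ scale d a b) y‖ ≤ B)
    (j : ℕ) {η : E d} (hη : η ≠ 0) :
    |radialEta^[j] (multiX β (multiEta α F)) x η| ≤
      |1 - ((∑ i, α i : ℕ) : ℝ)| ^ j * (b⁻¹ ^ (∑ i, α i) * (a⁻¹ ^ (∑ i, β i) * B)) *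
        ‖η‖ ^ (1 - ((∑ i, α i : ℕ) : ℝ)) := by
  have hn : 0 < ‖η‖ := norm_pos_iff.2 hη
  -- The bound is proved at the normalized covector and carried back by homogeneity of degree `1 -
  -- |α|`.
  set η₁ := ‖η‖⁻¹ • η with hη₁
  have hη₁n : ‖η₁‖ = 1 := by rw [hη₁, norm_smul, norm_inv, norm_norm, inv_mul_cancel₀ hn.ne']
  have hη₁0 : η₁ ≠ 0 := norm_ne_zero_iff.1 (by rw [hη₁n]; exact one_ne_zero)
  let y : E d × E d := (a⁻¹ • x, b⁻¹ • η₁)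
  have hy1 : scale d a b y = (x, η₁) := by simp [y, smul_smul, ha.ne', hb.ne']
  have hy : (scale d a b y).2 ≠ 0 := by rw [hy1]; exact hη₁0
  obtain ⟨p1, p2, p3⟩ := multiEta_properties hs hF hb hy α
  obtain ⟨q1, q2, q3⟩ := multiX_properties p1 p2 ha hy β
  rw [q2.radialEta_iterate_eq q1 j x hη]
  have e1 : η = ‖η‖ • η₁ := by rw [hη₁, smul_smul, mul_inv_cancel₀ hn.ne', one_smul]
  have e2 := q2 ‖η‖ hn x η₁ hη₁0
  rw [← e1] at e2
  have e3 := q3 0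
  have e4 := p3 (0 + ∑ i, β i)
  have e5 := hB y (by rw [hy1]) (by rw [hy1]; exact hη₁n)
  rw [norm_iteratedFDeriv_zero, Function.comp_apply, hy1] at e3
  rw [e2, abs_mul, abs_mul, abs_pow]
  have e6 : ‖η‖ ^ ((1 : ℝ) - ((∑ i, α i : ℕ) : ℝ)) = ‖η‖ ^ ((1 : ℤ) - ((∑ i, α i : ℕ) : ℤ)) := by
    rw [← Real.rpow_intCast]; push_cast; rfl
  have e8 : (((1 : ℤ) - ((∑ i, α i : ℕ) : ℤ) : ℤ) : ℝ) = 1 - ((∑ i, α i : ℕ) : ℝ) := by push_cast; rfl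
  rw [e6, e8, abs_of_pos (zpow_pos hn _), mul_left_comm, mul_comm (‖η‖ ^ _)]
  have e7 : |multiX β (multiEta α F) x η₁| ≤ b⁻¹ ^ (∑ i, α i) * (a⁻¹ ^ (∑ i, β i) * B) := by
    refine e3.trans ?_
    calc _ ≤ a⁻¹ ^ (∑ i, β i) * (b⁻¹ ^ (∑ i, α i) * B) := by
          gcongr
          refine e4.trans ?_
          gcongr
          rwa [zero_add, add_comm]
      _ = _ := by ring
  exact mul_le_mul_of_nonneg_right (mul_le_mul_of_nonneg_left e7 (by positivity))
    (zpow_pos hn _).le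

end Homogeneous

end EikonalBounds

namespace EikonalBounds

/-! ### The solution of the eikonal equation -/

section Solution

open Set Filter Topology

variable {d : ℕ}

/-- The extension of the phase which is homogeneous of degree one in `η`. -/
noncomputable def solution (q : E d × E d → ℝ) (t : ℝ) (x η : E d) : ℝ :=
  ‖η‖ * phase q (t, (x, ‖η‖⁻¹ • η))

/-- `p` is a symbol which is homogeneous of degree one and agrees with `q` in the shell. -/
structure IsSymbolOf (p : E d → E d → ℝ) (q : E d × E d → ℝ) : Prop where
  eq : ∀ x ξ, (x, ξ) ∈ shell d → p x ξ = q (x, ξ)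
  homogeneous : ∀ c : ℝ, 0 < c → ∀ x ξ, p x (c • ξ) = c * p x ξ
  lipschitz : ∃ L : ℝ, 0 ≤ L ∧ ∀ x ξ ξ', |p x ξ - p x ξ'| ≤ L * ‖ξ - ξ'‖

theorem mem_slab_normalize {t : ℝ} (ht : |t| < 2) (x : E d) {η : E d} (hη : η ≠ 0) :
    (t, (x, ‖η‖⁻¹ • η)) ∈ slab d := by
  have hn : ‖(‖η‖⁻¹ • η)‖ = 1 := by
    rw [norm_smul, norm_inv, norm_norm, inv_mul_cancel₀ (norm_ne_zero_iff.2 hη)]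
  refine ⟨ht, ?_, ?_⟩ <;> simp only [hn] <;> norm_num

theorem isHomogeneous_solution (q : E d × E d → ℝ) (t : ℝ) : IsHomogeneous 1 (solution q t) := by
  intro c hc x η _
  have h : ‖c • η‖⁻¹ • c • η = ‖η‖⁻¹ • η := by
    rw [norm_smul, Real.norm_of_nonneg hc.le, smul_smul, mul_inv, mul_right_comm,
      inv_mul_cancel₀ hc.ne', one_mul]
  rw [solution, solution, h, norm_smul, Real.norm_of_nonneg hc.le, zpow_one, mul_assoc]

theorem abs_lt_two_of_mem {t : ℝ} (ht : t ∈ Icc (0 : ℝ) 1) : |t| < 2 := by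
  rw [abs_of_nonneg ht.1]; linarith [ht.2]

namespace IsRegularized

variable {q : E d × E d → ℝ} {M : E d × E d → E d →L[ℝ] E d} {ε Λ r : ℝ} {K : ℕ → ℝ}
  (h : IsRegularized q M ε Λ r K)
include h

theorem contDiffAt_phase' {p : ℝ × (E d × E d)} (hp : p ∈ slab d) :
    ContDiffAt ℝ ∞ (phase q) p := h.contDiffAt_phase h.eps_le h.one_le h.varConst_mul_le hp

theorem isSmooth_solution {t : ℝ} (ht : |t| < 2) : IsSmooth (solution q t) := by
  intro z hz
  have h1 : ContDiffAt ℝ ∞ (fun z : E d × E d => ‖z.2‖) z :=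
    (contDiffAt_norm ℝ hz).comp z contDiffAt_snd
  have h2 : ContDiffAt ℝ ∞ (fun z : E d × E d => ‖z.2‖⁻¹ • z.2) z :=
    (h1.inv (norm_ne_zero_iff.2 hz)).smul contDiffAt_snd
  exact h1.mul (ContDiffAt.comp z (g := phase q)
    (f := fun z : E d × E d => (t, (z.1, ‖z.2‖⁻¹ • z.2)))
    (h.contDiffAt_phase' (mem_slab_normalize ht z.1 hz)) (contDiffAt_const.prodMk (contDiffAt_fst.prodMk h2)))

theorem mem_shell_covector {p : ℝ × (E d × E d)} (hp : p ∈ slab d) :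
    (p.2.1, covector q p) ∈ shell d := by
  have h1 := h.norm_covector_sub_le hp
  have h2 := h.eps_le
  have h3 := norm_sub_norm_le p.2.2 (covector q p)
  have h4 := norm_sub_norm_le (covector q p) p.2.2
  rw [norm_sub_rev] at h3
  obtain ⟨-, h5, h6⟩ := hp
  constructor <;> simp only <;> linarith

/-- The phase, times a constant, solves the eikonal equation. -/
theorem phase_eikonal {p : E d → E d → ℝ} (hp : IsSymbolOf p q) {η : E d} {c : ℝ} (hc : 0 < c)
    (hη : ∀ t x, |t| < 2 → (t, (x, η)) ∈ slab d) :
    ContDiffOn ℝ 1 (fun z : ℝ × E d => c * phase q (z.1, (z.2, η))) (Icc 0 1 ×ˢ univ) ∧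
    ∀ t ∈ Icc (0 : ℝ) 1, ∀ x, HasDerivWithinAt (fun s => c * phase q (s, (x, η)))
      (-p x (gradient (fun x' => c * phase q (t, (x', η))) x)) (Icc 0 1) t := by
  constructor
  · intro z hz
    refine ContDiffAt.contDiffWithinAt (contDiffAt_const.mul ?_)
    have h1 := (h.contDiffAt_phase' (hη z.1 z.2 (abs_lt_two_of_mem hz.1))).of_le
      (natCast_le_infty 1)
    exact h1.comp z (f := fun z : ℝ × E d => (z.1, (z.2, η)))
      (contDiffAt_fst.prodMk (contDiffAt_snd.prodMk contDiffAt_const))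
  · intro t ht x
    have hs := hη t x (abs_lt_two_of_mem ht)
    have hd := ((h.contDiffAt_phase' hs).differentiableAt (by simp)).hasFDerivAt
    have hf := h.fderiv_phase h.eps_le h.one_le h.varConst_mul_le hs
    have hg : HasGradientAt (fun x' => c * phase q (t, (x', η)))
        (c • covector q (t, (x, η))) x := by
      have h1 : HasFDerivAt (fun x' : E d => (t, (x', η)))
          ((0 : E d →L[ℝ] ℝ).prod ((ContinuousLinearMap.id ℝ (E d)).prod 0)) x :=
        (hasFDerivAt_const t x).prodMk ((hasFDerivAt_id x).prodMk (hasFDerivAt_const η x))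
      have h2 : HasFDerivAt (fun x' => c * phase q (t, (x', η))) _ x :=
        (HasFDerivAt.comp x hd h1).const_mul c
      rw [hasGradientAt_iff_hasFDerivAt]
      refine h2.congr_fderiv ?_
      ext1 u
      change c * fderiv ℝ (phase q) (t, (x, η)) (0, (u, 0)) = inner ℝ (c • covector q (t, (x, η))) u
      rw [hf]; simp [inner_smul_left]
    rw [hg.gradient, hp.homogeneous c hc, hp.eq _ _ (h.mem_shell_covector hs)]
    have h1 : HasDerivAt (fun s => (s, (x, η))) ((1 : ℝ), ((0 : E d), (0 : E d))) t :=
      (hasDerivAt_id t).prodMk (hasDerivAt_const t _)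
    have h2 := (hd.comp_hasDerivAt t h1).const_mul c
    refine (h2.congr_deriv ?_).hasDerivWithinAt
    rw [hf]; simp

theorem isEikonalSolution {p : E d → E d → ℝ} (hp : IsSymbolOf p q) :
    IsEikonalSolution p (solution q) where
  contDiffOn η hη := (h.phase_eikonal hp (norm_pos_iff.2 hη)
    fun _ x ht => mem_slab_normalize ht x hη).1
  equation η hη := (h.phase_eikonal hp (norm_pos_iff.2 hη)
    fun _ x ht => mem_slab_normalize ht x hη).2
  initial η hη x := by
    rw [solution, h.phase_zero h.eps_le h.one_le h.varConst_mul_le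
      (mem_slab_normalize (by simp) x hη), inner_smul_right, ← mul_assoc,
      mul_inv_cancel₀ (norm_ne_zero_iff.2 hη), one_mul]

theorem eq_solution {p : E d → E d → ℝ} (hp : IsSymbolOf p q) {ψ : ℝ → E d → E d → ℝ}
    (hψ : IsEikonalSolution p ψ) {t : ℝ} (ht : t ∈ Icc (0 : ℝ) 1) (x : E d) {η : E d}
    (hη : η ≠ 0) : ψ t x η = solution q t x η := by
  obtain ⟨L, hL, hpL⟩ := hp.lipschitz
  have hs := h.isEikonalSolution hp
  exact eikonal_unique hL hpL (u := fun t x => ψ t x η) (v := fun t x => solution q t x η)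
    (hψ.contDiffOn η hη) (hs.contDiffOn η hη) (hψ.equation η hη) (hs.equation η hη)
    (fun x => (hψ.initial η hη x).trans (hs.initial η hη x).symm) ht x

/-- The phase is not homogeneous by construction. For `η` in this range, however, it solves the same
eikonal equation with the same initial value as the homogeneous extension, so uniqueness identifies
them. The agreement on an open set around `|η| = 1` transfers the derivative bounds. -/
theorem solution_eq_phase {p : E d → E d → ℝ} (hp : IsSymbolOf p q) {t : ℝ}
    (ht : t ∈ Icc (0 : ℝ) 1) (x : E d) {η : E d} (h1 : 3 / 4 < ‖η‖) (h2 : ‖η‖ < 4 / 3) :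
    solution q t x η = phase q (t, (x, η)) := by
  obtain ⟨L, hL, hpL⟩ := hp.lipschitz
  have hs := h.isEikonalSolution hp
  have hη : η ≠ 0 := norm_pos_iff.1 (by linarith)
  have hv := h.phase_eikonal hp one_pos (η := η) fun t x ht => ⟨ht, h1, h2⟩
  simp only [one_mul] at hv
  exact eikonal_unique hL hpL (u := fun t x => solution q t x η)
    (v := fun t x => phase q (t, (x, η)))
    (hs.contDiffOn η hη) hv.1 (hs.equation η hη) hv.2
    (fun x => (hs.initial η hη x).trans (h.phase_zero h.eps_le h.one_le h.varConst_mul_le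
      ⟨by simp, h1, h2⟩).symm) ht x

/-- The second derivative of the phase. -/
theorem norm_iteratedFDeriv_two_phase_le {t ρ : ℝ} (ht0 : 0 ≤ t) (htρ : t ≤ ρ) (hρ : 0 < ρ)
    (hρ1 : ρ ≤ 1) {z : E d × E d} (hz : (t, scale d ρ 1 z) ∈ slab d) :
    ‖iteratedFDeriv ℝ 2 (fun y => phase q (t, scale d ρ 1 y)) z‖ ≤
      100 * Λ * varConst Λ ^ 2 * ρ := by
  have hC := one_le_varConst h.one_le
  have hΛ := h.one_le
  have hC2 : varConst Λ ≤ varConst Λ ^ 2 := by nlinarith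
  have hl : ∀ y, HasFDerivAt (fun z : E d × E d => (t, scale d ρ 1 z))
      ((0 : E d × E d →L[ℝ] ℝ).prod (scale d ρ 1)) y := fun y =>
    (hasFDerivAt_const t y).prodMk (scale d ρ 1).hasFDerivAt
  let Φ : E d × E d → ℝ := fun y => phase q (t, scale d ρ 1 y)
  have h1 : ∀ᶠ y in 𝓝 z, ∀ w, fderiv ℝ Φ y w
      = ρ * inner ℝ (covector q (t, scale d ρ 1 y)) w.1
        + inner ℝ (basePoint q (t, scale d ρ 1 y)) w.2 := by
    filter_upwards [eventually_mem_slab hz] with y hy w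
    have h2 : HasFDerivAt Φ _ y := HasFDerivAt.comp y (g := phase q)
      (f := fun z : E d × E d => (t, scale d ρ 1 z))
      ((h.contDiffAt_phase' hy).differentiableAt (by simp)).hasFDerivAt (hl y)
    rw [h2.fderiv]
    change fderiv ℝ (phase q) (t, scale d ρ 1 y) (0, scale d ρ 1 w) = _
    rw [h.fderiv_phase h.eps_le h.one_le h.varConst_mul_le hy]
    simp [inner_smul_right]
  have hΦ : ContDiffAt ℝ ∞ Φ z := (h.contDiffAt_phase' hz).comp z
    (f := fun z : E d × E d => (t, scale d ρ 1 z))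
    (contDiff_const.prodMk (scale d ρ 1).contDiff).contDiffAt
  have hdd := (contDiffAt_fderiv hΦ).differentiableAt (by simp)
  have hcov : HasFDerivAt (fun y => covector q (t, scale d ρ 1 y)) _ z := HasFDerivAt.comp z
    (g := covector q) (f := fun z : E d × E d => (t, scale d ρ 1 z))
    ((h.contDiffAt_covector h.eps_le h.one_le h.varConst_mul_le hz).differentiableAt
      (by simp)).hasFDerivAt (hl z)
  have hbp : HasFDerivAt (fun y => basePoint q (t, scale d ρ 1 y)) _ z := HasFDerivAt.comp z
    (g := basePoint q) (f := fun z : E d × E d => (t, scale d ρ 1 z))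
    ((h.contDiffAt_basePoint h.eps_le h.one_le h.varConst_mul_le hz).differentiableAt
      (by simp)).hasFDerivAt (hl z)
  -- The Hessian of the phase is the derivative of the pair of covector and starting point. With `x`
  -- scaled by `ρ`, every entry is of size `ρ`: derivatives in `x` bring factors `ρ`, and the entry
  -- with two derivatives in `η` brings the factor `t ≤ ρ`.
  have key : ∀ a w, fderiv ℝ (fderiv ℝ Φ) z a w
      = ρ * inner ℝ (fderiv ℝ (covector q) (t, scale d ρ 1 z) (0, scale d ρ 1 a)) w.1
        + inner ℝ (fderiv ℝ (basePoint q) (t, scale d ρ 1 z) (0, scale d ρ 1 a)) w.2 := by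
    intro a w
    have e1 : HasFDerivAt (fun y => fderiv ℝ Φ y w) _ z := hdd.hasFDerivAt.clm_apply
      (hasFDerivAt_const w z)
    have e2 := ((hcov.inner ℝ (hasFDerivAt_const w.1 z)).const_mul ρ).add
      (hbp.inner ℝ (hasFDerivAt_const w.2 z))
    have e3 := e1.unique (e2.congr_of_eventuallyEq (h1.mono fun y hy => hy w))
    have e4 := DFunLike.congr_fun e3 a
    simpa using e4
  have hb : ‖fderiv ℝ (fderiv ℝ Φ) z‖ ≤ 100 * Λ * varConst Λ ^ 2 * ρ := by
    refine ContinuousLinearMap.opNorm_le_bound₂ _ (by positivity) fun a w => ?_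
    rw [key]
    have c1 := h.norm_fderiv_covector_le h.eps_le h.one_le h.varConst_mul_le hz (scale d ρ 1 a)
    have c2 := h.norm_fderiv_basePoint_le h.eps_le h.one_le h.varConst_mul_le hz (scale d ρ 1 a)
    have n1 : ‖(scale d ρ 1 a).1‖ ≤ ρ * ‖a‖ := by
      rw [scale_apply, norm_smul, Real.norm_of_nonneg hρ.le]; gcongr; exact norm_fst_le a
    have n2 : ‖(scale d ρ 1 a).2‖ ≤ ‖a‖ := by
      rw [scale_apply, one_smul]; exact norm_snd_le a
    have n3 : ‖scale d ρ 1 a‖ ≤ ‖a‖ :=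
      max_le (n1.trans (mul_le_of_le_one_left (norm_nonneg _) hρ1)) n2
    have d1 := abs_real_inner_le_norm
      (fderiv ℝ (covector q) (t, scale d ρ 1 z) (0, scale d ρ 1 a)) w.1
    have d2 := abs_real_inner_le_norm
      (fderiv ℝ (basePoint q) (t, scale d ρ 1 z) (0, scale d ρ 1 a)) w.2
    have f1 : ‖fderiv ℝ (covector q) (t, scale d ρ 1 z) (0, scale d ρ 1 a)‖ * ‖w.1‖
        ≤ 60 * Λ * varConst Λ ^ 2 * ‖a‖ * ‖w‖ := by
      gcongr
      · exact c1.trans (by gcongr)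
      · exact norm_fst_le w
    have f2 : ‖fderiv ℝ (basePoint q) (t, scale d ρ 1 z) (0, scale d ρ 1 a)‖ * ‖w.2‖
        ≤ 10 * Λ * varConst Λ * ρ * ‖a‖ * ‖w‖ := by
      gcongr
      · refine c2.trans ?_
        simp only [abs_of_nonneg ht0]
        calc _ ≤ 2 * (ρ * ‖a‖) + 8 * Λ * varConst Λ * ρ * ‖a‖ := by gcongr
          _ = (2 + 8 * (Λ * varConst Λ)) * (ρ * ‖a‖) := by ring
          _ ≤ (10 * (Λ * varConst Λ)) * (ρ * ‖a‖) := by gcongr; nlinarith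
          _ = _ := by ring
      · exact norm_snd_le w
    rw [Real.norm_eq_abs]
    refine (abs_add_le _ _).trans ?_
    rw [abs_mul, abs_of_pos hρ]
    calc _ ≤ ρ * (60 * Λ * varConst Λ ^ 2 * ‖a‖ * ‖w‖)
          + 10 * Λ * varConst Λ ^ 2 * ρ * ‖a‖ * ‖w‖ := by
          refine add_le_add (mul_le_mul_of_nonneg_left (d1.trans f1) hρ.le) ((d2.trans f2).trans ?_)
          gcongr
      _ = 70 * Λ * varConst Λ ^ 2 * ρ * ‖a‖ * ‖w‖ := by ring
      _ ≤ _ := by gcongr; norm_num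
  rwa [← norm_iteratedFDeriv_fderiv (n := 1), ← norm_iteratedFDeriv_fderiv (n := 0),
    norm_iteratedFDeriv_zero]

end IsRegularized

/-- The bounds for the derivatives of the solution of the eikonal equation. -/
theorem exists_bound_solution (d : ℕ) (Λ : ℝ) (K : ℕ → ℝ) :
    ∃ C : ℕ → (Fin d → ℕ) → (Fin d → ℕ) → ℝ,
    ∀ {q : E d × E d → ℝ} {M : E d × E d → E d →L[ℝ] E d} {ε r : ℝ} {p : E d → E d → ℝ},
      IsRegularized q M ε Λ r K → IsSymbolOf p q → ∀ (j : ℕ) (α β : Fin d → ℕ),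
      (2 ≤ ∑ i, α i ∨ 2 ≤ ∑ i, β i) → ∀ x η : E d, η ≠ 0 → ∀ τ t, r ≤ τ → τ ≤ 1 → 0 ≤ t →
      t ≤ τ ^ 2 →
      |radialEta^[j] (multiX β (multiEta α (solution q t))) x η| ≤
        C j α β * (τ / r) ^ (∑ i, α i) * (r⁻¹ ^ (∑ i, β i) * r ^ 2) *
          ‖η‖ ^ (1 - ((∑ i, α i : ℕ) : ℝ)) := by
  choose C hC1 hC using exists_bound_scaledPhase d Λ K
  refine ⟨fun j α β => |1 - ((∑ i, α i : ℕ) : ℝ)| ^ j *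
    max (C (∑ i, α i + ∑ i, β i + 1)) (100 * Λ * varConst Λ ^ 2), ?_⟩
  intro q M ε r p h hp j α β hαβ x η hη τ t hrτ hτ1 ht0 htτ
  have hr := h.pos
  have hτ : 0 < τ := hr.trans_le hrτ
  have ht : t ∈ Icc (0 : ℝ) 1 := ⟨ht0, htτ.trans (pow_le_one₀ hτ.le hτ1)⟩
  have hs := h.isSmooth_solution (abs_lt_two_of_mem ht)
  have hhom := isHomogeneous_solution q t
  have hloc : ∀ (a b : ℝ) (y : E d × E d), ‖(scale d a b y).2‖ = 1 → ∀ n : ℕ,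
      (t, scale d a b y) ∈ slab d ∧
      iteratedFDeriv ℝ n (Function.uncurry (solution q t) ∘ scale d a b) y
        = iteratedFDeriv ℝ n (fun y => phase q (t, scale d a b y)) y := by
    intro a b y hy n
    have hy' : (t, scale d a b y) ∈ slab d := by
      refine ⟨abs_lt_two_of_mem ht, ?_, ?_⟩ <;> simp only [hy] <;> norm_num
    refine ⟨hy', Filter.EventuallyEq.eq_of_nhds (Filter.EventuallyEq.iteratedFDeriv ℝ ?_ n)⟩
    filter_upwards [IsRegularized.eventually_mem_slab hy'] with y' h'
    exact h.solution_eq_phase hp ht _ h'.2.1 h'.2.2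
  have hn : 0 ≤ ‖η‖ ^ (1 - ((∑ i, α i : ℕ) : ℝ)) := by positivity
  have fin : ∀ a b B : ℝ, 0 < a → 0 < b →
      (∀ y : E d × E d, (scale d a b y).1 = x → ‖(scale d a b y).2‖ = 1 →
        ‖iteratedFDeriv ℝ (∑ i, α i + ∑ i, β i) (fun y => phase q (t, scale d a b y)) y‖ ≤ B) →
      (b⁻¹ ^ (∑ i, α i) * (a⁻¹ ^ (∑ i, β i) * B) ≤
        max (C (∑ i, α i + ∑ i, β i + 1)) (100 * Λ * varConst Λ ^ 2) *
          ((τ / r) ^ (∑ i, α i) * (r⁻¹ ^ (∑ i, β i) * r ^ 2))) →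
      |radialEta^[j] (multiX β (multiEta α (solution q t))) x η| ≤
        |1 - ((∑ i, α i : ℕ) : ℝ)| ^ j *
        max (C (∑ i, α i + ∑ i, β i + 1)) (100 * Λ * varConst Λ ^ 2) *
        (τ / r) ^ (∑ i, α i) * (r⁻¹ ^ (∑ i, β i) * r ^ 2) *
          ‖η‖ ^ (1 - ((∑ i, α i : ℕ) : ℝ)) := by
    intro a b B ha hb hB hfin
    refine (abs_multi_le hs hhom ha hb α β x (B := B) (fun y hy1 hy2 => ?_) j hη).trans ?_
    · rw [(hloc a b y hy2 _).2]; exact hB y hy1 hy2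
    · refine mul_le_mul_of_nonneg_right ?_ hn
      rw [mul_assoc, mul_assoc]
      exact mul_le_mul_of_nonneg_left hfin (by positivity)
  -- From order three on, the transport estimate applies with scales `r` and `r / τ`. In total order
  -- two the hypothesis leaves only pure derivatives: scales `τ²` and 1 give `τ²` for two
  -- derivatives in `η`, and unit scales give a constant for two derivatives in `x`.
  rcases Nat.lt_or_ge 2 (∑ i, α i + ∑ i, β i) with h3 | h3
  · refine fin r (r / τ) (C (∑ i, α i + ∑ i, β i + 1) * r ^ 2) hr (by positivity)
      (fun y _ hy => hC _ h τ hrτ hτ1 _ h3 (Nat.lt_succ_self _) t y ht0 htτ (hloc _ _ y hy 0).1) ?_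
    rw [inv_div]
    calc _ = C (∑ i, α i + ∑ i, β i + 1) *
          ((τ / r) ^ (∑ i, α i) * (r⁻¹ ^ (∑ i, β i) * r ^ 2)) := by ring
      _ ≤ _ := by gcongr; exact le_max_left _ _
  · have h2 : ∑ i, α i + ∑ i, β i = 2 := by omega
    rcases hαβ with hα | hβ
    · have e1 : ∑ i, α i = 2 := by omega
      have e2 : ∑ i, β i = 0 := by omega
      refine fin (τ ^ 2) 1 (100 * Λ * varConst Λ ^ 2 * τ ^ 2) (by positivity) one_pos
        (fun y _ hy => ?_) ?_
      · rw [h2]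
        exact h.norm_iteratedFDeriv_two_phase_le ht0 htτ (by positivity)
          (pow_le_one₀ hτ.le hτ1) (hloc _ _ y hy 0).1
      · rw [e1, e2]
        calc _ = 100 * Λ * varConst Λ ^ 2 * ((τ / r) ^ 2 * (r⁻¹ ^ 0 * r ^ 2)) := by
              field_simp
          _ ≤ _ := by gcongr; exact le_max_right _ _
    · have e1 : ∑ i, α i = 0 := by omega
      have e2 : ∑ i, β i = 2 := by omega
      refine fin 1 1 (100 * Λ * varConst Λ ^ 2) one_pos one_pos (fun y _ hy => ?_) ?_
      · rw [h2]
        simpa using h.norm_iteratedFDeriv_two_phase_le ht0 ht.2 one_pos le_rfl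
          (hloc _ _ y hy 0).1
      · rw [e1, e2]
        calc _ = 100 * Λ * varConst Λ ^ 2 * ((τ / r) ^ 0 * (r⁻¹ ^ 2 * r ^ 2)) := by
              field_simp
          _ ≤ _ := by gcongr; exact le_max_right _ _

end Solution

end EikonalBounds

namespace EikonalBounds

/-! ### Mollification -/

section Mollify

open Set Filter Topology

variable {d : ℕ} {W : Type} [NormedAddCommGroup W] [NormedSpace ℝ W]

/-- Convolution of a function with a kernel. -/
noncomputable def mollify (κ : E d → W) (f : E d → ℝ) (x : E d) : W := ∫ y, f y • κ (x - y)

/-- Smooth kernels with support in the unit ball. -/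
structure IsKernel (κ : E d → W) : Prop where
  smooth : ContDiff ℝ ∞ κ
  support : tsupport κ ⊆ Metric.closedBall 0 1

theorem mollify_eq_convolution (κ : E d → W) (f : E d → ℝ) :
    mollify κ f = convolution f κ (ContinuousLinearMap.lsmul ℝ ℝ) volume := rfl

theorem fderiv_mul_const_apply {κ : E d → ℝ} (hκ : ContDiff ℝ ∞ κ) (v u : E d) :
    fderiv ℝ (fun y => fderiv ℝ κ y v) u = (fderiv ℝ (fderiv ℝ κ) u).flip v := by
  have h1 := ((hκ.fderiv_right (m := ∞) (by simp)).differentiable (by simp) u).hasFDerivAt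
  rw [(h1.clm_apply (hasFDerivAt_const v u)).fderiv]
  ext1 w; simp

namespace IsKernel

variable {κ : E d → W} {f : E d → ℝ}

theorem hasCompactSupport (hκ : IsKernel κ) : HasCompactSupport κ :=
  (isCompact_closedBall 0 1).of_isClosed_subset (isClosed_tsupport κ) hκ.support

theorem eq_zero (hκ : IsKernel κ) {u : E d} (hu : 1 < ‖u‖) : κ u = 0 :=
  image_eq_zero_of_notMem_tsupport fun h => by
    have := mem_closedBall_zero_iff.1 (hκ.support h)
    linarith

theorem fderiv (hκ : IsKernel κ) : IsKernel (fderiv ℝ κ) :=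
  ⟨hκ.smooth.fderiv_right (by simp), (tsupport_fderiv_subset ℝ).trans hκ.support⟩

theorem iteratedFDeriv (hκ : IsKernel κ) (n : ℕ) : IsKernel (iteratedFDeriv ℝ n κ) :=
  ⟨hκ.smooth.iteratedFDeriv_right (i := n) (m := ∞) (mod_cast le_top),
    (tsupport_iteratedFDeriv_subset n).trans hκ.support⟩

theorem clm {G : Type} [NormedAddCommGroup G] [NormedSpace ℝ G] (hκ : IsKernel κ)
    (L : W →L[ℝ] G) : IsKernel fun x => L (κ x) :=
  ⟨L.contDiff.comp hκ.smooth, (closure_mono (Function.support_comp_subset L.map_zero κ)).trans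
    hκ.support⟩

theorem continuous_comp_sub (hκ : IsKernel κ) (x : E d) : Continuous fun y => κ (x - y) :=
  hκ.smooth.continuous.comp (continuous_const.sub continuous_id)

theorem hasCompactSupport_comp_sub (hκ : IsKernel κ) (x : E d) :
    HasCompactSupport fun y => κ (x - y) :=
  hκ.hasCompactSupport.comp_homeomorph (Homeomorph.subLeft x)

theorem integrable_smul (hκ : IsKernel κ) (hf : LocallyIntegrable f) (x : E d) :
    Integrable fun y => f y • κ (x - y) :=
  hf.integrable_smul_right_of_hasCompactSupport (hκ.continuous_comp_sub x)
    (hκ.hasCompactSupport_comp_sub x)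

theorem contDiff_mollify (hκ : IsKernel κ) (hf : LocallyIntegrable f) :
    ContDiff ℝ ∞ (mollify κ f) := by
  rw [mollify_eq_convolution]
  exact hκ.hasCompactSupport.contDiff_convolution_right (n := ⊤) _ hf hκ.smooth

theorem fderiv_mollify (hκ : IsKernel κ) (hf : LocallyIntegrable f) :
    _root_.fderiv ℝ (mollify κ f) = mollify (_root_.fderiv ℝ κ) f := by
  ext1 x
  have h := hκ.hasCompactSupport.hasFDerivAt_convolution_right
    (ContinuousLinearMap.lsmul ℝ ℝ : ℝ →L[ℝ] W →L[ℝ] W) hf (hκ.smooth.of_le (natCast_le_infty 1)) x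
  rw [mollify_eq_convolution, h.fderiv]
  rfl

theorem mollify_clm [CompleteSpace W] {G : Type} [NormedAddCommGroup G] [NormedSpace ℝ G]
    [CompleteSpace G] (hκ : IsKernel κ)
    (hf : LocallyIntegrable f) (L : W →L[ℝ] G) (x : E d) :
    mollify (fun y => L (κ y)) f x = L (mollify κ f x) := by
  rw [mollify, mollify, ← L.integral_comp_comm (hκ.integrable_smul hf x)]
  simp only [map_smul]

/-- All derivatives fall on the kernel. Kernels take values in a normed space so that the
derivatives of a kernel are again kernels and can be treated by the same estimates. -/
theorem iteratedFDeriv_mollify [CompleteSpace W] (hκ : IsKernel κ) (hf : LocallyIntegrable f)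
    (n : ℕ) : _root_.iteratedFDeriv ℝ n (mollify κ f) = mollify (_root_.iteratedFDeriv ℝ n κ) f := by
  induction n with
  | zero =>
    ext1 x
    exact ((hκ.mollify_clm hf
      (continuousMultilinearCurryFin0 ℝ (E d) W).symm.toContinuousLinearEquiv.toContinuousLinearMap) x).symm
  | succ n ih =>
    rw [iteratedFDeriv_succ_eq_comp_left, ih, (hκ.iteratedFDeriv n).fderiv_mollify hf]
    ext1 x
    exact ((hκ.iteratedFDeriv n).fderiv.mollify_clm hf
      (continuousMultilinearCurryLeftEquiv ℝ (fun _ : Fin (n + 1) => E d)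
        W).symm.toContinuousLinearEquiv.toContinuousLinearMap x).symm

theorem _root_.EikonalBounds.mollify_const [CompleteSpace W] (κ : E d → W) (a : ℝ) (x : E d) :
    mollify κ (fun _ => a) x = a • ∫ y, κ y := by
  rw [mollify, integral_smul]
  congr 1
  exact integral_sub_left_eq_self κ volume x

/-- Mollifying the constant one gives a constant function, whose derivatives vanish; computed on the
kernel, these derivatives are the integral. -/
theorem integral_iteratedFDeriv [CompleteSpace W] (hκ : IsKernel κ) {n : ℕ} (hn : 1 ≤ n) :
    ∫ y, _root_.iteratedFDeriv ℝ n κ y = 0 := by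
  have h1 := mollify_const (_root_.iteratedFDeriv ℝ n κ) 1 0
  rw [← hκ.iteratedFDeriv_mollify (locallyIntegrable_const 1) n] at h1
  have h2 : mollify κ (fun _ => (1 : ℝ)) = fun _ => (1 : ℝ) • ∫ y, κ y := by
    ext1 x; exact mollify_const κ 1 x
  rw [h2] at h1
  obtain ⟨m, rfl⟩ := Nat.exists_eq_add_of_le' hn
  rw [iteratedFDeriv_succ_const, one_smul] at h1
  exact h1.symm

theorem norm_mollify_le (hκ : IsKernel κ) {B : ℝ} {x : E d} (hB : ∀ y, ‖x - y‖ ≤ 1 → |f y| ≤ B) :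
    ‖mollify κ f x‖ ≤ B * ∫ y, ‖κ y‖ := by
  have h1 : ∫ y, ‖κ (x - y)‖ = ∫ y, ‖κ y‖ := integral_sub_left_eq_self (fun y => ‖κ y‖) volume x
  rw [mollify, ← h1, ← integral_const_mul]
  refine norm_integral_le_of_norm_le ?_ (Eventually.of_forall fun y => ?_)
  · exact (((hκ.continuous_comp_sub x).integrable_of_hasCompactSupport
      (hκ.hasCompactSupport_comp_sub x)).norm).const_mul B
  · rcases le_or_gt ‖x - y‖ 1 with h | h
    · rw [norm_smul, Real.norm_eq_abs]
      gcongr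
      exact hB y h
    · simp [hκ.eq_zero h]

theorem norm_mollify_le_of_ae (hκ : IsKernel κ) {B : ℝ} {x : E d} (hB : ∀ᵐ y, |f y| ≤ B) :
    ‖mollify κ f x‖ ≤ B * ∫ y, ‖κ y‖ := by
  have h1 : ∫ y, ‖κ (x - y)‖ = ∫ y, ‖κ y‖ := integral_sub_left_eq_self (fun y => ‖κ y‖) volume x
  rw [mollify, ← h1, ← integral_const_mul]
  refine norm_integral_le_of_norm_le ?_ (hB.mono fun y hy => ?_)
  · exact (((hκ.continuous_comp_sub x).integrable_of_hasCompactSupport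
      (hκ.hasCompactSupport_comp_sub x)).norm).const_mul B
  · rw [norm_smul, Real.norm_eq_abs]
    gcongr

/-- A kernel of mean zero does not see constants, so a bound on the oscillation of `f` can replace a
bound on its size. -/
theorem mollify_sub_const [CompleteSpace W] (hκ : IsKernel κ) (h0 : ∫ y, κ y = 0) (a : ℝ)
    (hf : LocallyIntegrable f) (x : E d) : mollify κ f x = mollify κ (fun y => f y - a) x := by
  have h1 := mollify_const κ a x
  rw [h0, smul_zero] at h1
  rw [← sub_zero (mollify κ f x), ← h1, mollify, mollify, mollify, ← integral_sub
    (hκ.integrable_smul hf x) (hκ.integrable_smul (locallyIntegrable_const a) x)]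
  simp only [sub_smul]

theorem mollify_add (hκ : IsKernel κ) {g : E d → ℝ} (hf : LocallyIntegrable f)
    (hg : LocallyIntegrable g) (x : E d) :
    mollify κ (fun y => f y + g y) x = mollify κ f x + mollify κ g x := by
  rw [mollify, mollify, mollify, ← integral_add (hκ.integrable_smul hf x) (hκ.integrable_smul hg x)]
  simp only [add_smul]

theorem _root_.EikonalBounds.mollify_const_mul (κ : E d → W) (f : E d → ℝ) (a : ℝ) (x : E d) :
    mollify κ (fun y => a * f y) x = a • mollify κ f x := by
  simp only [mollify, mul_smul, integral_smul]

theorem mollify_sum (hκ : IsKernel κ) {ι : Type} (s : Finset ι) {g : ι → E d → ℝ}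
    (hg : ∀ i ∈ s, LocallyIntegrable (g i)) (x : E d) :
    mollify κ (fun y => ∑ i ∈ s, g i y) x = ∑ i ∈ s, mollify κ (g i) x := by
  simp only [mollify, Finset.sum_smul]
  exact integral_finsetSum s fun i hi => hκ.integrable_smul (hg i hi) x

end IsKernel

theorem locallyIntegrable_comp_smul {f : E d → ℝ} (hf : LocallyIntegrable f) {r : ℝ}
    (hr : r ≠ 0) : LocallyIntegrable fun y => f (r • y) := by
  rw [locallyIntegrable_iff]
  intro k hk
  have h1 : IsCompact ((fun y : E d => r • y) '' k) := hk.image (continuous_const_smul r)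
  have h2 := (integrable_indicator_iff h1.measurableSet).2 (hf.integrableOn_isCompact h1)
  have h3 := h2.comp_smul hr
  rw [← integrable_indicator_iff hk.measurableSet]
  refine h3.congr (Eventually.of_forall fun y => ?_)
  by_cases hy : y ∈ k
  · rw [indicator_of_mem hy]
    exact indicator_of_mem (mem_image_of_mem (fun y : E d => r • y) hy) f
  · rw [indicator_of_notMem hy]
    refine indicator_of_notMem (fun h => hy ?_) f
    obtain ⟨y', hy', he⟩ := h
    rwa [← smul_right_injective (E d) hr he]

theorem ae_comp_smul {p : E d → Prop} (hp : ∀ᵐ y, p y) {r : ℝ} (hr : r ≠ 0) :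
    ∀ᵐ y : E d, p (r • y) := by
  have h := (Measure.quasiMeasurePreserving_smul (volume : Measure (E d)) hr)
  exact h.ae hp

/-- Integration by parts for a weak derivative, on the unit scale. -/
theorem HasWeakPartial.mollify {m : Fin d} {f h : E d → ℝ} (hfh : HasWeakPartial m f h) {r : ℝ}
    (hr : r ≠ 0) {κ : E d → ℝ} (hκ : IsKernel κ) (x : E d) :
    mollify (fun y => fderiv ℝ κ y (e m)) (fun y => f (r • y)) x =
      r * mollify κ (fun y => h (r • y)) x := by
  -- The test function is the reflected and dilated kernel; its derivative brings out `-r⁻¹`, which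
  -- accounts for the factor `r` and cancels the sign of the integration by parts.
  let ψ : E d → ℝ := fun y => κ (x - r⁻¹ • y)
  have hψs : ContDiff ℝ ∞ ψ := hκ.smooth.comp (contDiff_const.sub (contDiff_const_smul r⁻¹))
  have hψc : HasCompactSupport ψ := by
    refine hκ.hasCompactSupport.comp_homeomorph
      ((Homeomorph.smulOfNeZero r⁻¹ (inv_ne_zero hr)).trans (Homeomorph.subLeft x))
  have hd : ∀ y, fderiv ℝ ψ y (e m) = -(r⁻¹ * fderiv ℝ κ (x - r⁻¹ • y) (e m)) := fun y => by
    have h1 : HasFDerivAt (fun y : E d => x - r⁻¹ • y) (-(r⁻¹ • ContinuousLinearMap.id ℝ (E d))) y :=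
      ((hasFDerivAt_id (𝕜 := ℝ) y).const_smul r⁻¹).const_sub x
    have h2 : HasFDerivAt ψ _ y := HasFDerivAt.comp y
      ((hκ.smooth.differentiable (by simp) (x - r⁻¹ • y)).hasFDerivAt) h1
    rw [h2.fderiv]; simp
  have key := hfh.2 ψ hψs hψc
  simp only [hd] at key
  have e1 := Measure.integral_comp_smul (volume : Measure (E d))
    (fun y => f y * -(r⁻¹ * fderiv ℝ κ (x - r⁻¹ • y) (e m))) r
  have e2 := Measure.integral_comp_smul (volume : Measure (E d)) (fun y => h y * ψ y) r
  rw [key, smul_neg, ← e2] at e1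
  simp only [smul_smul, inv_mul_cancel₀ hr, one_smul, ψ] at e1
  simp only [EikonalBounds.mollify, smul_eq_mul]
  rw [← neg_inj, neg_eq_iff_eq_neg.1 (neg_neg _), ← mul_neg, ← e1, ← integral_const_mul,
    ← integral_neg]
  refine integral_congr_ae (Eventually.of_forall fun y => ?_)
  field_simp

end Mollify

end EikonalBounds

namespace EikonalBounds

/-! ### Mollification of the inverse of a matrix -/

section Inverse

open Set Filter Topology Pointwise

variable {d : ℕ} {W : Type} [NormedAddCommGroup W] [NormedSpace ℝ W]

theorem abs_mul_apply_le {X Y : Matrix (Fin d) (Fin d) ℝ} {a b : ℝ}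
    (hX : ∀ i j, |X i j| ≤ a) (hY : ∀ i j, |Y i j| ≤ b) (i j : Fin d) :
    |(X * Y) i j| ≤ d * (a * b) := by
  rw [Matrix.mul_apply]
  refine (Finset.abs_sum_le_sum_abs _ _).trans ?_
  calc _ ≤ ∑ _k : Fin d, a * b := Finset.sum_le_sum fun k _ => by
        rw [abs_mul]
        exact mul_le_mul (hX i k) (hY k j) (abs_nonneg _) ((abs_nonneg _).trans (hX i k))
    _ = _ := by simp

/-- From `X⁻¹ - 1 = -(X - 1) X⁻¹` the largest entry `s` of the inverse satisfies `s ≤ 1 + d c s ≤ 1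
+ s / 2`, hence `s ≤ 2`. Inserted back, this bounds the distance of the inverse from the identity.
-/
theorem abs_inv_apply_le {X : Matrix (Fin d) (Fin d) ℝ} (hX : X.PosDef) {c : ℝ}
    (hc : ∀ i j, |X i j - (1 : Matrix (Fin d) (Fin d) ℝ) i j| ≤ c) (hdc : d * c ≤ 1 / 2) :
    (∀ i j, |X⁻¹ i j| ≤ 2) ∧ ∀ i j, |X⁻¹ i j - (1 : Matrix (Fin d) (Fin d) ℝ) i j| ≤ 2 * d * c := by
  have hu : IsUnit X.det := (hX.det_pos).ne'.isUnit
  have h1 : X⁻¹ - 1 = -((X - 1) * X⁻¹) := by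
    rw [sub_mul, Matrix.mul_nonsing_inv _ hu, one_mul]; abel
  have h2 : ∀ s : ℝ, (∀ i j, |X⁻¹ i j| ≤ s) →
      ∀ i j, |X⁻¹ i j - (1 : Matrix (Fin d) (Fin d) ℝ) i j| ≤ d * (c * s) := fun s hs i j => by
    have h3 := congrFun (congrFun h1 i) j
    rw [Matrix.sub_apply] at h3
    rw [h3, Matrix.neg_apply, abs_neg]
    exact abs_mul_apply_le (fun i j => hc i j) hs i j
  have h4 : ∀ i j, |X⁻¹ i j| ≤ 2 := by
    rcases isEmpty_or_nonempty (Fin d) with he | he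
    · exact fun i => (he.false i).elim
    obtain ⟨⟨i₀, j₀⟩, hij⟩ := exists_eq_ciSup_of_finite (f := fun p : Fin d × Fin d => |X⁻¹ p.1 p.2|)
    have hs : ∀ i j, |X⁻¹ i j| ≤ |X⁻¹ i₀ j₀| := fun i j => by
      simp only at hij
      rw [hij]
      exact le_ciSup (f := fun p : Fin d × Fin d => |X⁻¹ p.1 p.2|)
        (Finite.bddAbove_range _) (i, j)
    have h5 := h2 _ hs i₀ j₀
    have h6 : |(1 : Matrix (Fin d) (Fin d) ℝ) i₀ j₀| ≤ 1 := by
      rw [Matrix.one_apply]; split_ifs <;> simp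
    have h7 := abs_sub_abs_le_abs_sub (X⁻¹ i₀ j₀) ((1 : Matrix (Fin d) (Fin d) ℝ) i₀ j₀)
    have h8 : d * (c * |X⁻¹ i₀ j₀|) ≤ 1 / 2 * |X⁻¹ i₀ j₀| := by
      rw [← mul_assoc]; gcongr
    exact fun i j => (hs i j).trans (by linarith)
  exact ⟨h4, fun i j => (h2 2 h4 i j).trans_eq (by ring)⟩

/-- A matrix valued function close to the identity with slowly varying entries. -/
structure IsSlowlyVarying (m : E d → Matrix (Fin d) (Fin d) ℝ) (c l : ℝ) : Prop where
  posDef : ∀ x, (m x).PosDef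
  near : ∀ x i j, |m x i j - (1 : Matrix (Fin d) (Fin d) ℝ) i j| ≤ c
  lipschitz : ∀ x y i j, |m y i j - m x i j| ≤ l * ‖x - y‖
  small : d * c ≤ 1 / 2
  nonneg : 0 ≤ l

namespace IsSlowlyVarying

variable {m : E d → Matrix (Fin d) (Fin d) ℝ} {c l : ℝ}

theorem abs_inv_le (h : IsSlowlyVarying m c l) (x : E d) (i j : Fin d) : |(m x)⁻¹ i j| ≤ 2 :=
  (abs_inv_apply_le (h.posDef x) (h.near x) h.small).1 i j

theorem inv_sub_inv (h : IsSlowlyVarying m c l) (x y : E d) :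
    (m y)⁻¹ - (m x)⁻¹ = -((m x)⁻¹ * (m y - m x) * (m y)⁻¹) := by
  have hx : IsUnit (m x).det := ((h.posDef x).det_pos).ne'.isUnit
  have hy : IsUnit (m y).det := ((h.posDef y).det_pos).ne'.isUnit
  rw [mul_sub, Matrix.nonsing_inv_mul _ hx, sub_mul, mul_assoc, Matrix.mul_nonsing_inv _ hy]
  simp

/-- The resolvent identity is inserted into itself: an expansion of the inverse to first order
around `x` with an exact remainder quadratic in `m y - m x`. -/
theorem inv_sub_inv_add (h : IsSlowlyVarying m c l) (x y : E d) :
    (m y)⁻¹ - (m x)⁻¹ + (m x)⁻¹ * (m y - m x) * (m x)⁻¹ =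
      (m x)⁻¹ * (m y - m x) * ((m x)⁻¹ * (m y - m x) * (m y)⁻¹) := by
  have h1 := h.inv_sub_inv x y
  have h2 : (m y)⁻¹ = (m x)⁻¹ - ((m x)⁻¹ * (m y - m x) * (m y)⁻¹) := by
    rw [← neg_neg ((m x)⁻¹ * (m y - m x) * (m y)⁻¹), ← h1]; abel
  rw [h1]
  conv_lhs => rw [h2]
  noncomm_ring

theorem abs_inv_sub_inv_le (h : IsSlowlyVarying m c l) (x y : E d) (i j : Fin d) :
    |(m y)⁻¹ i j - (m x)⁻¹ i j| ≤ 4 * d ^ 2 * l * ‖x - y‖ := by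
  have h1 := congrFun (congrFun (h.inv_sub_inv x y) i) j
  rw [Matrix.sub_apply, Matrix.neg_apply] at h1
  rw [h1, abs_neg]
  refine (abs_mul_apply_le (abs_mul_apply_le (h.abs_inv_le x) (h.lipschitz x y)) (h.abs_inv_le y)
    i j).trans_eq ?_
  ring

theorem abs_inv_sub_inv_add_le (h : IsSlowlyVarying m c l) {x y : E d} (hxy : ‖x - y‖ ≤ 1)
    (i j : Fin d) :
    |(m y)⁻¹ i j - (m x)⁻¹ i j + ((m x)⁻¹ * (m y - m x) * (m x)⁻¹) i j| ≤ 8 * d ^ 4 * l ^ 2 := by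
  have h1 := congrFun (congrFun (h.inv_sub_inv_add x y) i) j
  rw [Matrix.add_apply, Matrix.sub_apply] at h1
  rw [h1]
  have hl := h.nonneg
  have h2 : ∀ i j, |(m y - m x) i j| ≤ l := fun i j =>
    (h.lipschitz x y i j).trans (mul_le_of_le_one_right h.nonneg hxy)
  have h3 := abs_mul_apply_le (h.abs_inv_le x) h2
  refine (abs_mul_apply_le h3 (abs_mul_apply_le h3 (h.abs_inv_le y)) i j).trans_eq ?_
  ring

theorem continuous_apply (h : IsSlowlyVarying m c l) (i j : Fin d) :
    Continuous fun y => m y i j := by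
  refine (LipschitzWith.of_dist_le_mul (K := ⟨l, h.nonneg⟩) fun x y => ?_).continuous
  rw [dist_comm, Real.dist_eq, dist_eq_norm]
  exact h.lipschitz x y i j

theorem continuous_inv_apply (h : IsSlowlyVarying m c l) (i j : Fin d) :
    Continuous fun y => (m y)⁻¹ i j := by
  have hl := h.nonneg
  refine (LipschitzWith.of_dist_le_mul (K := ⟨4 * d ^ 2 * l, by positivity⟩) fun x y => ?_).continuous
  rw [dist_comm, Real.dist_eq, dist_eq_norm]
  exact h.abs_inv_sub_inv_le x y i j

theorem norm_mollify_le [CompleteSpace W] (h : IsSlowlyVarying m c l) {κ : E d → W}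
    (hκ : IsKernel κ) (h0 : ∫ y, κ y = 0) (i j : Fin d) (x : E d) :
    ‖mollify κ (fun y => m y i j) x‖ ≤ l * ∫ y, ‖κ y‖ := by
  rw [hκ.mollify_sub_const h0 (m x i j) (h.continuous_apply i j).locallyIntegrable]
  exact hκ.norm_mollify_le fun y hy => (h.lipschitz x y i j).trans
    (mul_le_of_le_one_right h.nonneg hy)

theorem norm_mollify_inv_le [CompleteSpace W] (h : IsSlowlyVarying m c l) {κ : E d → W}
    (hκ : IsKernel κ) (h0 : ∫ y, κ y = 0) (i j : Fin d) (x : E d) :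
    ‖mollify κ (fun y => (m y)⁻¹ i j) x‖ ≤ 4 * d ^ 2 * l * ∫ y, ‖κ y‖ := by
  have hl := h.nonneg
  rw [hκ.mollify_sub_const h0 ((m x)⁻¹ i j) (h.continuous_inv_apply i j).locallyIntegrable]
  exact hκ.norm_mollify_le fun y hy => (h.abs_inv_sub_inv_le x y i j).trans
    (mul_le_of_le_one_right (by positivity) hy)

theorem mul_mul_apply (A X : Matrix (Fin d) (Fin d) ℝ) (i j : Fin d) :
    (A * X * A) i j = ∑ k, ∑ n, A i k * A n j * X k n := by
  simp only [Matrix.mul_apply, Finset.sum_mul]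
  rw [Finset.sum_comm]
  exact Finset.sum_congr rfl fun k _ => Finset.sum_congr rfl fun n _ => by ring

/-- Against a kernel of mean zero, the inverse behaves like minus its first variation, with the
inverse frozen at `x`. The error is quadratic in `l`; for a metric dilated by `r`, where `l = c *
r`, it therefore has the size of a second derivative. -/
theorem norm_mollify_inv_add_le [CompleteSpace W] (h : IsSlowlyVarying m c l) {κ : E d → W}
    (hκ : IsKernel κ) (h0 : ∫ y, κ y = 0) (i j : Fin d) (x : E d) :
    ‖mollify κ (fun y => (m y)⁻¹ i j) x +
      ∑ k, ∑ n, ((m x)⁻¹ i k * (m x)⁻¹ n j) • mollify κ (fun y => m y k n) x‖ ≤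
      8 * d ^ 4 * l ^ 2 * ∫ y, ‖κ y‖ := by
  have hc1 := fun i j => (h.continuous_apply i j)
  have hc2 := h.continuous_inv_apply i j
  have hc3 : ∀ k n, Continuous fun y => m y k n - m x k n := fun k n => (hc1 k n).sub continuous_const
  have hc6 : ∀ k n, Continuous fun y => (m x)⁻¹ i k * (m x)⁻¹ n j * (m y k n - m x k n) :=
    fun k n => continuous_const.mul (hc3 k n)
  have hc7 : Continuous fun y => (m y)⁻¹ i j - (m x)⁻¹ i j := hc2.sub continuous_const
  have hc4 : ∀ k, Continuous fun y => ∑ n, (m x)⁻¹ i k * (m x)⁻¹ n j * (m y k n - m x k n) :=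
    fun k => continuous_finsetSum _ fun n _ => hc6 k n
  have hc5 : Continuous fun y => ∑ k, ∑ n, (m x)⁻¹ i k * (m x)⁻¹ n j * (m y k n - m x k n) :=
    continuous_finsetSum _ fun k _ => hc4 k
  have e1 : ∑ k, ∑ n, ((m x)⁻¹ i k * (m x)⁻¹ n j) • mollify κ (fun y => m y k n) x =
      mollify κ (fun y => ∑ k, ∑ n, (m x)⁻¹ i k * (m x)⁻¹ n j * (m y k n - m x k n)) x := by
    rw [hκ.mollify_sum _ (fun k _ => (hc4 k).locallyIntegrable)]
    refine Finset.sum_congr rfl fun k _ => ?_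
    rw [hκ.mollify_sum _ (fun n _ => (hc6 k n).locallyIntegrable)]
    refine Finset.sum_congr rfl fun n _ => ?_
    rw [mollify_const_mul, hκ.mollify_sub_const h0 (m x k n) (hc1 k n).locallyIntegrable]
  rw [e1, hκ.mollify_sub_const h0 ((m x)⁻¹ i j) hc2.locallyIntegrable, ← hκ.mollify_add
    hc7.locallyIntegrable hc5.locallyIntegrable]
  refine hκ.norm_mollify_le fun y hy => ?_
  have := h.abs_inv_sub_inv_add_le hy i j
  rwa [mul_mul_apply] at this

theorem abs_mollify_inv_sub_le (h : IsSlowlyVarying m c l) {κ : E d → ℝ}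
    (hκ : IsKernel κ) (h1 : ∫ y, κ y = 1) (i j : Fin d) (x : E d) :
    |mollify κ (fun y => (m y)⁻¹ i j) x - (m x)⁻¹ i j| ≤ 4 * d ^ 2 * l * ∫ y, ‖κ y‖ := by
  have hl := h.nonneg
  have e1 : mollify κ (fun y => (m y)⁻¹ i j) x - (m x)⁻¹ i j
      = mollify κ (fun y => (m y)⁻¹ i j - (m x)⁻¹ i j) x := by
    have e2 := mollify_const κ (-(m x)⁻¹ i j) x
    rw [h1, smul_eq_mul, mul_one] at e2
    rw [sub_eq_add_neg, ← e2, ← hκ.mollify_add (h.continuous_inv_apply i j).locallyIntegrable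
      (locallyIntegrable_const _)]
    simp only [sub_eq_add_neg]
  rw [e1]
  exact hκ.norm_mollify_le fun y hy => (h.abs_inv_sub_inv_le x y i j).trans
    (mul_le_of_le_one_right (by positivity) hy)

theorem abs_mollify_inv_sub_one_le (h : IsSlowlyVarying m c l) {κ : E d → ℝ}
    (hκ : IsKernel κ) (h1 : ∫ y, κ y = 1) (i j : Fin d) (x : E d) :
    |mollify κ (fun y => (m y)⁻¹ i j) x - (1 : Matrix (Fin d) (Fin d) ℝ) i j| ≤
      2 * d * c * ∫ y, ‖κ y‖ := by
  set a := (1 : Matrix (Fin d) (Fin d) ℝ) i j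
  have e1 : mollify κ (fun y => (m y)⁻¹ i j) x - a = mollify κ (fun y => (m y)⁻¹ i j - a) x := by
    have e2 := mollify_const κ (-a) x
    rw [h1, smul_eq_mul, mul_one] at e2
    rw [sub_eq_add_neg, ← e2, ← hκ.mollify_add (h.continuous_inv_apply i j).locallyIntegrable
      (locallyIntegrable_const _)]
    simp only [sub_eq_add_neg]
  rw [e1]
  exact hκ.norm_mollify_le fun y _ => (abs_inv_apply_le (h.posDef y) (h.near y) h.small).2 i j

end IsSlowlyVarying

theorem IsKernel.integral_fderiv [CompleteSpace W] {κ : E d → W} (hκ : IsKernel κ) :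
    ∫ y, _root_.fderiv ℝ κ y = 0 := by
  have h1 := mollify_const (_root_.fderiv ℝ κ) 1 0
  rw [← hκ.fderiv_mollify (locallyIntegrable_const 1)] at h1
  have h2 : mollify κ (fun _ => (1 : ℝ)) = fun _ => (1 : ℝ) • ∫ y, κ y := by
    ext1 x; exact mollify_const κ 1 x
  rw [h2, fderiv_fun_const, one_smul] at h1
  exact h1.symm

/-- Mollification of a function of bounded mean oscillation with a kernel of mean zero. -/
theorem IsKernel.norm_mollify_le_of_bmo [CompleteSpace W] {κ : E d → W} (hκ : IsKernel κ)
    (h0 : ∫ y, κ y = 0) {S : ℝ} (hS : ∀ y, ‖κ y‖ ≤ S) {f : E d → ℝ} (hf : LocallyIntegrable f)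
    {c : ℝ} (hc : 0 ≤ c) (hbmo : bmoNorm f ≤ ENNReal.ofReal c) {r : ℝ} (hr : 0 < r) (x : E d) :
    ‖mollify κ (fun y => f (r • y)) x‖ ≤ c * (S * volume.real (Metric.ball (0 : E d) 2)) := by
  have hS0 : 0 ≤ S := (norm_nonneg _).trans (hS 0)
  -- After dilation the kernel lives in a closed ball of radius `r`; the doubled radius provides an
  -- open ball which contains it, as the definition of `bmoNorm` requires.
  set Q := Metric.ball (r • x) (r * 2)
  set a := ⨍ z in Q, f z
  have hQ : r • Metric.ball x 2 = Q := by
    rw [smul_ball hr.ne', Real.norm_of_nonneg hr.le]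
  have hfin : volume Q ≠ ⊤ := measure_ball_lt_top.ne
  have hpos : volume Q ≠ 0 := (Metric.measure_ball_pos volume _ (by positivity)).ne'
  have h1 : ∫⁻ y in Q, ‖f y - a‖ₑ ≤ ENNReal.ofReal c * volume Q := by
    have h2 : ⨍⁻ y in Q, ‖f y - a‖ₑ ∂volume ≤ ENNReal.ofReal c :=
      (le_iSup₂_of_le (f := fun (x : E d) (r : ℝ) => ⨆ _ : 0 < r,
        ⨍⁻ y in Metric.ball x r, ‖f y - ⨍ z in Metric.ball x r, f z ∂volume‖ₑ ∂volume)
        (r • x) (r * 2) (le_iSup_of_le (by positivity) le_rfl)).trans hbmo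
    rw [setLAverage_eq] at h2
    exact (ENNReal.div_le_iff hpos hfin).1 h2
  have hfQ : IntegrableOn f Q := (hf.integrableOn_isCompact (isCompact_closedBall _ _)).mono_set
    Metric.ball_subset_closedBall
  have hfa : IntegrableOn (fun y => f y - a) Q := hfQ.sub (integrableOn_const hfin)
  have h3 : ∫ y in Q, ‖f y - a‖ ≤ c * volume.real Q := by
    rw [integral_norm_eq_lintegral_enorm hfa.aestronglyMeasurable]
    refine ENNReal.toReal_le_of_le_ofReal (by positivity) (h1.trans_eq ?_)
    rw [ENNReal.ofReal_mul hc, ofReal_measureReal hfin]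
  have h4 : ∫ y in Metric.ball x 2, ‖f (r • y) - a‖ ≤ c * volume.real (Metric.ball (0 : E d) 2) := by
    rw [Measure.setIntegral_comp_smul_of_pos volume (fun y => ‖f y - a‖) _ hr, hQ, smul_eq_mul]
    have e1 : volume.real Q = r ^ Module.finrank ℝ (E d) * volume.real (Metric.ball (0 : E d) 2) := by
      rw [← hQ, measureReal_def, Measure.addHaar_smul, ENNReal.toReal_mul,
        ENNReal.toReal_ofReal (abs_nonneg _), abs_of_pos (by positivity),
        Measure.addHaar_ball_center, measureReal_def]
    rw [e1] at h3
    rw [inv_mul_le_iff₀ (by positivity)]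
    linarith
  have hfr := locallyIntegrable_comp_smul hf hr.ne'
  rw [hκ.mollify_sub_const h0 a hfr]
  have hint : IntegrableOn (fun y => f (r • y) - a) (Metric.ball x 2) :=
    ((hfr.integrableOn_isCompact (isCompact_closedBall x 2)).mono_set
      Metric.ball_subset_closedBall).sub (integrableOn_const measure_ball_lt_top.ne)
  have h5 : mollify κ (fun y => f (r • y) - a) x =
      ∫ y in Metric.ball x 2, (f (r • y) - a) • κ (x - y) := by
    refine (setIntegral_eq_integral_of_forall_compl_eq_zero fun y hy => ?_).symm
    have h6 : 1 < ‖x - y‖ := by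
      rw [Metric.mem_ball, dist_comm, dist_eq_norm, not_lt] at hy; linarith
    rw [hκ.eq_zero h6, smul_zero]
  rw [h5]
  refine (norm_integral_le_of_norm_le (hint.norm.mul_const S) (Eventually.of_forall fun y => ?_)).trans ?_
  · rw [norm_smul]; gcongr; exact hS _
  · rw [integral_mul_const]
    calc _ ≤ c * volume.real (Metric.ball (0 : E d) 2) * S := by gcongr
      _ = _ := by ring

end Inverse

end EikonalBounds

namespace EikonalBounds

/-! ### Regularization of a metric of bounded curvature -/

section Metric

open Set Filter Topology

variable {d : ℕ}

theorem fderiv_comp_dilation {W : Type} [NormedAddCommGroup W] [NormedSpace ℝ W] {f : E d → W}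
    (hf : Differentiable ℝ f) (s : ℝ) (x : E d) :
    fderiv ℝ (fun y => f (s • y)) x = s • fderiv ℝ f (s • x) := by
  have h1 : HasFDerivAt (fun y : E d => s • y) (s • ContinuousLinearMap.id ℝ (E d)) x :=
    (hasFDerivAt_id (𝕜 := ℝ) x).const_smul s
  have h2 : HasFDerivAt (fun y => f (s • y)) _ x := HasFDerivAt.comp x (hf (s • x)).hasFDerivAt h1
  rw [h2.fderiv]
  ext1 u; simp

theorem fderiv_fderiv_comp_dilation {f : E d → ℝ} (hf : ContDiff ℝ ∞ f) (s : ℝ) (x : E d) :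
    fderiv ℝ (fderiv ℝ fun y => f (s • y)) x = s ^ 2 • fderiv ℝ (fderiv ℝ f) (s • x) := by
  have h1 : (fderiv ℝ fun y => f (s • y)) = fun y => s • fderiv ℝ f (s • y) := by
    ext1 y; exact fderiv_comp_dilation (hf.differentiable (by simp)) s y
  have h2 : Differentiable ℝ (fderiv ℝ f) :=
    (hf.fderiv_right (m := ∞) (by simp)).differentiable (by simp)
  have h3 : DifferentiableAt ℝ (fun y => fderiv ℝ f (s • y)) x :=
    (h2.comp (differentiable_id.const_smul s)) x
  rw [h1, fderiv_fun_const_smul h3, fderiv_comp_dilation h2, smul_smul, sq]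

/-- Bounds for the regularizations `G` of the inverse of a metric and `H` of the metric. -/
structure RegularCoefficients (G H : Fin d → Fin d → E d → ℝ) (ε r : ℝ) (B : ℕ → ℝ) : Prop where
  smooth_inv : ∀ i j, ContDiff ℝ ∞ (G i j)
  smooth : ∀ i j, ContDiff ℝ ∞ (H i j)
  symm : ∀ i j x, G i j x = G j i x
  inv_sub_le : ∀ i j x, |G i j x - (1 : Matrix (Fin d) (Fin d) ℝ) i j| ≤ ε
  fderiv_inv_le : ∀ i j x, ‖fderiv ℝ (G i j) x‖ ≤ ε
  fderiv_le : ∀ i j x, ‖fderiv ℝ (H i j) x‖ ≤ ε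
  second : ∀ i j x u v, |fderiv ℝ (fderiv ℝ (G i j)) x u v +
    ∑ k, ∑ n, G i k x * G n j x * fderiv ℝ (fderiv ℝ (H k n)) x u v| ≤ ε * (‖u‖ * ‖v‖)
  curvature : ∀ i j k l x,
    |fderiv ℝ (fderiv ℝ (H i k)) x (e j) (e l) + fderiv ℝ (fderiv ℝ (H j l)) x (e i) (e k)
      - fderiv ℝ (fderiv ℝ (H i l)) x (e j) (e k)
      - fderiv ℝ (fderiv ℝ (H j k)) x (e i) (e l)| ≤ ε
  scaled_le : ∀ n, 1 ≤ n → ∀ i j x, ‖iteratedFDeriv ℝ n (fun y => G i j (r • y)) x‖ ≤ B n * r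
  scaled_le_sq : ∀ n, 3 ≤ n → ∀ i j x,
    ‖iteratedFDeriv ℝ n (fun y => G i j (r • y)) x‖ ≤ B n * r ^ 2

theorem abs_le_of_lipNorm_le {f : E d → ℝ} {c : ℝ} (hc : 0 ≤ c)
    (h : lipNorm f ≤ ENNReal.ofReal c) (x : E d) : |f x| ≤ c := by
  have h1 : ‖f x‖ₑ ≤ ENNReal.ofReal c :=
    ((le_iSup (fun x => ‖f x‖ₑ) x).trans le_self_add).trans h
  rw [← ofReal_norm, ENNReal.ofReal_le_ofReal_iff hc] at h1
  exact h1

theorem abs_sub_le_of_lipNorm_le {f : E d → ℝ} {c : ℝ} (hc : 0 ≤ c)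
    (h : lipNorm f ≤ ENNReal.ofReal c) (x y : E d) : |f x - f y| ≤ c * ‖x - y‖ := by
  rcases eq_or_ne x y with rfl | hxy
  · simp
  have h1 : edist (f x) (f y) / edist x y ≤ ENNReal.ofReal c :=
    ((le_iSup₂ (f := fun x y => edist (f x) (f y) / edist x y) x y).trans le_add_self).trans h
  rw [ENNReal.div_le_iff (edist_pos.2 hxy).ne' (edist_ne_top x y), edist_dist, edist_dist,
    ← ENNReal.ofReal_mul hc, ENNReal.ofReal_le_ofReal_iff (by positivity), Real.dist_eq,
    dist_eq_norm] at h1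
  exact h1

/-- The weak derivative of a Lipschitz function is bounded. -/
theorem HasWeakPartial.ae_abs_le {m : Fin d} {f h : E d → ℝ} (hfh : HasWeakPartial m f h) {c : ℝ}
    (hc : 0 ≤ c) (hf : ∀ x y, |f x - f y| ≤ c * ‖x - y‖) : ∀ᵐ x, |h x| ≤ c := by
  have hl : LipschitzWith ⟨c, hc⟩ f := LipschitzWith.of_dist_le_mul fun x y => by
    rw [Real.dist_eq, dist_eq_norm]; exact hf x y
  have hb : ∀ x, |lineDeriv ℝ f x (e m)| ≤ c := fun x => by
    have := norm_lineDeriv_le_of_lipschitz ℝ hl (x₀ := x) (v := e m)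
    rw [norm_e, mul_one] at this
    exact this
  have hli : LocallyIntegrable (fun x => lineDeriv ℝ f x (e m)) :=
    (locallyIntegrable_const c).mono (measurable_lineDeriv hl.continuous).aestronglyMeasurable
      (Eventually.of_forall fun x => by
        rw [Real.norm_eq_abs, Real.norm_eq_abs, abs_of_nonneg hc]; exact hb x)
  -- A Lipschitz function satisfies the integration by parts formula with its line derivative, so
  -- the weak derivative equals the line derivative almost everywhere, and the latter is bounded by
  -- the Lipschitz constant.
  have h1 := ae_eq_of_integral_contDiff_smul_eq hfh.1 hli fun ψ hψ hψc => by
    obtain ⟨D, hD⟩ := ContDiff.lipschitzWith_of_hasCompactSupport hψc hψ (by simp)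
    have h2 := hl.integral_lineDeriv_mul_eq (μ := volume) hD hψc (e m)
    have h3 := hfh.2 ψ hψ hψc
    simp only [smul_eq_mul, mul_comm (ψ _)]
    rw [h2]
    have h4 : ∀ x, lineDeriv ℝ ψ x (-e m) * f x = -(f x * fderiv ℝ ψ x (e m)) := fun x => by
      rw [((hψ.differentiable (by simp)) x).lineDeriv_eq_fderiv, map_neg]; ring
    simp only [h4]
    rw [integral_neg, h3, neg_neg]
  exact h1.mono fun x hx => by rw [hx]; exact hb x

/-- The part of the curvature which is linear in the second derivatives. -/
theorem abs_linear_riemann_le {g : Matrix (Fin d) (Fin d) ℝ} {dg : Fin d → Fin d → Fin d → ℝ}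
    {ddg : Fin d → Fin d → Fin d → Fin d → ℝ} {c : ℝ} (hc1 : c ≤ 1)
    (hg : ∀ i j, |g i j| ≤ 2) (hg' : ∀ i j, |g⁻¹ i j| ≤ 2) (hdg : ∀ l i j, |dg l i j| ≤ c)
    {i j k l : Fin d} (hR : |riemann g dg ddg i j k l| ≤ c) :
    |ddg j l i k + ddg i k j l - ddg j k i l - ddg i l j k| ≤ (2 + 72 * d ^ 4) * c := by
  have hc : 0 ≤ c := (abs_nonneg _).trans hR
  have hΓ : ∀ m i j, |christoffel g dg m i j| ≤ 3 * d * c := fun m i j => by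
    rw [christoffel, abs_mul, abs_of_pos (by norm_num : (0 : ℝ) < 1 / 2)]
    have h1 : |∑ l, g⁻¹ m l * (dg i j l + dg j i l - dg l i j)| ≤ ∑ _l : Fin d, 2 * (3 * c) := by
      refine (Finset.abs_sum_le_sum_abs _ _).trans (Finset.sum_le_sum fun l _ => ?_)
      rw [abs_mul]
      refine mul_le_mul (hg' m l) ?_ (abs_nonneg _) zero_le_two
      have a1 := abs_le.1 (hdg i j l)
      have a2 := abs_le.1 (hdg j i l)
      have a3 := abs_le.1 (hdg l i j)
      rw [abs_le]; constructor <;> linarith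
    rw [Finset.sum_const, Finset.card_univ, Fintype.card_fin, nsmul_eq_mul] at h1
    linarith
  have hS : |∑ m, ∑ n, g m n * (christoffel g dg m j l * christoffel g dg n i k
          - christoffel g dg m j k * christoffel g dg n i l)| ≤ 36 * d ^ 4 * c ^ 2 := by
    have h1 : ∀ m n, |g m n * (christoffel g dg m j l * christoffel g dg n i k
          - christoffel g dg m j k * christoffel g dg n i l)| ≤ 2 * (2 * (3 * d * c) ^ 2) := by
      intro m n
      rw [abs_mul]
      refine mul_le_mul (hg m n) ?_ (abs_nonneg _) zero_le_two
      refine (abs_sub _ _).trans ?_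
      rw [abs_mul, abs_mul, two_mul, sq]
      gcongr <;> exact hΓ _ _ _
    refine (Finset.abs_sum_le_sum_abs _ _).trans ?_
    calc _ ≤ ∑ _m : Fin d, ∑ _n : Fin d, 2 * (2 * (3 * d * c) ^ 2) :=
          Finset.sum_le_sum fun m _ => (Finset.abs_sum_le_sum_abs _ _).trans
            (Finset.sum_le_sum fun n _ => h1 m n)
      _ = _ := by simp; ring
  have hcc : 36 * (d : ℝ) ^ 4 * c ^ 2 ≤ 36 * d ^ 4 * c := by gcongr; nlinarith
  rw [riemann] at hR
  rw [abs_le] at hR hS ⊢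
  constructor <;> nlinarith [hR.1, hR.2, hS.1, hS.2]

/-- The consequences of the hypotheses on a metric. -/
theorem IsSmallMetric.exists_bounds {c : ℝ} (hc : 0 ≤ c) (hc1 : c ≤ 1) (hdc : d * c ≤ 1 / 2)
    {g : E d → Matrix (Fin d) (Fin d) ℝ} (h : IsSmallMetric c g) :
    (∀ x, (g x).PosDef) ∧ (∀ x i j, |g x i j - (1 : Matrix (Fin d) (Fin d) ℝ) i j| ≤ c) ∧
    (∀ x y i j, |g y i j - g x i j| ≤ c * ‖x - y‖) ∧
    ∃ (dg : Fin d → Fin d → Fin d → E d → ℝ) (ddg : Fin d → Fin d → Fin d → Fin d → E d → ℝ),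
    (∀ m i j, HasWeakPartial m (fun x => g x i j) (dg m i j)) ∧
    (∀ l m i j, HasWeakPartial l (dg m i j) (ddg l m i j)) ∧
    (∀ i j k l, ∀ᵐ x, |ddg j l i k x + ddg i k j l x - ddg j k i l x - ddg i l j k x| ≤
      (2 + 72 * d ^ 4) * c) ∧
    ∀ l m i j, bmoNorm (ddg l m i j) ≤ ENNReal.ofReal c := by
  obtain ⟨hpd, dg, ddg, hdg, hddg, hle⟩ := h
  have hR := (le_self_add.trans le_self_add).trans hle
  have hL := (le_add_self.trans le_self_add).trans hle
  have hB := le_add_self.trans hle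
  have hL' : ∀ i j, lipNorm (fun x => g x i j - (1 : Matrix (Fin d) (Fin d) ℝ) i j) ≤
      ENNReal.ofReal c := fun i j =>
    (le_iSup₂ (f := fun i j => lipNorm (fun x => g x i j - (1 : Matrix (Fin d) (Fin d) ℝ) i j))
      i j).trans hL
  have hnear : ∀ x i j, |g x i j - (1 : Matrix (Fin d) (Fin d) ℝ) i j| ≤ c := fun x i j =>
    abs_le_of_lipNorm_le hc (hL' i j) x
  have hlip : ∀ x y i j, |g x i j - g y i j| ≤ c * ‖x - y‖ := fun x y i j => by
    simpa using abs_sub_le_of_lipNorm_le hc (hL' i j) x y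
  refine ⟨hpd, hnear, fun x y i j => by rw [abs_sub_comm]; exact hlip x y i j, dg, ddg, hdg, hddg,
    fun i j k l => ?_, fun l m i j => ?_⟩
  · have h1 : eLpNorm (fun x => riemann (g x) (fun a b c => dg a b c x)
        (fun a b c d' => ddg a b c d' x) i j k l) ⊤ volume ≤ ENNReal.ofReal c := by
      refine le_trans ?_ hR
      refine le_iSup_of_le i ?_
      refine le_iSup_of_le j ?_
      refine le_iSup_of_le k ?_
      exact le_iSup_of_le l le_rfl
    rw [eLpNorm_exponent_top] at h1
    have h2 : ∀ᵐ x, ‖riemann (g x) (fun a b c => dg a b c x)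
        (fun a b c d' => ddg a b c d' x) i j k l‖ₑ ≤ ENNReal.ofReal c :=
      (ae_le_eLpNormEssSup).mono fun x hx => hx.trans h1
    have h3 : ∀ᵐ x, ∀ m i j, |dg m i j x| ≤ c := by
      rw [ae_all_iff]; intro m
      rw [ae_all_iff]; intro i
      rw [ae_all_iff]; intro j
      exact (hdg m i j).ae_abs_le hc fun x y => hlip x y i j
    filter_upwards [h2, h3] with x hx hx'
    rw [← ofReal_norm, ENNReal.ofReal_le_ofReal_iff hc] at hx
    refine abs_linear_riemann_le (g := g x) (dg := fun a b c => dg a b c x)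
      (ddg := fun a b c d' => ddg a b c d' x) hc1 (fun i j => ?_)
      (abs_inv_apply_le (hpd x) (hnear x) hdc).1 hx' hx
    have h4 := abs_sub_abs_le_abs_sub (g x i j) ((1 : Matrix (Fin d) (Fin d) ℝ) i j)
    have h5 := hnear x i j
    have h6 : |(1 : Matrix (Fin d) (Fin d) ℝ) i j| ≤ 1 := by
      rw [Matrix.one_apply]; split_ifs <;> simp
    linarith
  · refine le_trans ?_ hB
    refine le_iSup_of_le l ?_
    refine le_iSup_of_le m ?_
    refine le_iSup_of_le i ?_
    exact le_iSup_of_le j le_rfl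

/-- Second derivatives of the regularized metric are regularized weak derivatives. -/
theorem fderiv_fderiv_mollify_weak {χ : E d → ℝ} (hχ : IsKernel χ) {f df ddf : E d → ℝ}
    {l m : Fin d} (hf : LocallyIntegrable f) (h1 : HasWeakPartial m f df)
    (h2 : HasWeakPartial l df ddf) {r : ℝ} (hr : r ≠ 0) (x : E d) :
    fderiv ℝ (fderiv ℝ (mollify χ fun y => f (r • y))) x (e l) (e m) =
      r ^ 2 * mollify χ (fun y => ddf (r • y)) x := by
  have hfr := locallyIntegrable_comp_smul hf hr
  have hs : IsSymmSndFDerivAt ℝ (mollify χ fun y => f (r • y)) x :=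
    (hχ.contDiff_mollify hfr).contDiffAt.isSymmSndFDerivAt (by simp [two_le_infty])
  rw [hs.eq, hχ.fderiv_mollify hfr, hχ.fderiv.fderiv_mollify hfr]
  have hk : IsKernel (fun y => fderiv ℝ χ y (e l)) :=
    hχ.fderiv.clm (ContinuousLinearMap.apply ℝ ℝ (e l))
  have e1 := h1.mollify hr hk x
  rw [h2.mollify hr hχ x] at e1
  rw [sq, mul_assoc, ← e1]
  have e2 := hχ.fderiv.fderiv.mollify_clm hfr ((ContinuousLinearMap.apply ℝ ℝ (e l)).comp
    (ContinuousLinearMap.apply ℝ (E d →L[ℝ] ℝ) (e m))) x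
  refine e2.symm.trans ?_
  congr 1
  ext1 y
  rw [fderiv_mul_const_apply hχ.smooth]; rfl

/-- The bilinear form `(u, v) ↦ u_l v_m`. -/
noncomputable def coordForm (l m : Fin d) : E d →L[ℝ] E d →L[ℝ] ℝ :=
  (EuclideanSpace.proj l : E d →L[ℝ] ℝ).smulRight (EuclideanSpace.proj m : E d →L[ℝ] ℝ)

theorem eq_sum_coordForm (T : E d →L[ℝ] E d →L[ℝ] ℝ) :
    T = ∑ l, ∑ m, T (e l) (e m) • coordForm l m := by
  have hv : ∀ v : E d, v = ∑ i, v i • e i := fun v => by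
    have := (EuclideanSpace.basisFun (Fin d) ℝ).sum_repr v
    simpa [e] using this.symm
  ext u v
  conv_lhs => rw [hv u, hv v]
  simp only [map_sum, map_smul, _root_.sum_apply, _root_.smul_apply, smul_eq_mul,
    Finset.mul_sum, coordForm, ContinuousLinearMap.smulRight_apply]
  rw [Finset.sum_comm]
  refine Finset.sum_congr rfl fun l _ => Finset.sum_congr rfl fun m _ => ?_
  change v m * (u l * _) = T (e l) (e m) * (u l * v m)
  ring

theorem norm_iteratedFDeriv_smul_const_le {Z W : Type} [NormedAddCommGroup Z] [NormedSpace ℝ Z]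
    [NormedAddCommGroup W] [NormedSpace ℝ W] {φ : Z → ℝ} (hφ : ContDiff ℝ ∞ φ) {a : ℝ} (ha : 0 ≤ a) (w : W)
    (n : ℕ) (x : Z) : ContDiff ℝ n (fun x => φ x • a • w) ∧
      ‖iteratedFDeriv ℝ n (fun x => φ x • a • w) x‖ ≤ a * ‖w‖ * ‖iteratedFDeriv ℝ n φ x‖ := by
  refine ⟨(hφ.smul contDiff_const).of_le (natCast_le_infty n), ?_⟩
  have h := (ContinuousLinearMap.toSpanSingleton ℝ (a • w)).norm_iteratedFDeriv_comp_left
    (hφ.contDiffAt (x := x)) (natCast_le_infty n)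
  rw [ContinuousLinearMap.norm_toSpanSingleton, norm_smul, Real.norm_of_nonneg ha] at h
  exact h

/-- Two of the derivatives are moved to the function, where they become weak derivatives in BMO and
bring the factor `r²`. At least one derivative stays on the kernel and gives it mean zero, so the
BMO seminorm suffices. -/
theorem norm_iteratedFDeriv_mollify_weak_le {χ : E d → ℝ} (hχ : IsKernel χ) {f : E d → ℝ}
    (hf : LocallyIntegrable f) {h : Fin d → Fin d → E d → ℝ}
    (hh : ∀ l m, LocallyIntegrable (h l m)) {r : ℝ} (hr : 0 < r)
    (h2 : ∀ x l m, fderiv ℝ (fderiv ℝ (mollify χ fun y => f (r • y))) x (e l) (e m) =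
      r ^ 2 * mollify χ (fun y => h l m (r • y)) x) {c : ℝ} (hc : 0 ≤ c)
    (hbmo : ∀ l m, bmoNorm (h l m) ≤ ENNReal.ofReal c) {n : ℕ} (hn : 1 ≤ n) {S : ℝ}
    (hS : ∀ y, ‖iteratedFDeriv ℝ n χ y‖ ≤ S) (x : E d) :
    ‖iteratedFDeriv ℝ (n + 2) (mollify χ fun y => f (r • y)) x‖ ≤
      (∑ l : Fin d, ∑ m : Fin d, ‖coordForm l m‖) *
        (S * volume.real (Metric.ball (0 : E d) 2)) * c * r ^ 2 := by
  have hfr := locallyIntegrable_comp_smul hf hr.ne'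
  have hhr := fun l m => locallyIntegrable_comp_smul (hh l m) hr.ne'
  have e1 : fderiv ℝ (fderiv ℝ (mollify χ fun y => f (r • y))) =
      fun x => ∑ l, ∑ m, mollify χ (fun y => h l m (r • y)) x • (r ^ 2 • coordForm l m) := by
    ext1 x
    rw [eq_sum_coordForm (fderiv ℝ (fderiv ℝ (mollify χ fun y => f (r • y))) x)]
    refine Finset.sum_congr rfl fun l _ => Finset.sum_congr rfl fun m _ => ?_
    rw [h2, smul_smul, mul_comm]
  have hL := fun l m => norm_iteratedFDeriv_smul_const_le (hχ.contDiff_mollify (hhr l m))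
    (sq_nonneg r) (coordForm l m) n x
  rw [← norm_iteratedFDeriv_fderiv (n := n + 1), ← norm_iteratedFDeriv_fderiv (n := n), e1,
    iteratedFDeriv_fun_sum_apply (fun l _ => ContDiffAt.sum fun m _ => (hL l m).1.contDiffAt)]
  rw [Finset.sum_mul, Finset.sum_mul, Finset.sum_mul]
  refine (norm_sum_le _ _).trans (Finset.sum_le_sum fun l _ => ?_)
  rw [iteratedFDeriv_fun_sum_apply (fun m _ => (hL l m).1.contDiffAt), Finset.sum_mul,
    Finset.sum_mul, Finset.sum_mul]
  refine (norm_sum_le _ _).trans (Finset.sum_le_sum fun m _ => ?_)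
  refine (hL l m).2.trans ?_
  rw [hχ.iteratedFDeriv_mollify (hhr l m)]
  calc _ ≤ r ^ 2 * ‖coordForm l m‖ * (c * (S * volume.real (Metric.ball (0 : E d) 2))) := by
        gcongr
        exact (hχ.iteratedFDeriv n).norm_mollify_le_of_bmo (hχ.integral_iteratedFDeriv hn) hS
          (hh l m) hc (hbmo l m) hr x
    _ = _ := by ring

/-- Up to errors quadratic in `l`, the Hessian of the inverse is minus the Hessian of the metric
with both indices raised. One error is that of the first order expansion (`h3`); the other comes
from raising with the mollified instead of the exact inverse (`h4`), where a difference of size `l`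
meets a mollified Hessian of size `l`. -/
theorem IsSlowlyVarying.abs_second_le {m : E d → Matrix (Fin d) (Fin d) ℝ} {c l : ℝ}
    (hm : IsSlowlyVarying m c l) {χ : E d → ℝ} (hk : IsKernel χ) (h1 : ∫ y, χ y = 1)
    (i j : Fin d) (z u v : E d) :
    |fderiv ℝ (fderiv ℝ (mollify χ fun y => (m y)⁻¹ i j)) z u v +
      ∑ k, ∑ n, mollify χ (fun y => (m y)⁻¹ i k) z * mollify χ (fun y => (m y)⁻¹ n j) z *
        fderiv ℝ (fderiv ℝ (mollify χ fun y => m y k n)) z u v| ≤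
      (∫ y, ‖fderiv ℝ (fderiv ℝ χ) y‖) *
        (8 * d ^ 4 + 8 * d ^ 4 * ((∫ y, ‖χ y‖) * ((∫ y, ‖χ y‖) + 1))) * l ^ 2 * (‖u‖ * ‖v‖) := by
  set I₀ := ∫ y, ‖χ y‖
  set J₂ := ∫ y, ‖fderiv ℝ (fderiv ℝ χ) y‖
  have hI₀0 : 0 ≤ I₀ := integral_nonneg fun _ => norm_nonneg _
  have hJ₂0 : 0 ≤ J₂ := integral_nonneg fun y => norm_nonneg (fderiv ℝ (fderiv ℝ χ) y)
  have hl := hm.nonneg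
  have hmi := fun i j => (hm.continuous_apply i j).locallyIntegrable (μ := volume)
  have hni := fun i j => (hm.continuous_inv_apply i j).locallyIntegrable (μ := volume)
  have hHd : ∀ k n, fderiv ℝ (fderiv ℝ (mollify χ fun y => m y k n)) =
      mollify (fderiv ℝ (fderiv ℝ χ)) fun y => m y k n := fun k n => by
    rw [hk.fderiv_mollify (hmi k n), hk.fderiv.fderiv_mollify (hmi k n)]
  have hGd : fderiv ℝ (fderiv ℝ (mollify χ fun y => (m y)⁻¹ i j)) =
      mollify (fderiv ℝ (fderiv ℝ χ)) fun y => (m y)⁻¹ i j := by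
    rw [hk.fderiv_mollify (hni i j), hk.fderiv.fderiv_mollify (hni i j)]
  set A := (m z)⁻¹
  set G : Fin d → Fin d → ℝ := fun i j => mollify χ (fun y => (m y)⁻¹ i j) z with hGdef
  set P : Fin d → Fin d → E d →L[ℝ] E d →L[ℝ] ℝ := fun k n =>
    mollify (fderiv ℝ (fderiv ℝ χ)) (fun y => m y k n) z with hP
  have hD : ∀ k n, |P k n u v| ≤ l * J₂ * (‖u‖ * ‖v‖) := fun k n => by
    have a1 := hm.norm_mollify_le hk.fderiv.fderiv hk.fderiv.integral_fderiv k n z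
    refine ((P k n).le_opNorm₂ u v).trans ?_
    rw [mul_assoc]
    gcongr
  have hGA : ∀ i j, |G i j - A i j| ≤ 4 * d ^ 2 * l * I₀ := fun i j =>
    hm.abs_mollify_inv_sub_le hk h1 i j z
  have hA : ∀ i j, |A i j| ≤ 2 := hm.abs_inv_le z
  have hG : ∀ i j, |G i j| ≤ 2 * I₀ := fun i j => hk.norm_mollify_le fun y _ =>
    hm.abs_inv_le y i j
  set P₀ : E d →L[ℝ] E d →L[ℝ] ℝ := mollify (fderiv ℝ (fderiv ℝ χ)) (fun y => (m y)⁻¹ i j) z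
  have h3 : |P₀ u v + ∑ k, ∑ n, A i k * A n j * P k n u v| ≤
      8 * d ^ 4 * l ^ 2 * J₂ * (‖u‖ * ‖v‖) := by
    have a1 := hm.norm_mollify_inv_add_le hk.fderiv.fderiv hk.fderiv.integral_fderiv i j z
    have a2 := ((P₀ + ∑ k, ∑ n, (A i k * A n j) • P k n).le_opNorm₂ u v).trans
      (mul_le_mul_of_nonneg_right (mul_le_mul_of_nonneg_right a1 (norm_nonneg u)) (norm_nonneg v))
    rw [← mul_assoc]
    refine le_trans (le_of_eq ?_) a2
    simp only [_root_.add_apply, _root_.sum_apply, _root_.smul_apply, smul_eq_mul,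
      Real.norm_eq_abs]
  have h4 : |∑ k, ∑ n, (G i k * G n j - A i k * A n j) * P k n u v| ≤
      d * (d * (4 * d ^ 2 * l * I₀ * (2 * I₀ + 2) * (l * J₂ * (‖u‖ * ‖v‖)))) := by
    have a1 : ∀ k n, |(G i k * G n j - A i k * A n j) * P k n u v| ≤
        4 * d ^ 2 * l * I₀ * (2 * I₀ + 2) * (l * J₂ * (‖u‖ * ‖v‖)) := fun k n => by
      rw [abs_mul]
      refine mul_le_mul ?_ (hD k n) (abs_nonneg _) (by positivity)
      have a2 : G i k * G n j - A i k * A n j = (G i k - A i k) * G n j + A i k * (G n j - A n j) := by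
        ring
      rw [a2]
      refine (abs_add_le _ _).trans ?_
      rw [abs_mul, abs_mul]
      calc _ ≤ 4 * d ^ 2 * l * I₀ * (2 * I₀) + 2 * (4 * d ^ 2 * l * I₀) :=
            add_le_add (mul_le_mul (hGA i k) (hG n j) (abs_nonneg _) (by positivity))
              (mul_le_mul (hA i k) (hGA n j) (abs_nonneg _) zero_le_two)
        _ = _ := by ring
    calc _ ≤ ∑ _k : Fin d, ∑ _n : Fin d,
          4 * d ^ 2 * l * I₀ * (2 * I₀ + 2) * (l * J₂ * (‖u‖ * ‖v‖)) :=
          (Finset.abs_sum_le_sum_abs _ _).trans (Finset.sum_le_sum fun k _ =>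
            (Finset.abs_sum_le_sum_abs _ _).trans (Finset.sum_le_sum fun n _ => a1 k n))
      _ = _ := by simp
  have h5 : P₀ u v + ∑ k, ∑ n, G i k * G n j * P k n u v =
      (P₀ u v + ∑ k, ∑ n, A i k * A n j * P k n u v) +
        ∑ k, ∑ n, (G i k * G n j - A i k * A n j) * P k n u v := by
    simp only [sub_mul, Finset.sum_sub_distrib]
    ring
  simp only [hGd, hHd]
  change |P₀ u v + ∑ k, ∑ n, G i k * G n j * P k n u v| ≤ _
  rw [h5]
  refine ((abs_add_le _ _).trans (add_le_add h3 h4)).trans (le_of_eq ?_)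
  ring

/-- The BMO hypothesis concerns the metric and not its inverse. The expansion against kernels of
mean zero transfers the resulting bounds to the inverse, up to an error quadratic in `l`. -/
theorem IsSlowlyVarying.norm_iteratedFDeriv_mollify_inv_le {m : E d → Matrix (Fin d) (Fin d) ℝ}
    {c l : ℝ} (hm : IsSlowlyVarying m c l) {χ : E d → ℝ} (hk : IsKernel χ) {p : ℕ} (hp : 1 ≤ p)
    {x : E d} {B : ℝ} (hH : ∀ k n, ‖iteratedFDeriv ℝ p (mollify χ fun y => m y k n) x‖ ≤ B)
    (i j : Fin d) :
    ‖iteratedFDeriv ℝ p (mollify χ fun y => (m y)⁻¹ i j) x‖ ≤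
      8 * d ^ 4 * l ^ 2 * (∫ y, ‖iteratedFDeriv ℝ p χ y‖) + 4 * d ^ 2 * B := by
  have hmi := fun i j => (hm.continuous_apply i j).locallyIntegrable (μ := volume)
  have hni := fun i j => (hm.continuous_inv_apply i j).locallyIntegrable (μ := volume)
  have hA : ∀ i j, |(m x)⁻¹ i j| ≤ 2 := hm.abs_inv_le x
  have h1 := hm.norm_mollify_inv_add_le (hk.iteratedFDeriv p)
    (hk.integral_iteratedFDeriv hp) i j x
  simp only [← hk.iteratedFDeriv_mollify (hmi _ _), ← hk.iteratedFDeriv_mollify (hni _ _)] at h1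
  have h2 : ‖∑ k, ∑ n, ((m x)⁻¹ i k * (m x)⁻¹ n j) •
      iteratedFDeriv ℝ p (mollify χ fun y => m y k n) x‖ ≤ d * (d * (2 * 2 * B)) := by
    have a1 : ∀ k n, ‖((m x)⁻¹ i k * (m x)⁻¹ n j) •
        iteratedFDeriv ℝ p (mollify χ fun y => m y k n) x‖ ≤ 2 * 2 * B := fun k n => by
      rw [norm_smul, Real.norm_eq_abs, abs_mul]
      exact mul_le_mul (mul_le_mul (hA i k) (hA n j) (abs_nonneg _) zero_le_two) (hH k n)
        (norm_nonneg _) (by norm_num)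
    calc _ ≤ ∑ _k : Fin d, ∑ _n : Fin d, 2 * 2 * B :=
          (norm_sum_le _ _).trans (Finset.sum_le_sum fun k _ =>
            (norm_sum_le _ _).trans (Finset.sum_le_sum fun n _ => a1 k n))
      _ = _ := by simp
  have h3 := norm_le_add_norm_add (iteratedFDeriv ℝ p (mollify χ fun y => (m y)⁻¹ i j) x)
    (∑ k, ∑ n, ((m x)⁻¹ i k * (m x)⁻¹ n j) •
      iteratedFDeriv ℝ p (mollify χ fun y => m y k n) x)
  refine (h3.trans (add_le_add h1 h2)).trans (le_of_eq (by ring))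

/-- Coefficients which satisfy the bounds on the unit scale satisfy them after a dilation. -/
theorem RegularCoefficients.dilate {G H : Fin d → Fin d → E d → ℝ} {ε r : ℝ} {B : ℕ → ℝ}
    (hr : 0 < r) (smooth_inv : ∀ i j, ContDiff ℝ ∞ (G i j)) (smooth : ∀ i j, ContDiff ℝ ∞ (H i j))
    (symm : ∀ i j x, G i j x = G j i x)
    (inv_sub_le : ∀ i j x, |G i j x - (1 : Matrix (Fin d) (Fin d) ℝ) i j| ≤ ε)
    (fderiv_inv_le : ∀ i j x, ‖fderiv ℝ (G i j) x‖ ≤ ε * r)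
    (fderiv_le : ∀ i j x, ‖fderiv ℝ (H i j) x‖ ≤ ε * r)
    (second : ∀ i j x u v, |fderiv ℝ (fderiv ℝ (G i j)) x u v +
      ∑ k, ∑ n, G i k x * G n j x * fderiv ℝ (fderiv ℝ (H k n)) x u v| ≤
        ε * r ^ 2 * (‖u‖ * ‖v‖))
    (curvature : ∀ i j k l x,
      |fderiv ℝ (fderiv ℝ (H i k)) x (e j) (e l) + fderiv ℝ (fderiv ℝ (H j l)) x (e i) (e k)
        - fderiv ℝ (fderiv ℝ (H i l)) x (e j) (e k)
        - fderiv ℝ (fderiv ℝ (H j k)) x (e i) (e l)| ≤ ε * r ^ 2)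
    (scaled_le : ∀ n, 1 ≤ n → ∀ i j x, ‖iteratedFDeriv ℝ n (G i j) x‖ ≤ B n * r)
    (scaled_le_sq : ∀ n, 3 ≤ n → ∀ i j x, ‖iteratedFDeriv ℝ n (G i j) x‖ ≤ B n * r ^ 2) :
    RegularCoefficients (fun i j x => G i j (r⁻¹ • x)) (fun i j x => H i j (r⁻¹ • x)) ε r B := by
  have hi : 0 < r⁻¹ := inv_pos.2 hr
  have hri : (r⁻¹ : ℝ) ^ 2 * r ^ 2 = 1 := by rw [← mul_pow, inv_mul_cancel₀ hr.ne', one_pow]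
  have hdil : ContDiff ℝ ∞ fun x : E d => r⁻¹ • x := contDiff_const_smul r⁻¹
  have hres : ∀ f : E d → ℝ, (fun y => f (r⁻¹ • r • y)) = f := fun f => by
    ext1 y; rw [smul_smul, inv_mul_cancel₀ hr.ne', one_smul]
  have h1 : ∀ {f : E d → ℝ}, ContDiff ℝ ∞ f → (∀ x, ‖fderiv ℝ f x‖ ≤ ε * r) → ∀ x,
      ‖fderiv ℝ (fun x => f (r⁻¹ • x)) x‖ ≤ ε := fun hf hle x => by
    rw [fderiv_comp_dilation (hf.differentiable (by simp)), norm_smul, Real.norm_of_nonneg hi.le,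
      inv_mul_le_iff₀ hr, mul_comm]
    exact hle _
  exact
    { smooth_inv := fun i j => (smooth_inv i j).comp hdil
      smooth := fun i j => (smooth i j).comp hdil
      symm := fun i j x => symm i j _
      inv_sub_le := fun i j x => inv_sub_le i j _
      fderiv_inv_le := fun i j => h1 (smooth_inv i j) (fderiv_inv_le i j)
      fderiv_le := fun i j => h1 (smooth i j) (fderiv_le i j)
      second := fun i j x u v => by
        have h3 := second i j (r⁻¹ • x) u v
        simp only [fderiv_fderiv_comp_dilation (smooth_inv _ _),
          fderiv_fderiv_comp_dilation (smooth _ _), _root_.smul_apply, smul_eq_mul,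
          mul_left_comm _ (r⁻¹ ^ 2), ← Finset.mul_sum]
        rw [← mul_add, abs_mul, abs_of_nonneg (by positivity)]
        calc _ ≤ r⁻¹ ^ 2 * _ := mul_le_mul_of_nonneg_left h3 (by positivity)
          _ = (r⁻¹ ^ 2 * r ^ 2) * (ε * (‖u‖ * ‖v‖)) := by ring
          _ = _ := by rw [hri, one_mul]
      curvature := fun i j k l x => by
        have h3 := curvature i j k l (r⁻¹ • x)
        simp only [fderiv_fderiv_comp_dilation (smooth _ _), _root_.smul_apply, smul_eq_mul]
        rw [← mul_add, ← mul_sub, ← mul_sub, abs_mul, abs_of_nonneg (by positivity)]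
        calc _ ≤ r⁻¹ ^ 2 * _ := mul_le_mul_of_nonneg_left h3 (by positivity)
          _ = (r⁻¹ ^ 2 * r ^ 2) * ε := by ring
          _ = _ := by rw [hri, one_mul]
      scaled_le := fun n hn i j x => by rw [hres (G i j)]; exact scaled_le n hn i j x
      scaled_le_sq := fun n hn i j x => by rw [hres (G i j)]; exact scaled_le_sq n hn i j x }

/-- All estimates are made at unit scale for the metric dilated by `r`, whose entries have Lipschitz
constant `c * r`. The powers of `r` so obtained are removed by `RegularCoefficients.dilate`. The
curvature bound survives mollification because the combination of second derivatives is linear and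
bounded almost everywhere. -/
theorem exists_regularCoefficients {χ : E d → ℝ} (hχ : IsMollifier χ) :
    ∃ C : ℝ, 1 ≤ C ∧ ∃ B : ℕ → ℝ, ∀ c, 0 ≤ c → C * c ≤ 1 →
      ∀ g : E d → Matrix (Fin d) (Fin d) ℝ, IsSmallMetric c g → ∀ r, 0 < r → r ≤ 1 →
      RegularCoefficients (fun i j x => mollify χ (fun y => (g (r • y))⁻¹ i j) (r⁻¹ • x))
        (fun i j x => mollify χ (fun y => g (r • y) i j) (r⁻¹ • x)) (C * c) r B := by
  have hk : IsKernel χ := ⟨hχ.smooth, hχ.support.trans Metric.ball_subset_closedBall⟩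
  choose S hS using fun n => (hk.iteratedFDeriv n).hasCompactSupport.exists_bound_of_continuous
    (hk.iteratedFDeriv n).smooth.continuous
  set I₀ := ∫ y, ‖χ y‖ with hI₀
  set J₁ := ∫ y, ‖fderiv ℝ χ y‖ with hJ₁
  set J₂ := ∫ y, ‖fderiv ℝ (fderiv ℝ χ) y‖ with hJ₂
  set I : ℕ → ℝ := fun n => ∫ y, ‖iteratedFDeriv ℝ n χ y‖ with hI
  have hI₀0 : 0 ≤ I₀ := integral_nonneg fun _ => norm_nonneg _
  have hJ₁0 : 0 ≤ J₁ := integral_nonneg fun _ => norm_nonneg _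
  have hJ₂0 : 0 ≤ J₂ := integral_nonneg fun y => norm_nonneg (fderiv ℝ (fderiv ℝ χ) y)
  have hI0 : ∀ n, 0 ≤ I n := fun n => integral_nonneg fun _ => norm_nonneg _
  have hS0 : ∀ n, 0 ≤ S n := fun n => (norm_nonneg _).trans (hS n 0)
  set V := volume.real (Metric.ball (0 : E d) 2) with hV
  set T := ∑ l : Fin d, ∑ m : Fin d, ‖coordForm l m‖ with hT
  have hT0 : 0 ≤ T := Finset.sum_nonneg fun l _ => Finset.sum_nonneg fun m _ =>
    norm_nonneg (coordForm l m : E d →L[ℝ] E d →L[ℝ] ℝ)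
  set C₂ := J₂ * (8 * d ^ 4 + 8 * d ^ 4 * (I₀ * (I₀ + 1))) with hC₂
  have hC₂0 : 0 ≤ C₂ := by positivity
  set C := 1 + 2 * d + 2 * d * I₀ + 4 * d ^ 2 * J₁ + J₁ + C₂ + (2 + 72 * d ^ 4) * I₀ with hC
  have hC1 : 1 ≤ C := by
    have : 0 ≤ 2 * d + 2 * d * I₀ + 4 * d ^ 2 * J₁ + J₁ + C₂ + (2 + 72 * d ^ 4) * I₀ := by
      positivity
    linarith
  -- Of `n` derivatives two go to the metric, so the kernel bound needed is that of order `n - 2`.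
  -- For `n < 3` this entry only has to be nonnegative.
  refine ⟨C, hC1, fun n => 4 * d ^ 2 * I n + 4 * d ^ 2 * (T * (S (n - 2) * V)) + 8 * d ^ 4 * I n,
    ?_⟩
  intro c hc hCc g hg r hr hr1
  have hc1 : c ≤ 1 := (le_mul_of_one_le_left hc hC1).trans hCc
  have hmono : ∀ a, 0 ≤ a → a ≤ C → a * c ≤ C * c := fun a _ ha =>
    mul_le_mul_of_nonneg_right ha hc
  have hdc : d * c ≤ 1 / 2 := by
    have := hmono (2 * d) (by positivity) (by
      have : 0 ≤ 1 + 2 * d * I₀ + 4 * d ^ 2 * J₁ + J₁ + C₂ + (2 + 72 * d ^ 4) * I₀ := by positivity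
      linarith)
    linarith
  obtain ⟨hpd, hnear, hlip, dg, ddg, hdg, hddg, hlin, hbmo⟩ := hg.exists_bounds hc hc1 hdc
  let m : E d → Matrix (Fin d) (Fin d) ℝ := fun y => g (r • y)
  have hm : IsSlowlyVarying m c (c * r) :=
    { posDef := fun x => hpd _
      near := fun x => hnear _
      lipschitz := fun x y i j => (hlip (r • x) (r • y) i j).trans_eq (by
        rw [← smul_sub, norm_smul, Real.norm_of_nonneg hr.le]; ring)
      small := hdc
      nonneg := by positivity }
  have hgc : ∀ i j, LocallyIntegrable fun x => g x i j := fun i j => by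
    have : Continuous fun x => g x i j :=
      (LipschitzWith.of_dist_le_mul (K := ⟨c, hc⟩) fun x y => by
        rw [dist_comm, Real.dist_eq, dist_eq_norm]; exact hlip x y i j).continuous
    exact this.locallyIntegrable
  have hmi := fun i j => (hm.continuous_apply i j).locallyIntegrable (μ := volume)
  have hni := fun i j => (hm.continuous_inv_apply i j).locallyIntegrable (μ := volume)
  have hHs := fun i j => hk.contDiff_mollify (hmi i j)
  have hGs := fun i j => hk.contDiff_mollify (hni i j)
  have hdd : ∀ i j l n x, fderiv ℝ (fderiv ℝ (mollify χ fun y => m y i j)) x (e l) (e n) =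
      r ^ 2 * mollify χ (fun y => ddg l n i j (r • y)) x := fun i j l n x =>
    fderiv_fderiv_mollify_weak hk (hgc i j) (hdg n i j) (hddg l n i j) hr.ne' x
  have hDn : ∀ n, 1 ≤ n → ∀ i j x, ‖iteratedFDeriv ℝ n (mollify χ fun y => (m y)⁻¹ i j) x‖ ≤
      4 * d ^ 2 * (c * r) * I n := fun n hn i j x => by
    rw [hk.iteratedFDeriv_mollify (hni i j)]
    exact hm.norm_mollify_inv_le (hk.iteratedFDeriv n) (hk.integral_iteratedFDeriv hn) i j x
  refine RegularCoefficients.dilate (G := fun i j => mollify χ fun y => (m y)⁻¹ i j)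
    (H := fun i j => mollify χ fun y => m y i j) hr hGs hHs (fun i j x => ?_)
    (fun i j x => ?_) (fun i j x => ?_) (fun i j x => ?_) (fun i j x u v => ?_)
    (fun i j k l x => ?_) (fun n hn i j x => ?_) (fun n hn i j x => ?_)
  · congr 1
    ext1 y
    have := congrFun (congrFun (hpd (r • y)).isHermitian.inv i) j
    simpa using this.symm
  · refine (hm.abs_mollify_inv_sub_one_le hk hχ.integral_one i j _).trans ?_
    have := hmono (2 * d * I₀) (by positivity) (by
      have : 0 ≤ 1 + 2 * d + 4 * d ^ 2 * J₁ + J₁ + C₂ + (2 + 72 * d ^ 4) * I₀ := by positivity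
      linarith)
    linarith
  · rw [hk.fderiv_mollify (hni i j)]
    have h1 := hm.norm_mollify_inv_le hk.fderiv hk.integral_fderiv i j x
    have h2 := hmono (4 * d ^ 2 * J₁) (by positivity) (by
      have : 0 ≤ 1 + 2 * d + 2 * d * I₀ + J₁ + C₂ + (2 + 72 * d ^ 4) * I₀ := by positivity
      linarith)
    refine (h1.trans_eq ?_).trans (mul_le_mul_of_nonneg_right h2 hr.le)
    ring
  · rw [hk.fderiv_mollify (hmi i j)]
    have h1 := hm.norm_mollify_le hk.fderiv hk.integral_fderiv i j x
    have h2 := hmono J₁ (by positivity) (by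
      have : 0 ≤ 1 + 2 * d + 2 * d * I₀ + 4 * d ^ 2 * J₁ + C₂ + (2 + 72 * d ^ 4) * I₀ := by
        positivity
      linarith)
    refine (h1.trans_eq ?_).trans (mul_le_mul_of_nonneg_right h2 hr.le)
    ring
  · have h2 := hmono C₂ hC₂0 (by
      have : 0 ≤ 1 + 2 * d + 2 * d * I₀ + 4 * d ^ 2 * J₁ + J₁ + (2 + 72 * d ^ 4) * I₀ := by
        positivity
      linarith)
    refine (hm.abs_second_le hk hχ.integral_one i j x u v).trans
      (mul_le_mul_of_nonneg_right ?_ (by positivity))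
    -- The error is quadratic in `c`; one factor is given away through `c ≤ 1`.
    calc _ = C₂ * c * c * r ^ 2 := by rw [hC₂]; ring
      _ ≤ C₂ * c * 1 * r ^ 2 := by gcongr
      _ = C₂ * c * r ^ 2 := by rw [mul_one]
      _ ≤ _ := mul_le_mul_of_nonneg_right h2 (by positivity)
  · simp only [hdd]
    have hL := fun l n i j => locallyIntegrable_comp_smul (hddg l n i j).1 hr.ne'
    have h1 : mollify χ (fun y => ddg j l i k (r • y)) x +
        mollify χ (fun y => ddg i k j l (r • y)) x -
        mollify χ (fun y => ddg j k i l (r • y)) x -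
        mollify χ (fun y => ddg i l j k (r • y)) x =
        mollify χ (fun y => ddg j l i k (r • y) + ddg i k j l (r • y) - ddg j k i l (r • y)
          - ddg i l j k (r • y)) x := by
      have b := fun l n i j => hk.integrable_smul (hL l n i j) x
      simp only [mollify]
      have e1 := integral_add (b j l i k) (b i k j l)
      have e2 := integral_sub ((b j l i k).add (b i k j l)) (b j k i l)
      have e3 := integral_sub (((b j l i k).add (b i k j l)).sub (b j k i l)) (b i l j k)
      simp only [Pi.add_apply, Pi.sub_apply] at e1 e2 e3
      rw [← e1, ← e2, ← e3]
      refine integral_congr_ae (Eventually.of_forall fun y => ?_)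
      simp only [smul_eq_mul]
      ring
    rw [← mul_add, ← mul_sub, ← mul_sub, h1, abs_mul, abs_of_nonneg (by positivity), mul_comm]
    refine mul_le_mul_of_nonneg_right ?_ (by positivity)
    refine (hk.norm_mollify_le_of_ae (ae_comp_smul (hlin i j k l) hr.ne')).trans ?_
    have := hmono ((2 + 72 * d ^ 4) * I₀) (by positivity) (by
      have : 0 ≤ 1 + 2 * d + 2 * d * I₀ + 4 * d ^ 2 * J₁ + J₁ + C₂ := by positivity
      linarith)
    linarith
  · refine (hDn n hn i j x).trans ?_
    have h1 : 0 ≤ 4 * d ^ 2 * (T * (S (n - 2) * V)) + 8 * d ^ 4 * I n := by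
      have := hS0 (n - 2); have := hI0 n; positivity
    have h2 := hI0 n
    calc _ = 4 * d ^ 2 * I n * c * r := by ring
      _ ≤ 4 * d ^ 2 * I n * 1 * r := by gcongr
      _ ≤ _ := by
        gcongr
        linarith
  · obtain ⟨p, rfl⟩ : ∃ p, n = p + 2 := ⟨n - 2, by omega⟩
    have hp : 1 ≤ p := by omega
    have hSp := hS0 p
    have hIp := hI0 (p + 2)
    have h1 := hm.norm_iteratedFDeriv_mollify_inv_le hk (p := p + 2) (by omega) (x := x)
      (B := T * (S p * V) * c * r ^ 2) (fun k n =>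
      norm_iteratedFDeriv_mollify_weak_le hk (hgc k n) (h := fun l q => ddg l q k n)
        (fun l q => (hddg l q k n).1) hr (fun x l q => hdd k n l q x) hc
        (fun l q => hbmo l q k n) hp (hS p) x) i j
    refine h1.trans ?_
    rw [Nat.add_sub_cancel]
    change 8 * d ^ 4 * (c * r) ^ 2 * I (p + 2) + _ ≤ _
    have hcc : c ^ 2 ≤ 1 := pow_le_one₀ hc hc1
    calc _ = (8 * d ^ 4 * I (p + 2) * c ^ 2 + 4 * d ^ 2 * (T * (S p * V)) * c) * r ^ 2 := by ring
      _ ≤ (8 * d ^ 4 * I (p + 2) * 1 + 4 * d ^ 2 * (T * (S p * V)) * 1) * r ^ 2 := by gcongr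
      _ ≤ _ := by
        refine mul_le_mul_of_nonneg_right ?_ (by positivity)
        have h3 : 0 ≤ 4 * (d : ℝ) ^ 2 * I (p + 2) := by positivity
        rw [mul_one, mul_one]
        linarith

end Metric

end EikonalBounds

namespace EikonalBounds

/-! ### The square root of a quadratic form as a function of its coefficients -/

section Profile

open Set Filter Topology

variable {d : ℕ}

/-- The coefficients of the identity. -/
noncomputable def idCoeff (d : ℕ) : Fin d → Fin d → ℝ := fun i j =>
  (1 : Matrix (Fin d) (Fin d) ℝ) i j

/-- The bilinear form with coefficients `a`. -/
noncomputable def quad (a : Fin d → Fin d → ℝ) (ξ η : E d) : ℝ := ∑ i, ∑ j, a i j * ξ i * η j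

/-- Coefficients at this distance from the identity are positive definite. -/
noncomputable def coeffRadius (d : ℕ) : ℝ := 1 / (2 * (d ^ 2 + 1))

theorem coeffRadius_pos : 0 < coeffRadius d := by unfold coeffRadius; positivity

theorem abs_coord_le (ξ : E d) (i : Fin d) : |ξ i| ≤ ‖ξ‖ := PiLp.norm_apply_le ξ i

theorem abs_coeff_le (a : Fin d → Fin d → ℝ) (i j : Fin d) : |a i j| ≤ ‖a‖ :=
  (norm_le_pi_norm (a i) j).trans (norm_le_pi_norm a i)

theorem abs_quad_le (a : Fin d → Fin d → ℝ) (ξ η : E d) :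
    |quad a ξ η| ≤ d ^ 2 * ‖a‖ * (‖ξ‖ * ‖η‖) := by
  have h1 : ∀ i j, |a i j * ξ i * η j| ≤ ‖a‖ * ‖ξ‖ * ‖η‖ := fun i j => by
    rw [abs_mul, abs_mul]
    gcongr
    exacts [abs_coeff_le a i j, abs_coord_le ξ i, abs_coord_le η j]
  refine (Finset.abs_sum_le_sum_abs _ _).trans ?_
  calc _ ≤ ∑ _i : Fin d, ∑ _j : Fin d, ‖a‖ * ‖ξ‖ * ‖η‖ :=
        Finset.sum_le_sum fun i _ => (Finset.abs_sum_le_sum_abs _ _).trans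
          (Finset.sum_le_sum fun j _ => h1 i j)
    _ = _ := by simp; ring

theorem quad_idCoeff (ξ η : E d) : quad (idCoeff d) ξ η = inner ℝ ξ η := by
  simp [quad, idCoeff, Matrix.one_apply, PiLp.inner_apply, mul_comm]

theorem quad_sub_left (a b : Fin d → Fin d → ℝ) (ξ η : E d) :
    quad (a - b) ξ η = quad a ξ η - quad b ξ η := by
  simp [quad, sub_mul, Finset.sum_sub_distrib]

theorem abs_quad_sub_le {a : Fin d → Fin d → ℝ}
    (ha : a ∈ Metric.closedBall (idCoeff d) (coeffRadius d)) (ξ : E d) :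
    |quad a ξ ξ - ‖ξ‖ ^ 2| ≤ 1 / 2 * ‖ξ‖ ^ 2 := by
  rw [← real_inner_self_eq_norm_sq, ← quad_idCoeff, ← quad_sub_left, quad_idCoeff,
    real_inner_self_eq_norm_sq]
  rw [mem_closedBall_iff_norm] at ha
  refine (abs_quad_le _ _ _).trans ?_
  rw [← sq]
  refine mul_le_mul_of_nonneg_right ?_ (sq_nonneg _)
  calc (d : ℝ) ^ 2 * ‖a - idCoeff d‖ ≤ (d ^ 2 + 1) * coeffRadius d := by
        gcongr; linarith
    _ = 1 / 2 := by unfold coeffRadius; field_simp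

theorem contDiff_quad :
    ContDiff ℝ ∞ fun p : (Fin d → Fin d → ℝ) × E d => quad p.1 p.2 p.2 := by
  unfold quad
  fun_prop

theorem fderiv_quad (a b : Fin d → Fin d → ℝ) (ξ v : E d) :
    fderiv ℝ (fun p : (Fin d → Fin d → ℝ) × E d => quad p.1 p.2 p.2) (a, ξ) (b, v) =
      quad b ξ ξ + quad a v ξ + quad a ξ v := by
  rw [← (contDiff_quad.differentiable (by simp) _).lineDeriv_eq_fderiv]
  have h1 : ∀ i j, HasDerivAt (fun t : ℝ => (a i j + t * b i j) * (ξ i + t * v i) * (ξ j + t * v j))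
      (b i j * ξ i * ξ j + a i j * v i * ξ j + a i j * ξ i * v j) 0 := fun i j => by
    have l : ∀ x y : ℝ, HasDerivAt (fun t : ℝ => x + t * y) y 0 := fun x y => by
      simpa using ((hasDerivAt_id (0 : ℝ)).mul_const y).const_add x
    refine (((l _ _).fun_mul (l _ _)).fun_mul (l _ _)).congr_deriv ?_
    ring
  have h2 := HasDerivAt.fun_sum fun i (_ : i ∈ Finset.univ) =>
    HasDerivAt.fun_sum fun j (_ : j ∈ Finset.univ) => h1 i j
  have h3 : HasLineDerivAt ℝ (fun p : (Fin d → Fin d → ℝ) × E d => quad p.1 p.2 p.2)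
      (quad b ξ ξ + quad a v ξ + quad a ξ v) (a, ξ) (b, v) := by
    refine HasDerivAt.congr_deriv (f' := _) h2 ?_
    simp only [quad, Finset.sum_add_distrib]
  exact h3.lineDeriv

/-- A smooth function with compact support in `(0, ∞)` which is the square root on `[1/8, 7]`. -/
noncomputable def cutoffSqrt (s : ℝ) : ℝ :=
  -- The bump is one on [1/8, 63/8] and vanishes outside (1/16, 127/16).
  (⟨31 / 8, 63 / 16, by norm_num, by norm_num⟩ : ContDiffBump (4 : ℝ)) s * √s

theorem cutoffSqrt_of_mem {s : ℝ} (hs : s ∈ Icc (1 / 8 : ℝ) 7) : cutoffSqrt s = √s := by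
  rw [cutoffSqrt, ContDiffBump.one_of_mem_closedBall, one_mul]
  rw [Metric.mem_closedBall, Real.dist_eq, abs_le]
  simp only
  constructor <;> linarith [hs.1, hs.2]

theorem cutoffSqrt_of_le {s : ℝ} (hs : s ≤ 1 / 16) : cutoffSqrt s = 0 := by
  rw [cutoffSqrt, ContDiffBump.zero_of_le_dist, zero_mul]
  rw [Real.dist_eq, le_abs]
  simp only
  right; linarith

theorem cutoffSqrt_of_ge {s : ℝ} (hs : 127 / 16 ≤ s) : cutoffSqrt s = 0 := by
  rw [cutoffSqrt, ContDiffBump.zero_of_le_dist, zero_mul]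
  rw [Real.dist_eq, le_abs]
  simp only
  left; linarith

theorem contDiff_cutoffSqrt : ContDiff ℝ ∞ cutoffSqrt := by
  rw [contDiff_iff_contDiffAt]
  intro s
  rcases lt_or_ge s (1 / 16) with hs | hs
  · have : cutoffSqrt =ᶠ[𝓝 s] fun _ => 0 :=
      (eventually_lt_nhds hs).mono fun t ht => cutoffSqrt_of_le ht.le
    exact contDiffAt_const.congr_of_eventuallyEq this
  · exact (ContDiffBump.contDiffAt _).mul (Real.contDiffAt_sqrt (by linarith))

/-- The cut off square root of the quadratic form with coefficients `a`. -/
noncomputable def profile (p : (Fin d → Fin d → ℝ) × E d) : ℝ := cutoffSqrt (quad p.1 p.2 p.2)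

theorem contDiff_profile : ContDiff ℝ ∞ (profile (d := d)) := contDiff_cutoffSqrt.comp contDiff_quad

/-- For coefficients in the ball, the form exceeds `|ξ|² / 2 > 8 > 127/16` when `|ξ| > 4`, so the
profile vanishes near such points. What remains is a compact set of coefficients and covectors. -/
theorem exists_bound_profile (d : ℕ) : ∃ N : ℕ → ℝ, ∀ n, ∀ p : (Fin d → Fin d → ℝ) × E d,
    p.1 ∈ Metric.closedBall (idCoeff d) (coeffRadius d) → ‖iteratedFDeriv ℝ n profile p‖ ≤ N n := by
  have h : ∀ n, ∃ N : ℝ, ∀ p : (Fin d → Fin d → ℝ) × E d,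
      p.1 ∈ Metric.closedBall (idCoeff d) (coeffRadius d) →
      ‖iteratedFDeriv ℝ n profile p‖ ≤ N := fun n => by
    have hc : IsCompact (Metric.closedBall (idCoeff d) (coeffRadius d) ×ˢ
        Metric.closedBall (0 : E d) 4) := (isCompact_closedBall _ _).prod (isCompact_closedBall _ _)
    obtain ⟨N, hN⟩ := hc.exists_bound_of_continuousOn
      (contDiff_profile.continuous_iteratedFDeriv (m := n) (natCast_le_infty n)).continuousOn
    refine ⟨max N 0, fun p hp => ?_⟩
    rcases le_or_gt ‖p.2‖ 4 with h4 | h4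
    · exact (hN p ⟨hp, by simpa using h4⟩).trans (le_max_left _ _)
    · have h1 := abs_le.1 (abs_quad_sub_le hp p.2)
      have h2 : 127 / 16 < quad p.1 p.2 p.2 := by nlinarith
      have h3 : profile =ᶠ[𝓝 p] fun _ => (0 : ℝ) :=
        (contDiff_quad.continuous.continuousAt.eventually_const_lt h2).mono fun y hy =>
          cutoffSqrt_of_ge (le_of_lt hy)
      have h4 : iteratedFDeriv ℝ n profile p = 0 := by
        rw [(h3.iteratedFDeriv ℝ n).eq_of_nhds]
        simp
      rw [h4, norm_zero]
      exact le_max_right _ _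
  choose N hN using h
  exact ⟨N, hN⟩

theorem quad_mem_of_mem_shell {a : Fin d → Fin d → ℝ}
    (ha : a ∈ Metric.closedBall (idCoeff d) (coeffRadius d)) {z : E d × E d} (hz : z ∈ shell d) :
    quad a z.2 z.2 ∈ Ioo (1 / 8 : ℝ) 7 := by
  have h1 := abs_le.1 (abs_quad_sub_le ha z.2)
  have h2 := hz.1
  have h3 := hz.2
  constructor <;> nlinarith

theorem profile_of_mem_shell {a : Fin d → Fin d → ℝ}
    (ha : a ∈ Metric.closedBall (idCoeff d) (coeffRadius d)) {z : E d × E d} (hz : z ∈ shell d) :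
    profile (a, z.2) = √(quad a z.2 z.2) :=
  cutoffSqrt_of_mem (Ioo_subset_Icc_self (quad_mem_of_mem_shell ha hz))

theorem fderiv_profile_of_mem_shell {a : Fin d → Fin d → ℝ}
    (ha : a ∈ Metric.closedBall (idCoeff d) (coeffRadius d)) {z : E d × E d} (hz : z ∈ shell d)
    (b : Fin d → Fin d → ℝ) (v : E d) :
    fderiv ℝ profile (a, z.2) (b, v) =
      (quad b z.2 z.2 + quad a v z.2 + quad a z.2 v) / (2 * profile (a, z.2)) := by
  have hq := quad_mem_of_mem_shell ha hz
  have h1 : profile =ᶠ[𝓝 (a, z.2)] fun p => √(quad p.1 p.2 p.2) :=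
    (contDiff_quad.continuous.continuousAt.eventually
      (isOpen_Ioo.mem_nhds hq)).mono fun p hp => cutoffSqrt_of_mem (Ioo_subset_Icc_self hp)
  rw [h1.fderiv_eq, profile_of_mem_shell ha hz, ← fderiv_quad]
  have h2 := ((contDiff_quad.differentiable (by simp) (a, z.2)).hasFDerivAt).sqrt
    (by have := hq.1; simp only; linarith)
  rw [h2.fderiv]
  simp only [_root_.smul_apply, smul_eq_mul]
  ring

end Profile

end EikonalBounds

namespace EikonalBounds

/-! ### Hamiltonians with regular coefficients -/

section RegularHamiltonian

open Set Filter Topology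

section Lift

variable {X Y A G : Type} [NormedAddCommGroup X] [NormedSpace ℝ X] [NormedAddCommGroup Y]
  [NormedSpace ℝ Y] [NormedAddCommGroup A] [NormedSpace ℝ A] [NormedAddCommGroup G]
  [NormedSpace ℝ G]

theorem fderiv_fderiv_comp {g : Y → G} {f : X → Y} (hg : ContDiff ℝ ∞ g) (hf : ContDiff ℝ ∞ f)
    (x a b : X) : fderiv ℝ (fderiv ℝ (g ∘ f)) x a b =
      fderiv ℝ (fderiv ℝ g) (f x) (fderiv ℝ f x a) (fderiv ℝ f x b) +
        fderiv ℝ g (f x) (fderiv ℝ (fderiv ℝ f) x a b) := by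
  have hg1 : Differentiable ℝ (fderiv ℝ g) :=
    (hg.fderiv_right (m := ∞) (by simp)).differentiable (by simp)
  have hf1 : Differentiable ℝ (fderiv ℝ f) :=
    (hf.fderiv_right (m := ∞) (by simp)).differentiable (by simp)
  have hf0 : Differentiable ℝ f := hf.differentiable (by simp)
  have e1 : fderiv ℝ (g ∘ f) = fun x => (fderiv ℝ g (f x)).comp (fderiv ℝ f x) := by
    ext1 x
    exact fderiv_comp x (hg.differentiable (by simp) _) (hf0 x)
  have h1 : HasFDerivAt (fun x => fderiv ℝ g (f x)) _ x :=
    HasFDerivAt.comp x (hg1 (f x)).hasFDerivAt (hf0 x).hasFDerivAt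
  have h2 := h1.clm_comp (hf1 x).hasFDerivAt
  rw [e1, h2.fderiv]
  simp [add_comm]

theorem norm_fderiv_fderiv_le (f : X → G) (x a b : X) :
    ‖fderiv ℝ (fderiv ℝ f) x a b‖ ≤ ‖iteratedFDeriv ℝ 2 f x‖ * (‖a‖ * ‖b‖) := by
  have h := (iteratedFDeriv ℝ 2 f x).le_opNorm ![a, b]
  rw [iteratedFDeriv_two_apply, Fin.prod_univ_two] at h
  exact h

/-- The map `(x, ξ) ↦ (g x, δ ξ)`. -/
def liftMap (g : X → A) (δ : ℝ) (z : X × Y) : A × Y := (g z.1, δ • z.2)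

theorem contDiff_liftMap {g : X → A} (hg : ContDiff ℝ ∞ g) (δ : ℝ) :
    ContDiff ℝ ∞ (liftMap (Y := Y) g δ) :=
  (hg.comp contDiff_fst).prodMk (contDiff_snd.const_smul δ)

theorem fderiv_liftMap {g : X → A} (hg : Differentiable ℝ g) (δ : ℝ) (z w : X × Y) :
    fderiv ℝ (liftMap g δ) z w = (fderiv ℝ g z.1 w.1, δ • w.2) := by
  have h1 : HasFDerivAt (fun z : X × Y => g z.1) _ z :=
    HasFDerivAt.comp z (hg z.1).hasFDerivAt hasFDerivAt_fst
  have h2 : HasFDerivAt (fun z : X × Y => δ • z.2) _ z :=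
    (hasFDerivAt_snd (𝕜 := ℝ) (p := z)).const_smul δ
  have h3 : HasFDerivAt (liftMap g δ) _ z := h1.prodMk h2
  rw [h3.fderiv]
  rfl

theorem fderiv_fderiv_liftMap {g : X → A} (hg : ContDiff ℝ ∞ g) (δ : ℝ) (z a b : X × Y) :
    fderiv ℝ (fderiv ℝ (liftMap g δ)) z a b = (fderiv ℝ (fderiv ℝ g) z.1 a.1 b.1, 0) := by
  have hg1 : Differentiable ℝ (fderiv ℝ g) :=
    (hg.fderiv_right (m := ∞) (by simp)).differentiable (by simp)
  have h0 : DifferentiableAt ℝ (fderiv ℝ (liftMap (Y := Y) g δ)) z :=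
    (((contDiff_liftMap hg δ).fderiv_right (m := ∞) (by simp)).differentiable (by simp)) z
  have h1 : HasFDerivAt (fun z => fderiv ℝ (liftMap (Y := Y) g δ) z b) _ z :=
    h0.hasFDerivAt.clm_apply (hasFDerivAt_const b z)
  have e1 : (fun z => fderiv ℝ (liftMap (Y := Y) g δ) z b) =
      fun z => (fderiv ℝ g z.1 b.1, δ • b.2) := by
    ext1 z
    exact fderiv_liftMap (hg.differentiable (by simp)) δ z b
  have h2 : HasFDerivAt (fun z : X × Y => fderiv ℝ g z.1) _ z :=
    HasFDerivAt.comp z (hg1 z.1).hasFDerivAt hasFDerivAt_fst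
  have h3 := (h2.clm_apply (hasFDerivAt_const b.1 z)).prodMk (hasFDerivAt_const (δ • b.2) z)
  rw [e1] at h1
  have h4 := congrArg (fun T => T a) (h1.unique h3)
  simpa using h4

theorem norm_iteratedFDeriv_comp_fst_le {g : X → A} (hg : ContDiff ℝ ∞ g) (n : ℕ) (z : X × Y) :
    ‖iteratedFDeriv ℝ n (fun z : X × Y => g z.1) z‖ ≤ ‖iteratedFDeriv ℝ n g z.1‖ := by
  have h := (ContinuousLinearMap.fst ℝ X Y).iteratedFDeriv_comp_right hg z (natCast_le_infty n)
  change ‖iteratedFDeriv ℝ n (g ∘ ContinuousLinearMap.fst ℝ X Y) z‖ ≤ _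
  rw [h]
  refine (ContinuousMultilinearMap.norm_compContinuousLinearMap_le _ _).trans ?_
  refine mul_le_of_le_one_right (norm_nonneg _) ?_
  exact Finset.prod_le_one (fun _ _ => norm_nonneg _)
    fun _ _ => ContinuousLinearMap.norm_fst_le ℝ X Y

theorem norm_iteratedFDeriv_liftMap_le {g : X → A} (hg : ContDiff ℝ ∞ g) {δ : ℝ} {n : ℕ}
    (hn : 2 ≤ n) (z : X × Y) :
    ‖iteratedFDeriv ℝ n (liftMap g δ) z‖ ≤ ‖iteratedFDeriv ℝ n g z.1‖ := by
  have h := iteratedFDeriv_prodMk (𝕜 := ℝ) (f := fun z : X × Y => g z.1)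
    (g := fun z : X × Y => δ • z.2) (x := z) (n := ∞)
    (hg.comp contDiff_fst).contDiffAt (contDiff_snd.const_smul δ).contDiffAt (natCast_le_infty n)
  have e1 : iteratedFDeriv ℝ n (fun z : X × Y => δ • z.2) z = 0 :=
    iteratedFDeriv_clm (δ • ContinuousLinearMap.snd ℝ X Y) hn z
  change ‖iteratedFDeriv ℝ n (fun z : X × Y => (g z.1, δ • z.2)) z‖ ≤ _
  rw [h, ContinuousMultilinearMap.opNorm_prod, e1, norm_zero]
  exact max_le (norm_iteratedFDeriv_comp_fst_le hg n z) (norm_nonneg _)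

theorem norm_fderiv_liftMap_le {g : X → A} (hg : Differentiable ℝ g) {δ c : ℝ} (hδ : 0 ≤ δ)
    (hc : δ ≤ c) (z : X × Y) (h : ‖fderiv ℝ g z.1‖ ≤ c) : ‖fderiv ℝ (liftMap g δ) z‖ ≤ c :=
  ContinuousLinearMap.opNorm_le_bound _ (hδ.trans hc) fun w => by
    rw [fderiv_liftMap hg, Prod.norm_def, norm_smul, Real.norm_of_nonneg hδ]
    have h0 := hδ.trans hc
    refine max_le ?_ ?_
    · exact ((fderiv ℝ g z.1).le_opNorm _).trans
        (mul_le_mul h (norm_fst_le w) (norm_nonneg _) h0)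
    · exact mul_le_mul hc (norm_snd_le w) (norm_nonneg _) h0

end Lift

variable {d : ℕ}

/-- The coefficient functions as a function with values in the arrays. -/
def coeff (G : Fin d → Fin d → E d → ℝ) (x : E d) : Fin d → Fin d → ℝ := fun i j => G i j x

theorem contDiff_coeff {G : Fin d → Fin d → E d → ℝ} (hG : ∀ i j, ContDiff ℝ ∞ (G i j)) :
    ContDiff ℝ ∞ (coeff G) :=
  contDiff_pi.2 fun i => contDiff_pi.2 fun j => hG i j

theorem iteratedFDeriv_coeff {G : Fin d → Fin d → E d → ℝ} (hG : ∀ i j, ContDiff ℝ ∞ (G i j))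
    (n : ℕ) (x : E d) (v : Fin n → E d) (i j : Fin d) :
    iteratedFDeriv ℝ n (coeff G) x v i j = iteratedFDeriv ℝ n (G i j) x v := by
  let L : (Fin d → Fin d → ℝ) →L[ℝ] ℝ := (ContinuousLinearMap.proj j).comp
    (ContinuousLinearMap.proj (R := ℝ) (φ := fun _ : Fin d => Fin d → ℝ) i)
  have h := L.iteratedFDeriv_comp_left (contDiff_coeff hG).contDiffAt (x := x) (natCast_le_infty n)
  exact (congrArg (fun T => T v) h).symm

theorem norm_iteratedFDeriv_coeff_le {G : Fin d → Fin d → E d → ℝ}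
    (hG : ∀ i j, ContDiff ℝ ∞ (G i j)) {n : ℕ} {x : E d} {c : ℝ} (hc : 0 ≤ c)
    (h : ∀ i j, ‖iteratedFDeriv ℝ n (G i j) x‖ ≤ c) : ‖iteratedFDeriv ℝ n (coeff G) x‖ ≤ c := by
  refine ContinuousMultilinearMap.opNorm_le_bound hc fun v => ?_
  have h0 : 0 ≤ c * ∏ i, ‖v i‖ := by positivity
  refine (pi_norm_le_iff_of_nonneg h0).2 fun i => (pi_norm_le_iff_of_nonneg h0).2 fun j => ?_
  rw [iteratedFDeriv_coeff hG]
  exact ((iteratedFDeriv ℝ n (G i j) x).le_opNorm v).trans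
    (mul_le_mul_of_nonneg_right (h i j) (by positivity))

theorem fderiv_fderiv_coeff {G : Fin d → Fin d → E d → ℝ} (hG : ∀ i j, ContDiff ℝ ∞ (G i j))
    (x u v : E d) (i j : Fin d) :
    fderiv ℝ (fderiv ℝ (coeff G)) x u v i j = fderiv ℝ (fderiv ℝ (G i j)) x u v := by
  simpa [iteratedFDeriv_two_apply] using iteratedFDeriv_coeff hG 2 x ![u, v] i j

/-- The Hamiltonian with coefficients `G`. -/
noncomputable def hamiltonian (G : Fin d → Fin d → E d → ℝ) : E d × E d → ℝ :=
  profile ∘ liftMap (coeff G) 1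

theorem contDiff_hamiltonian {G : Fin d → Fin d → E d → ℝ} (hG : ∀ i j, ContDiff ℝ ∞ (G i j)) :
    ContDiff ℝ ∞ (hamiltonian G) := contDiff_profile.comp (contDiff_liftMap (contDiff_coeff hG) 1)

theorem hamiltonian_comp_scale (G : Fin d → Fin d → E d → ℝ) (r δ : ℝ) :
    hamiltonian G ∘ scale d r δ = profile ∘ liftMap (coeff fun i j y => G i j (r • y)) δ := by
  ext z
  simp only [hamiltonian, liftMap, Function.comp_apply, scale_apply, one_smul]
  rfl

theorem fderiv_hamiltonian {G : Fin d → Fin d → E d → ℝ} (hG : ∀ i j, ContDiff ℝ ∞ (G i j))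
    (z w : E d × E d) : fderiv ℝ (hamiltonian G) z w =
      fderiv ℝ profile (coeff G z.1, z.2) (fderiv ℝ (coeff G) z.1 w.1, w.2) := by
  have hl := contDiff_liftMap (Y := E d) (contDiff_coeff hG) 1
  rw [hamiltonian, fderiv_comp z (contDiff_profile.differentiable (by simp) _)
    (hl.differentiable (by simp) z)]
  have := fderiv_liftMap ((contDiff_coeff hG).differentiable (by simp)) 1 z w
  rw [ContinuousLinearMap.comp_apply, this, one_smul, liftMap, one_smul]

/-- Second derivatives of the coefficients enter through the last term only, and it is zero unless
both directions have a position component. -/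
theorem fderiv_fderiv_hamiltonian {G : Fin d → Fin d → E d → ℝ}
    (hG : ∀ i j, ContDiff ℝ ∞ (G i j)) (z a b : E d × E d) :
    fderiv ℝ (fderiv ℝ (hamiltonian G)) z a b =
      fderiv ℝ (fderiv ℝ profile) (coeff G z.1, z.2) (fderiv ℝ (coeff G) z.1 a.1, a.2)
        (fderiv ℝ (coeff G) z.1 b.1, b.2) +
      fderiv ℝ profile (coeff G z.1, z.2) (fderiv ℝ (fderiv ℝ (coeff G)) z.1 a.1 b.1, 0) := by
  rw [hamiltonian, fderiv_fderiv_comp contDiff_profile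
    (contDiff_liftMap (Y := E d) (contDiff_coeff hG) 1),
    fderiv_liftMap ((contDiff_coeff hG).differentiable (by simp)),
    fderiv_liftMap ((contDiff_coeff hG).differentiable (by simp)),
    fderiv_fderiv_liftMap (contDiff_coeff hG), liftMap]
  simp only [one_smul]

theorem inner_fderiv_hamField_fst {q : E d × E d → ℝ} (hq : ContDiff ℝ ∞ q) (z w : E d × E d)
    (v : E d) : inner ℝ (fderiv ℝ (hamField q) z w).1 v = fderiv ℝ (fderiv ℝ q) z w (0, v) := by
  have h1 := ((contDiff_hamField hq).differentiable (by simp) z).hasFDerivAt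
  have h2 : Differentiable ℝ (fderiv ℝ q) :=
    (hq.fderiv_right (m := ∞) (by simp)).differentiable (by simp)
  have h3 := (h1.fst).inner ℝ (hasFDerivAt_const v z)
  have h4 := (h2 z).hasFDerivAt.clm_apply (hasFDerivAt_const ((0, v) : E d × E d) z)
  have e1 : (fun z => inner ℝ (hamField q z).1 v) = fun z => fderiv ℝ q z (0, v) := by
    ext1 z; exact inner_gradXi q z v
  rw [e1] at h3
  simpa using congrArg (fun T => T w) (h3.unique h4)

theorem inner_fderiv_hamField_snd {q : E d × E d → ℝ} (hq : ContDiff ℝ ∞ q) (z w : E d × E d)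
    (u : E d) : inner ℝ (fderiv ℝ (hamField q) z w).2 u = -fderiv ℝ (fderiv ℝ q) z w (u, 0) := by
  have h1 := ((contDiff_hamField hq).differentiable (by simp) z).hasFDerivAt
  have h2 : Differentiable ℝ (fderiv ℝ q) :=
    (hq.fderiv_right (m := ∞) (by simp)).differentiable (by simp)
  have h3 := (h1.snd).inner ℝ (hasFDerivAt_const u z)
  have h4 := ((h2 z).hasFDerivAt.clm_apply (hasFDerivAt_const ((u, 0) : E d × E d) z)).neg
  have e1 : (fun z => inner ℝ (hamField q z).2 u) = -fun z => fderiv ℝ q z (u, 0) := by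
    ext1 z; simp [hamField, inner_gradX]
  rw [e1] at h3
  simpa using congrArg (fun T => T w) (h3.unique h4)

theorem norm_le_of_abs_inner_le {x : E d} {c : ℝ} (hc : 0 ≤ c)
    (h : ∀ v, |inner ℝ x v| ≤ c * ‖v‖) : ‖x‖ ≤ c := by
  rcases eq_or_ne x 0 with rfl | hx
  · rwa [norm_zero]
  · have h1 := h x
    rw [real_inner_self_eq_norm_sq, abs_of_nonneg (sq_nonneg _), sq] at h1
    exact le_of_mul_le_mul_right h1 (norm_pos_iff.2 hx)

end RegularHamiltonian

end EikonalBounds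

namespace EikonalBounds

/-! ### The correction of the Hessian of the Hamiltonian -/

section Correction

open Set Filter Topology

variable {d : ℕ}

/-- The covector `ξ` with its index raised. -/
noncomputable def raise (G : Fin d → Fin d → E d → ℝ) (n : Fin d) (z : E d × E d) : ℝ :=
  ∑ j, G n j z.1 * z.2 j

/-- The entries of the correction matrix. -/
noncomputable def correctionEntry (G H : Fin d → Fin d → E d → ℝ) (a b : Fin d)
    (z : E d × E d) : ℝ :=
  ∑ n, 1 / 2 * (fderiv ℝ (H a b) z.1 (e n) - fderiv ℝ (H n b) z.1 (e a)
    - fderiv ℝ (H a n) z.1 (e b)) * raise G n z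

/-- The linear map `u ↦ u_b e_a`. -/
noncomputable def unitMap (a b : Fin d) : E d →L[ℝ] E d :=
  (EuclideanSpace.proj b : E d →L[ℝ] ℝ).smulRight (e a)

theorem unitMap_apply (a b : Fin d) (u : E d) : unitMap a b u = u b • e a := rfl

theorem norm_unitMap_le (a b : Fin d) : ‖unitMap a b‖ ≤ 1 :=
  ContinuousLinearMap.opNorm_le_bound _ zero_le_one fun u => by
    rw [unitMap_apply, norm_smul, norm_e, mul_one, one_mul]
    exact abs_coord_le u b

/-- The matrix whose derivative along the flow cancels the Hessian of the Hamiltonian in `x` up to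
curvature terms. -/
noncomputable def correction (G H : Fin d → Fin d → E d → ℝ) (z : E d × E d) : E d →L[ℝ] E d :=
  ∑ a, ∑ b, correctionEntry G H a b z • unitMap a b

/-- The derivative of the entries of the correction matrix along a vector `V`. -/
theorem hasFDerivAt_correctionEntry {G H : Fin d → Fin d → E d → ℝ}
    (hG : ∀ i j, ContDiff ℝ ∞ (G i j)) (hH : ∀ i j, ContDiff ℝ ∞ (H i j)) (a b : Fin d)
    (z : E d × E d) : ∃ L : E d × E d →L[ℝ] ℝ, HasFDerivAt (correctionEntry G H a b) L z ∧
      ∀ V, L V = ∑ n, 1 / 2 * (fderiv ℝ (fderiv ℝ (H a b)) z.1 V.1 (e n)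
          - fderiv ℝ (fderiv ℝ (H n b)) z.1 V.1 (e a)
          - fderiv ℝ (fderiv ℝ (H a n)) z.1 V.1 (e b)) * raise G n z
        + ∑ n, 1 / 2 * (fderiv ℝ (H a b) z.1 (e n) - fderiv ℝ (H n b) z.1 (e a)
          - fderiv ℝ (H a n) z.1 (e b)) *
            ∑ j, (fderiv ℝ (G n j) z.1 V.1 * z.2 j + G n j z.1 * V.2 j) := by
  have hf : ∀ i j m, HasFDerivAt (fun z : E d × E d => fderiv ℝ (H i j) z.1 (e m))
      (((fderiv ℝ (fderiv ℝ (H i j)) z.1).comp (ContinuousLinearMap.fst ℝ (E d) (E d))).flip (e m))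
      z := fun i j m => by
    have h1 : DifferentiableAt ℝ (fderiv ℝ (H i j)) z.1 :=
      ((hH i j).fderiv_right (m := ∞) (by simp)).differentiable (by simp) _
    have h2 : HasFDerivAt (fun z : E d × E d => fderiv ℝ (H i j) z.1) _ z :=
      HasFDerivAt.comp z h1.hasFDerivAt hasFDerivAt_fst
    refine (h2.clm_apply (hasFDerivAt_const (e m) z)).congr_fderiv ?_
    ext w <;> simp
  have hg : ∀ n j, HasFDerivAt (fun z : E d × E d => G n j z.1 * z.2 j)
      (G n j z.1 • ((EuclideanSpace.proj j).comp (ContinuousLinearMap.snd ℝ (E d) (E d))) +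
        z.2 j • ((fderiv ℝ (G n j) z.1).comp (ContinuousLinearMap.fst ℝ (E d) (E d)))) z :=
    fun n j => by
    have h1 : HasFDerivAt (fun z : E d × E d => G n j z.1) _ z := HasFDerivAt.comp z
      ((hG n j).differentiable (by simp) z.1).hasFDerivAt hasFDerivAt_fst
    have h2 : HasFDerivAt (fun z : E d × E d => z.2 j) _ z :=
      ((EuclideanSpace.proj j).comp (ContinuousLinearMap.snd ℝ (E d) (E d))).hasFDerivAt
    exact h1.mul h2
  have hw : ∀ n, HasFDerivAt (raise G n) _ z := fun n =>
    HasFDerivAt.fun_sum fun j (_ : j ∈ Finset.univ) => hg n j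
  have h : HasFDerivAt (correctionEntry G H a b) _ z :=
    HasFDerivAt.fun_sum fun n (_ : n ∈ Finset.univ) =>
      ((((hf a b n).sub (hf n b a)).sub (hf a n b)).const_mul (1 / 2)).mul (hw n)
  refine ⟨_, h, fun V => ?_⟩
  rw [← Finset.sum_add_distrib]
  simp only [_root_.sum_apply, _root_.add_apply, _root_.smul_apply, _root_.sub_apply,
    smul_eq_mul, ContinuousLinearMap.flip_apply, ContinuousLinearMap.comp_apply,
    ContinuousLinearMap.coe_fst', ContinuousLinearMap.coe_snd', Pi.sub_apply]
  refine Finset.sum_congr rfl fun n _ => ?_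
  rw [add_comm]
  congr 1
  · ring
  · congr 1
    exact Finset.sum_congr rfl fun j _ => by rw [add_comm, mul_comm (z.2 j)]; rfl

theorem hasFDerivAt_correction {G H : Fin d → Fin d → E d → ℝ}
    (hG : ∀ i j, ContDiff ℝ ∞ (G i j)) (hH : ∀ i j, ContDiff ℝ ∞ (H i j)) (z : E d × E d) :
    HasFDerivAt (correction G H)
      (∑ a, ∑ b, (fderiv ℝ (correctionEntry G H a b) z).smulRight (unitMap a b)) z :=
  HasFDerivAt.fun_sum fun a (_ : a ∈ Finset.univ) =>
    HasFDerivAt.fun_sum fun b (_ : b ∈ Finset.univ) => by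
    obtain ⟨L, hL, -⟩ := hasFDerivAt_correctionEntry hG hH a b z
    exact hL.differentiableAt.hasFDerivAt.smul_const (unitMap a b)

theorem inner_fderiv_correction {G H : Fin d → Fin d → E d → ℝ}
    (hG : ∀ i j, ContDiff ℝ ∞ (G i j)) (hH : ∀ i j, ContDiff ℝ ∞ (H i j)) (z V : E d × E d)
    (u v : E d) : inner ℝ (fderiv ℝ (correction G H) z V u) v =
      ∑ a, ∑ b, fderiv ℝ (correctionEntry G H a b) z V * (u b * v a) := by
  rw [(hasFDerivAt_correction hG hH z).fderiv]
  simp only [_root_.sum_apply, ContinuousLinearMap.smulRight_apply, _root_.smul_apply, unitMap_apply,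
    sum_inner, real_inner_smul_left]
  refine Finset.sum_congr rfl fun a _ => Finset.sum_congr rfl fun b _ => ?_
  simp [e, EuclideanSpace.inner_single_left]

/-- The expansion of a bilinear form in coordinates. -/
theorem apply_eq_sum (T : E d →L[ℝ] E d →L[ℝ] ℝ) (u v : E d) :
    T u v = ∑ a, ∑ b, T (e b) (e a) * (u b * v a) := by
  have hv : ∀ v : E d, v = ∑ i, v i • e i := fun v => by
    have := (EuclideanSpace.basisFun (Fin d) ℝ).sum_repr v
    simpa [e] using this.symm
  conv_lhs => rw [hv u, hv v]
  simp only [map_sum, map_smul, _root_.sum_apply, _root_.smul_apply, smul_eq_mul, Finset.mul_sum]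
  refine Finset.sum_congr rfl fun l _ => Finset.sum_congr rfl fun m _ => ?_
  ring

theorem abs_sum_sum_mul_le {f : Fin d → Fin d → ℝ} {c : ℝ} (hf : ∀ a b, |f a b| ≤ c)
    (u v : E d) : |∑ a, ∑ b, f a b * (u b * v a)| ≤ d ^ 2 * c * (‖u‖ * ‖v‖) := by
  have h1 : ∀ a b, |f a b * (u b * v a)| ≤ c * (‖u‖ * ‖v‖) := fun a b => by
    have hc : 0 ≤ c := (abs_nonneg _).trans (hf a b)
    rw [abs_mul, abs_mul]
    gcongr
    exacts [hf a b, abs_coord_le u b, abs_coord_le v a]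
  refine (Finset.abs_sum_le_sum_abs _ _).trans ?_
  calc _ ≤ ∑ _i : Fin d, ∑ _j : Fin d, c * (‖u‖ * ‖v‖) :=
        Finset.sum_le_sum fun i _ => (Finset.abs_sum_le_sum_abs _ _).trans
          (Finset.sum_le_sum fun j _ => h1 i j)
    _ = _ := by simp; ring

/-- The principal part of the corrected Hessian is the curvature. -/
theorem abs_curvature_sum_le {h : Fin d → Fin d → Fin d → Fin d → ℝ} {ε : ℝ}
    (hsymm : ∀ i j k l, h i j k l = h i j l k)
    (hcurv : ∀ i j k l, |h i k j l + h j l i k - h i l j k - h j k i l| ≤ ε)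
    {w : Fin d → ℝ} {W : ℝ} (hw : ∀ n, |w n| ≤ W) (a b : Fin d) :
    |∑ k, ∑ n, w k * w n * h k n b a +
      ∑ n, ∑ m, (h a b m n - h n b m a - h a n m b) * w m * w n| ≤ d ^ 2 * (ε * W ^ 2) := by
  have e1 : ∑ k, ∑ n, w k * w n * h k n b a +
      ∑ n, ∑ m, (h a b m n - h n b m a - h a n m b) * w m * w n =
      ∑ m, ∑ n, w m * w n * (h m n a b + h a b m n - h m b a n - h a n m b) := by
    -- Renaming the summation indices and using the symmetry in the last two slots brings the four
    -- sums to one contraction of the curvature combination with `w` twice.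
    have e2 : ∑ n, ∑ m, h n b m a * w m * w n = ∑ m, ∑ n, h m b a n * w m * w n := by
      refine Finset.sum_congr rfl fun n _ => Finset.sum_congr rfl fun m _ => ?_
      rw [hsymm n b m a]; ring
    have e3 : ∀ f : Fin d → Fin d → ℝ, ∑ n, ∑ m, f n m = ∑ m, ∑ n, f n m := fun f =>
      Finset.sum_comm
    simp only [sub_mul, Finset.sum_sub_distrib, e2]
    rw [e3 fun n m => h a b m n * w m * w n, e3 fun n m => h a n m b * w m * w n]
    simp only [← Finset.sum_sub_distrib, ← Finset.sum_add_distrib]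
    refine Finset.sum_congr rfl fun m _ => Finset.sum_congr rfl fun n _ => ?_
    rw [hsymm m n b a]; ring
  rw [e1]
  refine (Finset.abs_sum_le_sum_abs _ _).trans ?_
  have h1 : ∀ m n, |w m * w n * (h m n a b + h a b m n - h m b a n - h a n m b)| ≤
      ε * W ^ 2 := fun m n => by
    have hW := (abs_nonneg _).trans (hw m)
    rw [abs_mul, abs_mul, sq, mul_comm ε]
    gcongr
    exacts [hw m, hw n, hcurv m a n b]
  calc _ ≤ ∑ _i : Fin d, ∑ _j : Fin d, ε * W ^ 2 :=
        Finset.sum_le_sum fun i _ => (Finset.abs_sum_le_sum_abs _ _).trans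
          (Finset.sum_le_sum fun j _ => h1 i j)
    _ = _ := by simp; ring

end Correction

end EikonalBounds

namespace EikonalBounds

/-! ### Regular coefficients give regularized Hamiltonians -/

section Verification

open Set Filter Topology

variable {d : ℕ}

theorem sum_comm_pairs {ι R : Type*} [Fintype ι] [AddCommMonoid R] (f : ι → ι → ι → ι → R) :
    ∑ i, ∑ j, ∑ k, ∑ n, f i j k n = ∑ k, ∑ n, ∑ i, ∑ j, f i j k n := by
  calc _ = ∑ i, ∑ k, ∑ j, ∑ n, f i j k n := Finset.sum_congr rfl fun i _ => Finset.sum_comm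
    _ = ∑ k, ∑ i, ∑ n, ∑ j, f i j k n := by
      rw [Finset.sum_comm]
      exact Finset.sum_congr rfl fun k _ => Finset.sum_congr rfl fun i _ => Finset.sum_comm
    _ = _ := Finset.sum_congr rfl fun k _ => Finset.sum_comm

theorem sum_raise_mul_raise {G : Fin d → Fin d → E d → ℝ} (hG : ∀ i j x, G i j x = G j i x)
    (T : Fin d → Fin d → ℝ) (z : E d × E d) :
    ∑ i, ∑ j, (∑ k, ∑ n, G i k z.1 * G n j z.1 * T k n) * z.2 i * z.2 j =
      ∑ k, ∑ n, raise G k z * raise G n z * T k n := by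
  simp only [raise, Finset.mul_sum, Finset.sum_mul]
  rw [sum_comm_pairs]
  refine Finset.sum_congr rfl fun k _ => Finset.sum_congr rfl fun n _ => Finset.sum_comm.trans
    (Finset.sum_congr rfl fun j _ => Finset.sum_congr rfl fun i _ => ?_)
  rw [hG i k]; ring

namespace RegularCoefficients

variable {G H : Fin d → Fin d → E d → ℝ} {ε r : ℝ} {B : ℕ → ℝ} {N : ℕ → ℝ}

theorem coeff_mem (h : RegularCoefficients G H ε r B) (hε : ε ≤ coeffRadius d) (x : E d) :
    coeff G x ∈ Metric.closedBall (idCoeff d) (coeffRadius d) := by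
  have h0 := (coeffRadius_pos (d := d)).le
  rw [mem_closedBall_iff_norm]
  refine (pi_norm_le_iff_of_nonneg h0).2 fun i => (pi_norm_le_iff_of_nonneg h0).2 fun j => ?_
  exact (h.inv_sub_le i j x).trans hε

theorem norm_fderiv_coeff_le (h : RegularCoefficients G H ε r B) (hε : 0 ≤ ε) (x : E d) :
    ‖fderiv ℝ (coeff G) x‖ ≤ ε := by
  rw [← norm_iteratedFDeriv_one]
  refine norm_iteratedFDeriv_coeff_le h.smooth_inv hε fun i j => ?_
  rw [norm_iteratedFDeriv_one]
  exact h.fderiv_inv_le i j x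

theorem abs_apply_le (h : RegularCoefficients G H ε r B) (hε : ε ≤ 1) (i j : Fin d) (x : E d) :
    |G i j x| ≤ 2 := by
  have h4 := abs_sub_abs_le_abs_sub (G i j x) ((1 : Matrix (Fin d) (Fin d) ℝ) i j)
  have h5 := h.inv_sub_le i j x
  have h6 : |(1 : Matrix (Fin d) (Fin d) ℝ) i j| ≤ 1 := by
    rw [Matrix.one_apply]; split_ifs <;> simp
  linarith

theorem abs_raise_le (h : RegularCoefficients G H ε r B) (hε : ε ≤ 1) (n : Fin d)
    {z : E d × E d} (hz : z ∈ shell d) : |raise G n z| ≤ 4 * d := by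
  have h1 : ∀ j, |G n j z.1 * z.2 j| ≤ 2 * 2 := fun j => by
    rw [abs_mul]
    exact mul_le_mul (h.abs_apply_le hε n j _) ((abs_coord_le _ _).trans hz.2.le) (abs_nonneg _)
      zero_le_two
  refine (Finset.abs_sum_le_sum_abs _ _).trans ((Finset.sum_le_sum fun j _ => h1 j).trans_eq ?_)
  simp; ring

theorem abs_christoffel_le (h : RegularCoefficients G H ε r B) (a b n : Fin d) (x : E d) :
    |1 / 2 * (fderiv ℝ (H a b) x (e n) - fderiv ℝ (H n b) x (e a) - fderiv ℝ (H a n) x (e b))| ≤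
      3 / 2 * ε := by
  have h1 : ∀ i j m, |fderiv ℝ (H i j) x (e m)| ≤ ε := fun i j m => by
    have := (fderiv ℝ (H i j) x).le_opNorm (e m)
    rw [norm_e, mul_one] at this
    exact this.trans (h.fderiv_le i j x)
  have a1 := abs_le.1 (h1 a b n)
  have a2 := abs_le.1 (h1 n b a)
  have a3 := abs_le.1 (h1 a n b)
  rw [abs_le]; constructor <;> linarith

theorem norm_correction_le (h : RegularCoefficients G H ε r B) (hε : 0 ≤ ε) (hε1 : ε ≤ 1)
    {z : E d × E d} (hz : z ∈ shell d) : ‖correction G H z‖ ≤ 6 * d ^ 4 * ε := by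
  have h1 : ∀ a b, |correctionEntry G H a b z| ≤ 6 * d ^ 2 * ε := fun a b => by
    have h2 : ∀ n, |1 / 2 * (fderiv ℝ (H a b) z.1 (e n) - fderiv ℝ (H n b) z.1 (e a)
        - fderiv ℝ (H a n) z.1 (e b)) * raise G n z| ≤ 3 / 2 * ε * (4 * d) := fun n => by
      rw [abs_mul]
      exact mul_le_mul (h.abs_christoffel_le a b n _) (h.abs_raise_le hε1 n hz) (abs_nonneg _)
        (by positivity)
    refine (Finset.abs_sum_le_sum_abs _ _).trans ((Finset.sum_le_sum fun n _ => h2 n).trans_eq ?_)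
    simp; ring
  have h3 : ∀ a b, ‖correctionEntry G H a b z • unitMap a b‖ ≤ 6 * d ^ 2 * ε := fun a b => by
    rw [norm_smul]
    exact (mul_le_of_le_one_right (norm_nonneg _) (norm_unitMap_le a b)).trans (h1 a b)
  refine (norm_sum_le _ _).trans ?_
  calc _ ≤ ∑ _a : Fin d, ∑ _b : Fin d, 6 * d ^ 2 * ε :=
        Finset.sum_le_sum fun a _ => (norm_sum_le _ _).trans (Finset.sum_le_sum fun b _ => h3 a b)
    _ = _ := by simp; ring

theorem norm_fderiv_profile_le (hN : ∀ n, ∀ p : (Fin d → Fin d → ℝ) × E d,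
    p.1 ∈ Metric.closedBall (idCoeff d) (coeffRadius d) → ‖iteratedFDeriv ℝ n profile p‖ ≤ N n)
    (h : RegularCoefficients G H ε r B) (hε : ε ≤ coeffRadius d) (x ξ : E d)
    (w : (Fin d → Fin d → ℝ) × E d) : |fderiv ℝ profile (coeff G x, ξ) w| ≤ N 1 * ‖w‖ := by
  have h1 := hN 1 (coeff G x, ξ) (h.coeff_mem hε x)
  rw [norm_iteratedFDeriv_one] at h1
  exact ((fderiv ℝ profile (coeff G x, ξ)).le_opNorm w).trans
    (mul_le_mul_of_nonneg_right h1 (norm_nonneg _))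

theorem norm_fderiv_fderiv_profile_le (hN : ∀ n, ∀ p : (Fin d → Fin d → ℝ) × E d,
    p.1 ∈ Metric.closedBall (idCoeff d) (coeffRadius d) → ‖iteratedFDeriv ℝ n profile p‖ ≤ N n)
    (h : RegularCoefficients G H ε r B) (hε : ε ≤ coeffRadius d) (x ξ : E d)
    (w w' : (Fin d → Fin d → ℝ) × E d) :
    |fderiv ℝ (fderiv ℝ profile) (coeff G x, ξ) w w'| ≤ N 2 * (‖w‖ * ‖w'‖) :=
  (norm_fderiv_fderiv_le profile (coeff G x, ξ) w w').trans
    (mul_le_mul_of_nonneg_right (hN 2 (coeff G x, ξ) (h.coeff_mem hε x)) (by positivity))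

theorem gradXi_hamiltonian_apply (h : RegularCoefficients G H ε r B) (hε : ε ≤ coeffRadius d)
    {z : E d × E d} (hz : z ∈ shell d) (n : Fin d) :
    gradXi (hamiltonian G) z n = raise G n z / hamiltonian G z := by
  have h1 := inner_gradXi (hamiltonian G) z (e n)
  rw [fderiv_hamiltonian h.smooth_inv, map_zero,
    fderiv_profile_of_mem_shell (h.coeff_mem hε z.1) hz] at h1
  have e1 : inner ℝ (gradXi (hamiltonian G) z) (e n) = gradXi (hamiltonian G) z n := by
    simp [e, EuclideanSpace.inner_single_right]
  have e2 : profile (coeff G z.1, z.2) = hamiltonian G z := by simp [hamiltonian, liftMap]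
  have e3 : quad (coeff G z.1) (e n) z.2 = raise G n z := by
    simp [quad, raise, coeff, e, PiLp.single_apply]
  have e4 : quad (coeff G z.1) z.2 (e n) = raise G n z := by
    simp [quad, raise, coeff, e, PiLp.single_apply, h.symm _ n]
  have e5 : quad (0 : Fin d → Fin d → ℝ) z.2 z.2 = 0 := by simp [quad]
  rw [← e1, h1, e2, e3, e4, e5, zero_add, ← two_mul, mul_div_mul_left _ _ two_ne_zero]

theorem hamiltonian_ge (h : RegularCoefficients G H ε r B) (hε : ε ≤ coeffRadius d)
    {z : E d × E d} (hz : z ∈ shell d) : 1 / 3 ≤ hamiltonian G z := by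
  have e2 : profile (coeff G z.1, z.2) = hamiltonian G z := by simp [hamiltonian, liftMap]
  rw [← e2, profile_of_mem_shell (h.coeff_mem hε z.1) hz]
  refine Real.le_sqrt_of_sq_le ?_
  linarith [(quad_mem_of_mem_shell (h.coeff_mem hε z.1) hz).1]

theorem inner_gradXi_hamiltonian (h : RegularCoefficients G H ε r B) (hε : ε ≤ coeffRadius d)
    {z : E d × E d} (hz : z ∈ shell d) :
    inner ℝ z.2 (gradXi (hamiltonian G) z) = hamiltonian G z := by
  rw [real_inner_comm, inner_gradXi, fderiv_hamiltonian h.smooth_inv, map_zero,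
    fderiv_profile_of_mem_shell (h.coeff_mem hε z.1) hz]
  have e5 : quad (0 : Fin d → Fin d → ℝ) z.2 z.2 = 0 := by simp [quad]
  have e2 : profile (coeff G z.1, z.2) = hamiltonian G z := by simp [hamiltonian, liftMap]
  have hq := h.hamiltonian_ge hε hz
  have h1 := profile_of_mem_shell (h.coeff_mem hε z.1) hz
  have h2 := (quad_mem_of_mem_shell (h.coeff_mem hε z.1) hz).1
  have h3 : quad (coeff G z.1) z.2 z.2 = hamiltonian G z ^ 2 := by
    rw [← e2, h1, Real.sq_sqrt (by linarith)]
  rw [e5, h3, e2]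
  have : hamiltonian G z ≠ 0 := by linarith
  field_simp
  ring

theorem abs_fderiv_hamiltonian_fst_le (hN : ∀ n, ∀ p : (Fin d → Fin d → ℝ) × E d,
    p.1 ∈ Metric.closedBall (idCoeff d) (coeffRadius d) → ‖iteratedFDeriv ℝ n profile p‖ ≤ N n)
    (h : RegularCoefficients G H ε r B) (hε0 : 0 ≤ ε) (hε : ε ≤ coeffRadius d) (z : E d × E d)
    (u : E d) : |fderiv ℝ (hamiltonian G) z (u, 0)| ≤ N 1 * ε * ‖u‖ := by
  have hN1 : 0 ≤ N 1 := (norm_nonneg _).trans (hN 1 (idCoeff d, 0)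
    (Metric.mem_closedBall_self coeffRadius_pos.le))
  rw [fderiv_hamiltonian h.smooth_inv, mul_assoc]
  refine (norm_fderiv_profile_le hN h hε _ _ _).trans (mul_le_mul_of_nonneg_left ?_ hN1)
  rw [Prod.norm_def, norm_zero]
  exact max_le ((fderiv ℝ (coeff G) z.1).le_of_opNorm_le (h.norm_fderiv_coeff_le hε0 _) u)
    (by positivity)

theorem abs_fderiv_hamiltonian_snd_le (hN : ∀ n, ∀ p : (Fin d → Fin d → ℝ) × E d,
    p.1 ∈ Metric.closedBall (idCoeff d) (coeffRadius d) → ‖iteratedFDeriv ℝ n profile p‖ ≤ N n)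
    (h : RegularCoefficients G H ε r B) (hε : ε ≤ coeffRadius d) (z : E d × E d)
    (v : E d) : |fderiv ℝ (hamiltonian G) z (0, v)| ≤ N 1 * ‖v‖ := by
  rw [fderiv_hamiltonian h.smooth_inv, map_zero]
  refine (norm_fderiv_profile_le hN h hε _ _ _).trans_eq ?_
  rw [Prod.norm_def, norm_zero, max_eq_right (norm_nonneg _)]

theorem norm_gradX_hamiltonian_le (hN : ∀ n, ∀ p : (Fin d → Fin d → ℝ) × E d,
    p.1 ∈ Metric.closedBall (idCoeff d) (coeffRadius d) → ‖iteratedFDeriv ℝ n profile p‖ ≤ N n)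
    (h : RegularCoefficients G H ε r B) (hε0 : 0 ≤ ε) (hε : ε ≤ coeffRadius d) (z : E d × E d) :
    ‖gradX (hamiltonian G) z‖ ≤ N 1 * ε := by
  have hN1 : 0 ≤ N 1 := (norm_nonneg _).trans (hN 1 (idCoeff d, 0)
    (Metric.mem_closedBall_self coeffRadius_pos.le))
  refine norm_le_of_abs_inner_le (by positivity) fun u => ?_
  rw [inner_gradX]
  exact abs_fderiv_hamiltonian_fst_le hN h hε0 hε z u

theorem norm_gradXi_hamiltonian_le (hN : ∀ n, ∀ p : (Fin d → Fin d → ℝ) × E d,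
    p.1 ∈ Metric.closedBall (idCoeff d) (coeffRadius d) → ‖iteratedFDeriv ℝ n profile p‖ ≤ N n)
    (h : RegularCoefficients G H ε r B) (hε : ε ≤ coeffRadius d) (z : E d × E d) :
    ‖gradXi (hamiltonian G) z‖ ≤ N 1 := by
  have hN1 : 0 ≤ N 1 := (norm_nonneg _).trans (hN 1 (idCoeff d, 0)
    (Metric.mem_closedBall_self coeffRadius_pos.le))
  refine norm_le_of_abs_inner_le hN1 fun u => ?_
  rw [inner_gradXi]
  exact abs_fderiv_hamiltonian_snd_le hN h hε z u

/-- With `w = G ξ`, the form `∂²G ξ ξ` equals `-∂²H w w` up to a small error, by `second`. The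
velocity is `w / q`, so differentiating the first derivatives of `H` inside the correction along the
flow yields further terms `∂²H w w` with the same factor `1 / (2q)`. Together they form a
contraction of the linear part of the curvature. All other terms contain a small first derivative of
the coefficients or of `H`. -/
theorem curvature_hamiltonian_le (hN : ∀ n, ∀ p : (Fin d → Fin d → ℝ) × E d,
    p.1 ∈ Metric.closedBall (idCoeff d) (coeffRadius d) → ‖iteratedFDeriv ℝ n profile p‖ ≤ N n)
    (h : RegularCoefficients G H ε r B) (hε0 : 0 ≤ ε) (hε : ε ≤ coeffRadius d) (hε1 : ε ≤ 1)
    {z : E d × E d} (hz : z ∈ shell d) (u : E d) :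
    ‖(fderiv ℝ (hamField (hamiltonian G)) z (u, 0)).2 +
      fderiv ℝ (correction G H) z (hamField (hamiltonian G) z) u‖ ≤
      (N 2 + 6 * d ^ 2 + 24 * d ^ 6 + 6 * N 1 * d ^ 4) * ε * ‖u‖ := by
  have hN1 : 0 ≤ N 1 := (norm_nonneg _).trans (hN 1 (idCoeff d, 0)
    (Metric.mem_closedBall_self coeffRadius_pos.le))
  have hN2 : 0 ≤ N 2 := (norm_nonneg _).trans (hN 2 (idCoeff d, 0)
    (Metric.mem_closedBall_self coeffRadius_pos.le))
  refine norm_le_of_abs_inner_le (by positivity) fun v => ?_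
  have hq := h.hamiltonian_ge hε hz
  have e2 : profile (coeff G z.1, z.2) = hamiltonian G z := by simp [hamiltonian, liftMap]
  set q := hamiltonian G z with hqdef
  have hq0 : 0 < q := by linarith
  have hqi : 1 / (2 * q) ≤ 3 / 2 := by
    rw [div_le_iff₀ (by positivity)]; linarith
  set V := hamField (hamiltonian G) z with hV
  let hh : Fin d → Fin d → Fin d → Fin d → ℝ := fun i j k l =>
    fderiv ℝ (fderiv ℝ (H i j)) z.1 (e k) (e l)
  have hsymm : ∀ i j k l, hh i j k l = hh i j l k := fun i j k l =>
    ((h.smooth i j).contDiffAt.isSymmSndFDerivAt (by simp [two_le_infty])).eq (e k) (e l)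
  let w : Fin d → ℝ := fun n => raise G n z
  have hw : ∀ n, |w n| ≤ 4 * d := fun n => h.abs_raise_le hε1 n hz
  -- The form with raised indices is added and subtracted: the bracket is the quantity bounded by
  -- `second`, and the last sum is kept to be combined with the correction.
  have hA : inner ℝ (fderiv ℝ (hamField (hamiltonian G)) z (u, 0)).2 v =
      -fderiv ℝ (fderiv ℝ profile) (coeff G z.1, z.2) (fderiv ℝ (coeff G) z.1 u, 0)
        (fderiv ℝ (coeff G) z.1 v, 0)
      - 1 / (2 * q) * ∑ i, ∑ j, (fderiv ℝ (fderiv ℝ (G i j)) z.1 u v + ∑ k, ∑ n,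
          G i k z.1 * G n j z.1 * fderiv ℝ (fderiv ℝ (H k n)) z.1 u v) * z.2 i * z.2 j
      + ∑ a, ∑ b, 1 / (2 * q) * (∑ k, ∑ n, w k * w n * hh k n b a) * (u b * v a) := by
    rw [inner_fderiv_hamField_snd (contDiff_hamiltonian h.smooth_inv),
      fderiv_fderiv_hamiltonian h.smooth_inv]
    simp only
    rw [fderiv_profile_of_mem_shell (h.coeff_mem hε z.1) hz, e2]
    have e6 : quad (coeff G z.1) 0 z.2 = 0 := by simp [quad]
    have e7 : quad (coeff G z.1) z.2 0 = 0 := by simp [quad]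
    have e8 : ∑ a, ∑ b, 1 / (2 * q) * (∑ k, ∑ n, w k * w n * hh k n b a) * (u b * v a) =
        1 / (2 * q) * ∑ k, ∑ n, w k * w n * fderiv ℝ (fderiv ℝ (H k n)) z.1 u v := by
      simp only [fun k n => apply_eq_sum (fderiv ℝ (fderiv ℝ (H k n)) z.1) u v, Finset.mul_sum,
        Finset.sum_mul]
      rw [sum_comm_pairs]
      refine Finset.sum_congr rfl fun k _ => Finset.sum_congr rfl fun n _ =>
        Finset.sum_congr rfl fun a _ => Finset.sum_congr rfl fun b _ => ?_
      simp only [hh]; ring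
    rw [e6, e7, e8, ← sum_raise_mul_raise h.symm]
    simp only [quad, fderiv_fderiv_coeff h.smooth_inv, add_mul, Finset.sum_add_distrib]
    ring
  have hB : ∀ a b, fderiv ℝ (correctionEntry G H a b) z V =
      1 / (2 * q) * (∑ n, ∑ m, (hh a b m n - hh n b m a - hh a n m b) * w m * w n)
      + ∑ n, 1 / 2 * (fderiv ℝ (H a b) z.1 (e n) - fderiv ℝ (H n b) z.1 (e a)
          - fderiv ℝ (H a n) z.1 (e b)) *
            ∑ j, (fderiv ℝ (G n j) z.1 V.1 * z.2 j + G n j z.1 * V.2 j) := by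
    intro a b
    obtain ⟨L, hL, hLV⟩ := hasFDerivAt_correctionEntry h.smooth_inv h.smooth a b z
    rw [hL.fderiv, hLV, add_left_inj]
    -- The velocity is the raised covector divided by `q`; this supplies the second factor `w` of
    -- the curvature contraction.
    have hV1 : V.1 = ∑ m, (w m / q) • e m := by
      have h1 := (EuclideanSpace.basisFun (Fin d) ℝ).sum_repr V.1
      rw [← h1]
      refine Finset.sum_congr rfl fun m _ => ?_
      rw [EuclideanSpace.basisFun_apply, EuclideanSpace.basisFun_repr]
      change gradXi (hamiltonian G) z m • _ = _
      rw [h.gradXi_hamiltonian_apply hε hz]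
      rfl
    rw [Finset.mul_sum]
    refine Finset.sum_congr rfl fun n _ => ?_
    have hT : ∀ i j k, fderiv ℝ (fderiv ℝ (H i j)) z.1 V.1 (e k) = ∑ m, w m / q * hh i j m k :=
      fun i j k => by
      rw [hV1, map_sum, _root_.sum_apply]
      refine Finset.sum_congr rfl fun m _ => ?_
      rw [map_smul, _root_.smul_apply, smul_eq_mul]
    rw [hT, hT, hT, ← Finset.sum_sub_distrib, ← Finset.sum_sub_distrib, Finset.mul_sum,
      Finset.sum_mul, Finset.mul_sum]
    refine Finset.sum_congr rfl fun m _ => ?_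
    change _ * w n = _
    field_simp
  have hC : ∀ a b, |∑ n, 1 / 2 * (fderiv ℝ (H a b) z.1 (e n) - fderiv ℝ (H n b) z.1 (e a)
          - fderiv ℝ (H a n) z.1 (e b)) *
            ∑ j, (fderiv ℝ (G n j) z.1 V.1 * z.2 j + G n j z.1 * V.2 j)| ≤
        6 * N 1 * d ^ 2 * ε := fun a b => by
    have hV1 : ‖V.1‖ ≤ N 1 := norm_gradXi_hamiltonian_le hN h hε z
    have hV2 : ‖V.2‖ ≤ N 1 * ε := (norm_neg _).trans_le (norm_gradX_hamiltonian_le hN h hε0 hε z)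
    have h1 : ∀ n j, |fderiv ℝ (G n j) z.1 V.1 * z.2 j + G n j z.1 * V.2 j| ≤
        ε * N 1 * 2 + 2 * (N 1 * ε) := fun n j => by
      refine (abs_add_le _ _).trans (add_le_add ?_ ?_)
      · rw [abs_mul]
        refine mul_le_mul ?_ ((abs_coord_le _ _).trans hz.2.le) (abs_nonneg _) (by positivity)
        exact ((fderiv ℝ (G n j) z.1).le_opNorm _).trans
          (mul_le_mul (h.fderiv_inv_le n j _) hV1 (norm_nonneg _) hε0)
      · rw [abs_mul]
        exact mul_le_mul (h.abs_apply_le hε1 n j _) ((abs_coord_le _ _).trans hV2) (abs_nonneg _)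
          zero_le_two
    have h2 : ∀ n, |∑ j, (fderiv ℝ (G n j) z.1 V.1 * z.2 j + G n j z.1 * V.2 j)| ≤
        4 * d * N 1 := fun n => by
      refine (Finset.abs_sum_le_sum_abs _ _).trans
        ((Finset.sum_le_sum fun j _ => h1 n j).trans ?_)
      rw [Finset.sum_const, Finset.card_univ, Fintype.card_fin, nsmul_eq_mul]
      have : ε * N 1 ≤ 1 * N 1 := by gcongr
      have hd : (0 : ℝ) ≤ d := by positivity
      nlinarith
    have h3 : ∀ n, |1 / 2 * (fderiv ℝ (H a b) z.1 (e n) - fderiv ℝ (H n b) z.1 (e a)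
          - fderiv ℝ (H a n) z.1 (e b)) *
            ∑ j, (fderiv ℝ (G n j) z.1 V.1 * z.2 j + G n j z.1 * V.2 j)| ≤
        3 / 2 * ε * (4 * d * N 1) := fun n => by
      rw [abs_mul]
      exact mul_le_mul (h.abs_christoffel_le a b n _) (h2 n) (abs_nonneg _) (by positivity)
    refine (Finset.abs_sum_le_sum_abs _ _).trans ((Finset.sum_le_sum fun n _ => h3 n).trans_eq ?_)
    simp; ring
  -- Each of the two summands alone contains Hessians of `H` with no uniform bound; only their sum
  -- is a curvature contraction and small.
  have hD : ∀ a b, |1 / (2 * q) * (∑ k, ∑ n, w k * w n * hh k n b a +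
      ∑ n, ∑ m, (hh a b m n - hh n b m a - hh a n m b) * w m * w n)| ≤ 24 * d ^ 4 * ε :=
    fun a b => by
    have h1 := abs_curvature_sum_le (h := hh) (ε := ε) hsymm (fun i j k l => by
      have := h.curvature i j k l z.1
      convert this using 2) hw a b
    rw [abs_mul, abs_of_pos (by positivity : 0 < 1 / (2 * q))]
    refine (mul_le_mul hqi h1 (abs_nonneg _) (by norm_num)).trans_eq ?_
    ring
  have hE : |∑ i, ∑ j, (fderiv ℝ (fderiv ℝ (G i j)) z.1 u v + ∑ k, ∑ n,
      G i k z.1 * G n j z.1 * fderiv ℝ (fderiv ℝ (H k n)) z.1 u v) * z.2 i * z.2 j| ≤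
      4 * d ^ 2 * ε * (‖u‖ * ‖v‖) := by
    have h1 : ∀ i j, |(fderiv ℝ (fderiv ℝ (G i j)) z.1 u v + ∑ k, ∑ n,
        G i k z.1 * G n j z.1 * fderiv ℝ (fderiv ℝ (H k n)) z.1 u v) * z.2 i * z.2 j| ≤
        ε * (‖u‖ * ‖v‖) * 2 * 2 := fun i j => by
      rw [abs_mul, abs_mul]
      have := (abs_coord_le z.2 i).trans hz.2.le
      have := (abs_coord_le z.2 j).trans hz.2.le
      gcongr
      exact h.second i j z.1 u v
    refine (Finset.abs_sum_le_sum_abs _ _).trans ((Finset.sum_le_sum fun i _ =>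
      (Finset.abs_sum_le_sum_abs _ _).trans (Finset.sum_le_sum fun j _ => h1 i j)).trans_eq ?_)
    simp; ring
  have hF : |fderiv ℝ (fderiv ℝ profile) (coeff G z.1, z.2) (fderiv ℝ (coeff G) z.1 u, 0)
        (fderiv ℝ (coeff G) z.1 v, 0)| ≤ N 2 * ε * (‖u‖ * ‖v‖) := by
    have h1 : ∀ u, ‖((fderiv ℝ (coeff G) z.1 u, 0) : (Fin d → Fin d → ℝ) × E d)‖ ≤ ε * ‖u‖ :=
      fun u => by
      rw [Prod.norm_def, norm_zero]
      exact max_le ((fderiv ℝ (coeff G) z.1).le_of_opNorm_le (h.norm_fderiv_coeff_le hε0 _) u)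
        (by positivity)
    refine (norm_fderiv_fderiv_profile_le hN h hε _ _ _ _).trans ?_
    calc _ ≤ N 2 * ((ε * ‖u‖) * (ε * ‖v‖)) := by
          gcongr
          exacts [h1 u, h1 v]
      _ = N 2 * ε * (‖u‖ * ‖v‖) * ε := by ring
      _ ≤ N 2 * ε * (‖u‖ * ‖v‖) * 1 := by gcongr
      _ = _ := mul_one _
  have hS : inner ℝ ((fderiv ℝ (hamField (hamiltonian G)) z (u, 0)).2 +
      fderiv ℝ (correction G H) z V u) v =
      -fderiv ℝ (fderiv ℝ profile) (coeff G z.1, z.2) (fderiv ℝ (coeff G) z.1 u, 0)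
        (fderiv ℝ (coeff G) z.1 v, 0)
      - 1 / (2 * q) * ∑ i, ∑ j, (fderiv ℝ (fderiv ℝ (G i j)) z.1 u v + ∑ k, ∑ n,
          G i k z.1 * G n j z.1 * fderiv ℝ (fderiv ℝ (H k n)) z.1 u v) * z.2 i * z.2 j
      + ∑ a, ∑ b, (1 / (2 * q) * (∑ k, ∑ n, w k * w n * hh k n b a +
          ∑ n, ∑ m, (hh a b m n - hh n b m a - hh a n m b) * w m * w n)) * (u b * v a)
      + ∑ a, ∑ b, (∑ n, 1 / 2 * (fderiv ℝ (H a b) z.1 (e n) - fderiv ℝ (H n b) z.1 (e a)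
          - fderiv ℝ (H a n) z.1 (e b)) *
            ∑ j, (fderiv ℝ (G n j) z.1 V.1 * z.2 j + G n j z.1 * V.2 j)) * (u b * v a) := by
    rw [inner_add_left, hA, inner_fderiv_correction h.smooth_inv h.smooth]
    simp only [hB, add_mul, mul_add, Finset.sum_add_distrib]
    ring
  rw [hS]
  have hCs := abs_sum_sum_mul_le hC u v
  have hDs := abs_sum_sum_mul_le hD u v
  have hE' : |1 / (2 * q) * ∑ i, ∑ j, (fderiv ℝ (fderiv ℝ (G i j)) z.1 u v + ∑ k, ∑ n,
      G i k z.1 * G n j z.1 * fderiv ℝ (fderiv ℝ (H k n)) z.1 u v) * z.2 i * z.2 j| ≤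
      6 * d ^ 2 * ε * (‖u‖ * ‖v‖) := by
    rw [abs_mul, abs_of_pos (by positivity : 0 < 1 / (2 * q))]
    refine (mul_le_mul hqi hE (abs_nonneg _) (by norm_num)).trans_eq ?_
    ring
  refine (abs_add_le _ _).trans ((add_le_add ((abs_add_le _ _).trans (add_le_add
    ((abs_sub _ _).trans (add_le_add ((abs_neg _).trans_le hF) hE')) hDs)) hCs).trans_eq ?_)
  ring

end RegularCoefficients

end Verification

end EikonalBounds

/-! ### Scaled derivative bounds and the choice of the smallness constant. -/

namespace EikonalBounds

section Verification

open Set Filter Topology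

variable {d : ℕ}

namespace RegularCoefficients

variable {G H : Fin d → Fin d → E d → ℝ} {ε r : ℝ} {B : ℕ → ℝ} {N : ℕ → ℝ}

theorem norm_fderiv_fderiv_coeff_le (h : RegularCoefficients G H ε r B) (hr : 0 < r) (x u v : E d) :
    ‖fderiv ℝ (fderiv ℝ (coeff G)) x u v‖ ≤ |B 2| / r * (‖u‖ * ‖v‖) := by
  have h0 : 0 ≤ |B 2| / r * (‖u‖ * ‖v‖) := by positivity
  refine (pi_norm_le_iff_of_nonneg h0).2 fun i => (pi_norm_le_iff_of_nonneg h0).2 fun j => ?_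
  rw [fderiv_fderiv_coeff h.smooth_inv]
  have h1 := norm_fderiv_fderiv_le (fun y => G i j (r • y)) (r⁻¹ • x) u v
  rw [fderiv_fderiv_comp_dilation (h.smooth_inv i j), smul_inv_smul₀ hr.ne', _root_.smul_apply,
    _root_.smul_apply, norm_smul, Real.norm_of_nonneg (sq_nonneg r)] at h1
  have h2 := (h.scaled_le 2 (by norm_num) i j (r⁻¹ • x)).trans
    (mul_le_mul_of_nonneg_right (le_abs_self _) hr.le)
  have h3 := h1.trans (mul_le_mul_of_nonneg_right h2 (by positivity))
  rw [div_mul_eq_mul_div, le_div_iff₀ hr]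
  refine le_of_mul_le_mul_left ?_ hr
  calc _ = r ^ 2 * ‖fderiv ℝ (fderiv ℝ (G i j)) x u v‖ := by ring
    _ ≤ _ := h3
    _ = _ := by ring

/-- The constant contains `1 / r` and is not uniform. It serves only the existence, uniqueness and
smoothness of the flow and enters no estimate. -/
theorem exists_lipschitzWith_hamField (hN : ∀ n, ∀ p : (Fin d → Fin d → ℝ) × E d,
    p.1 ∈ Metric.closedBall (idCoeff d) (coeffRadius d) → ‖iteratedFDeriv ℝ n profile p‖ ≤ N n)
    (h : RegularCoefficients G H ε r B) (hε0 : 0 ≤ ε) (hε : ε ≤ coeffRadius d) (hε1 : ε ≤ 1)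
    (hr : 0 < r) : ∃ K : NNReal, LipschitzWith K (hamField (hamiltonian G)) := by
  have hN1 : 0 ≤ N 1 := (norm_nonneg _).trans (hN 1 (idCoeff d, 0)
    (Metric.mem_closedBall_self coeffRadius_pos.le))
  have hN2 : 0 ≤ N 2 := (norm_nonneg _).trans (hN 2 (idCoeff d, 0)
    (Metric.mem_closedBall_self coeffRadius_pos.le))
  let C : NNReal := ⟨N 2 + N 1 * (|B 2| / r), by positivity⟩
  have hDF : ∀ z a : E d × E d, ‖((fderiv ℝ (coeff G) z.1 a.1, a.2) : (Fin d → Fin d → ℝ) × E d)‖ ≤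
      ‖a‖ := fun z a => by
    rw [Prod.norm_def]
    refine max_le ?_ (norm_snd_le a)
    refine ((fderiv ℝ (coeff G) z.1).le_of_opNorm_le
      ((h.norm_fderiv_coeff_le hε0 z.1).trans hε1) a.1).trans ?_
    rw [one_mul]
    exact norm_fst_le a
  have h2 : ∀ z a b, ‖fderiv ℝ (fderiv ℝ (hamiltonian G)) z a b‖ ≤ C * ‖a‖ * ‖b‖ := fun z a b => by
    rw [fderiv_fderiv_hamiltonian h.smooth_inv]
    refine (norm_add_le _ _).trans ?_
    change _ ≤ (N 2 + N 1 * (|B 2| / r)) * ‖a‖ * ‖b‖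
    have e1 : (N 2 + N 1 * (|B 2| / r)) * ‖a‖ * ‖b‖ =
        N 2 * (‖a‖ * ‖b‖) + N 1 * (|B 2| / r * (‖a‖ * ‖b‖)) := by ring
    rw [e1]
    refine add_le_add ((norm_fderiv_fderiv_profile_le hN h hε _ _ _ _).trans ?_)
      ((norm_fderiv_profile_le hN h hε _ _ _).trans (mul_le_mul_of_nonneg_left ?_ hN1))
    · gcongr
      exacts [hDF z a, hDF z b]
    · rw [Prod.norm_def, norm_zero]
      refine max_le ((h.norm_fderiv_fderiv_coeff_le hr _ _ _).trans ?_) (by positivity)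
      gcongr
      exacts [norm_fst_le a, norm_fst_le b]
  have hs : Differentiable ℝ (fderiv ℝ (hamiltonian G)) :=
    ((contDiff_hamiltonian h.smooth_inv).fderiv_right (m := ∞) (by simp)).differentiable (by simp)
  have hl : LipschitzWith C (fderiv ℝ (hamiltonian G)) :=
    lipschitzWith_of_nnnorm_fderiv_le hs fun z =>
      ContinuousLinearMap.opNorm_le_bound _ C.2 fun a =>
        ContinuousLinearMap.opNorm_le_bound _ (mul_nonneg C.2 (norm_nonneg _)) fun b => h2 z a b
  refine ⟨C, LipschitzWith.of_dist_le_mul fun z z' => ?_⟩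
  refine le_trans ?_ (hl.dist_le_mul z z')
  rw [Prod.dist_eq, dist_eq_norm, dist_eq_norm, dist_eq_norm]
  set D := fderiv ℝ (hamiltonian G) z - fderiv ℝ (hamiltonian G) z' with hD
  refine max_le (norm_le_of_abs_inner_le (norm_nonneg D) fun v => ?_)
    (norm_le_of_abs_inner_le (norm_nonneg D) fun v => ?_)
  · rw [inner_sub_left]
    change |inner ℝ (gradXi _ z) v - inner ℝ (gradXi _ z') v| ≤ _
    rw [inner_gradXi, inner_gradXi, ← _root_.sub_apply]
    refine (D.le_opNorm _).trans_eq ?_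
    rw [Prod.norm_def, norm_zero, max_eq_right (norm_nonneg _)]
  · rw [inner_sub_left]
    change |inner ℝ (-gradX _ z) v - inner ℝ (-gradX _ z') v| ≤ _
    rw [inner_neg_left, inner_neg_left, inner_gradX, inner_gradX, ← neg_sub', abs_neg,
      ← _root_.sub_apply]
    refine (D.le_opNorm _).trans_eq ?_
    rw [Prod.norm_def, norm_zero, max_eq_left (norm_nonneg _)]

theorem norm_fderiv_scaled_le (h : RegularCoefficients G H ε r B) {δ : ℝ} (hr : 0 < r) (hδ : r ≤ δ)
    (z : E d × E d) : ‖fderiv ℝ (liftMap (Y := E d) (coeff fun i j y => G i j (r • y)) δ) z‖ ≤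
      (1 + |B 1|) * δ := by
  have hs : ∀ i j, ContDiff ℝ ∞ fun y => G i j (r • y) := fun i j =>
    (h.smooth_inv i j).comp (contDiff_id.const_smul r)
  have hδ0 : 0 ≤ δ := hr.le.trans hδ
  have h0 : 0 ≤ |B 1| := abs_nonneg _
  refine norm_fderiv_liftMap_le ((contDiff_coeff hs).differentiable (by simp)) hδ0 (by nlinarith) z ?_
  rw [← norm_iteratedFDeriv_one]
  refine norm_iteratedFDeriv_coeff_le hs (by positivity) fun i j =>
    (h.scaled_le 1 le_rfl i j z.1).trans ?_
  calc B 1 * r ≤ |B 1| * δ := mul_le_mul (le_abs_self _) hδ hr.le h0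
    _ ≤ _ := by nlinarith

/-- If one direction has no position component, the term with second derivatives of the coefficients
drops out, and two first derivatives of size `δ` remain. -/
theorem second_scaled_le (hN : ∀ n, ∀ p : (Fin d → Fin d → ℝ) × E d,
    p.1 ∈ Metric.closedBall (idCoeff d) (coeffRadius d) → ‖iteratedFDeriv ℝ n profile p‖ ≤ N n)
    (h : RegularCoefficients G H ε r B) (hε : ε ≤ coeffRadius d) {δ : ℝ} (hr : 0 < r) (hδ : r ≤ δ)
    (z a b : E d × E d) (hab : a.1 = 0 ∨ b.1 = 0) :
    ‖fderiv ℝ (fderiv ℝ (hamiltonian G ∘ scale d r δ)) z a b‖ ≤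
      N 2 * (1 + |B 1|) ^ 2 * δ ^ 2 * (‖a‖ * ‖b‖) := by
  have hs : ∀ i j, ContDiff ℝ ∞ fun y => G i j (r • y) := fun i j =>
    (h.smooth_inv i j).comp (contDiff_id.const_smul r)
  have hN2 : 0 ≤ N 2 := (norm_nonneg _).trans (hN 2 (idCoeff d, 0)
    (Metric.mem_closedBall_self coeffRadius_pos.le))
  have hδ0 : 0 ≤ δ := hr.le.trans hδ
  rw [hamiltonian_comp_scale, fderiv_fderiv_comp contDiff_profile
    (contDiff_liftMap (contDiff_coeff hs) δ), fderiv_fderiv_liftMap (contDiff_coeff hs)]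
  have e1 : fderiv ℝ (fderiv ℝ (coeff fun i j y => G i j (r • y))) z.1 a.1 b.1 = 0 := by
    rcases hab with h | h <;> simp [h]
  rw [e1, Prod.mk_zero_zero, map_zero, add_zero]
  refine (norm_fderiv_fderiv_profile_le hN h hε (r • z.1) (δ • z.2) _ _).trans ?_
  have h1 := fun w => (fderiv ℝ (liftMap (Y := E d) (coeff fun i j y => G i j (r • y)) δ) z).le_of_opNorm_le
    (h.norm_fderiv_scaled_le hr hδ z) w
  calc _ ≤ N 2 * (((1 + |B 1|) * δ * ‖a‖) * ((1 + |B 1|) * δ * ‖b‖)) := by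
        gcongr
        exacts [h1 a, h1 b]
    _ = _ := by ring

/-- The first two derivatives of the inner map are of size `δ`, using `r ≤ δ`, and those of order at
least three of size `r² ≤ δ²`. This is the situation of `norm_iteratedFDeriv_comp_le_sq`. -/
theorem higher_scaled_le (hN : ∀ n, ∀ p : (Fin d → Fin d → ℝ) × E d,
    p.1 ∈ Metric.closedBall (idCoeff d) (coeffRadius d) → ‖iteratedFDeriv ℝ n profile p‖ ≤ N n)
    (h : RegularCoefficients G H ε r B) (hε : ε ≤ coeffRadius d) {δ : ℝ} (hr : 0 < r) (hδ : r ≤ δ)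
    (hδ1 : δ ≤ 1) {n : ℕ} (hn : 3 ≤ n) (z : E d × E d) :
    ‖iteratedFDeriv ℝ n (hamiltonian G ∘ scale d r δ) z‖ ≤
      Fintype.card (OrderedFinpartition n) * ((∑ m ∈ Finset.range (n + 1), |N m|) *
        (1 + ∑ m ∈ Finset.range (n + 1), |B m|) ^ n) * δ ^ 2 := by
  have hs : ∀ i j, ContDiff ℝ ∞ fun y => G i j (r • y) := fun i j =>
    (h.smooth_inv i j).comp (contDiff_id.const_smul r)
  have hδ0 : 0 ≤ δ := hr.le.trans hδ
  have hsum : ∀ (f : ℕ → ℝ) m, m ≤ n → |f m| ≤ ∑ m ∈ Finset.range (n + 1), |f m| := fun f m hm =>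
    Finset.single_le_sum (f := fun m => |f m|) (fun _ _ => abs_nonneg _)
      (Finset.mem_range.2 (by omega))
  have hB0 : 0 ≤ ∑ m ∈ Finset.range (n + 1), |B m| := Finset.sum_nonneg fun _ _ => abs_nonneg _
  have hmem : coeff (fun i j y => G i j (r • y)) z.1 ∈
      Metric.closedBall (idCoeff d) (coeffRadius d) := h.coeff_mem hε (r • z.1)
  rw [hamiltonian_comp_scale]
  set f : E d × E d → (Fin d → Fin d → ℝ) × E d := liftMap (coeff fun i j y => G i j (r • y)) δ
    with hf
  have hfs : ContDiff ℝ ∞ f := contDiff_liftMap (contDiff_coeff hs) δ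
  have hfz : (f z).1 ∈ Metric.closedBall (idCoeff d) (coeffRadius d) := hmem
  refine (norm_iteratedFDeriv_comp_le_sq (g := profile) (f := f) contDiff_profile.contDiffAt
    hfs.contDiffAt hn
    (K := ∑ m ∈ Finset.range (n + 1), |N m|) (B := 1 + ∑ m ∈ Finset.range (n + 1), |B m|)
    (by linarith) hδ0 hδ1 (fun m hm => ?_) (fun m hm1 hm2 => ?_) fun m hm1 hm2 => ?_).trans_eq ?_
  · exact (hN m (f z) hfz).trans ((le_abs_self _).trans (hsum N m hm))
  · rcases Nat.lt_or_ge m 2 with hm | hm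
    · obtain rfl : m = 1 := by omega
      rw [norm_iteratedFDeriv_one]
      refine (h.norm_fderiv_scaled_le hr hδ z).trans ?_
      gcongr
      exact hsum B 1 (by omega)
    · obtain rfl : m = 2 := by omega
      refine (norm_iteratedFDeriv_liftMap_le (contDiff_coeff hs) le_rfl z).trans ?_
      refine norm_iteratedFDeriv_coeff_le hs (by positivity) fun i j =>
        (h.scaled_le 2 (by norm_num) i j z.1).trans ?_
      have := hsum B 2 (by omega)
      exact mul_le_mul ((le_abs_self _).trans (by linarith)) hδ hr.le (by positivity)
  · refine (norm_iteratedFDeriv_liftMap_le (contDiff_coeff hs) (by omega) z).trans ?_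
    refine norm_iteratedFDeriv_coeff_le hs (by positivity) fun i j =>
      (h.scaled_le_sq m hm1 i j z.1).trans ?_
    have := hsum B m hm2
    exact mul_le_mul ((le_abs_self _).trans (by linarith)) (pow_le_pow_left₀ hr.le hδ 2)
      (by positivity) (by positivity)
  · ring

end RegularCoefficients

/-- Small regular coefficients define a regularized Hamiltonian. -/
theorem exists_isRegularized (d : ℕ) (B : ℕ → ℝ) : ∃ (Λ : ℝ) (K : ℕ → ℝ) (ε₁ : ℝ), 0 < ε₁ ∧
    ε₁ ≤ coeffRadius d ∧
    ∀ {G H : Fin d → Fin d → E d → ℝ} {ε r : ℝ}, 0 ≤ ε → ε ≤ ε₁ → 0 < r →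
      RegularCoefficients G H ε r B → ∃ M ε', IsRegularized (hamiltonian G) M ε' Λ r K := by
  obtain ⟨N, hN⟩ := exists_bound_profile d
  have hN0 : ∀ n, 0 ≤ N n := fun n => (norm_nonneg _).trans (hN n (idCoeff d, 0)
    (Metric.mem_closedBall_self coeffRadius_pos.le))
  have hN1 := hN0 1
  have hN2 := hN0 2
  set Λ := max 1 (N 2) with hΛ
  have hΛ1 : 1 ≤ Λ := le_max_left _ _
  have hv0 : 0 < varConst Λ := by unfold varConst; positivity
  set C : ℝ := N 1 + N 2 + 6 * d ^ 4 + (N 2 + 6 * d ^ 2 + 24 * d ^ 6 + 6 * N 1 * d ^ 4) with hC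
  have hC0 : 0 ≤ C := by positivity
  have hr1 : coeffRadius d ≤ 1 := by
    unfold coeffRadius
    rw [div_le_one (by positivity)]
    nlinarith [sq_nonneg (d : ℝ)]
  refine ⟨Λ, fun n => N 2 * (1 + |B 1|) ^ 2 + Fintype.card (OrderedFinpartition n) *
    ((∑ m ∈ Finset.range (n + 1), |N m|) * (1 + ∑ m ∈ Finset.range (n + 1), |B m|) ^ n),
    -- The second entry makes both `C * ε` and `varConst Λ * (C * ε)` at most 1/16, and the
    -- smallness parameter of the Hamiltonian is `C * ε`.
    min (coeffRadius d) (1 / (16 * ((C + 1) * (varConst Λ + 1)))),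
    lt_min coeffRadius_pos (by positivity), min_le_left _ _, ?_⟩
  intro G H ε r hε0 hε₁ hr h
  have hε : ε ≤ coeffRadius d := hε₁.trans (min_le_left _ _)
  have hε1 : ε ≤ 1 := hε.trans hr1
  have hsmall : (C + 1) * (varConst Λ + 1) * ε ≤ 1 / 16 := by
    have := hε₁.trans (min_le_right _ _)
    rw [le_div_iff₀ (by positivity)] at this
    linarith
  have hCε : 0 ≤ C * ε := by positivity
  have hvCε : 0 ≤ varConst Λ * (C * ε) := by positivity
  have hvε : 0 ≤ varConst Λ * ε := by positivity
  have hle : ∀ a, a ≤ C → a * ε ≤ C * ε := fun a ha => mul_le_mul_of_nonneg_right ha hε0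
  have hX : 0 ≤ N 2 + 6 * d ^ 2 + 24 * d ^ 6 + 6 * N 1 * d ^ 4 := by positivity
  have hX4 : 0 ≤ 6 * (d : ℝ) ^ 4 := by positivity
  have hq := contDiff_hamiltonian h.smooth_inv
  have hDF : ∀ (z : E d × E d) u,
      ‖((fderiv ℝ (coeff G) z.1 u, 0) : (Fin d → Fin d → ℝ) × E d)‖ ≤ ε * ‖u‖ := fun z u => by
    rw [Prod.norm_def, norm_zero]
    exact max_le ((fderiv ℝ (coeff G) z.1).le_of_opNorm_le (h.norm_fderiv_coeff_le hε0 _) u)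
      (by positivity)
  have hD0 : ∀ v, ‖((0, v) : (Fin d → Fin d → ℝ) × E d)‖ = ‖v‖ := fun v => by
    rw [Prod.norm_def, norm_zero, max_eq_right (norm_nonneg _)]
  have hP2 := fun z : E d × E d => h.norm_fderiv_fderiv_profile_le hN hε z.1 z.2
  refine ⟨correction G H, C * ε,
    { smooth := hq
      bounded := ⟨N 1, fun z => ?_⟩
      lipschitz := h.exists_lipschitzWith_hamField hN hε0 hε hε1 hr
      gradX_le := fun z => (h.norm_gradX_hamiltonian_le hN hε0 hε z).trans (hle _ (by linarith))
      homogeneous := fun z hz => h.inner_gradXi_hamiltonian hε hz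
      mixed₁ := fun z _ u => ?_
      pure₁ := fun z _ v => ?_
      mixed₂ := fun z _ v => ?_
      smoothM := fun z => (hasFDerivAt_correction h.smooth_inv h.smooth z).differentiableAt
      smallM := fun z hz => (h.norm_correction_le hε0 hε1 hz).trans (hle _ (by linarith))
      curvature := fun z hz u => (h.curvature_hamiltonian_le hN hε0 hε hε1 hz u).trans
        (mul_le_mul_of_nonneg_right (hle _ (by linarith)) (norm_nonneg _))
      eps_le := by nlinarith
      one_le := hΛ1
      varConst_mul_le := by nlinarith
      pos := hr
      second_le := fun δ hδ hδ1 z a b hab =>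
        (h.second_scaled_le hN hε hr hδ z a b hab).trans ?_
      higher_le := fun δ hδ hδ1 n hn z => (h.higher_scaled_le hN hε hr hδ hδ1 hn z).trans ?_ }⟩
  · rw [Prod.norm_def]
    refine max_le (h.norm_gradXi_hamiltonian_le hN hε z) ?_
    refine (norm_neg _).trans_le ((h.norm_gradX_hamiltonian_le hN hε0 hε z).trans ?_)
    exact mul_le_of_le_one_right hN1 hε1
  · refine norm_le_of_abs_inner_le (by positivity) fun v => ?_
    rw [inner_fderiv_hamField_fst hq, fderiv_fderiv_hamiltonian h.smooth_inv]
    simp only [map_zero, Prod.mk_zero_zero, add_zero]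
    refine (hP2 z _ _).trans ?_
    rw [hD0]
    calc _ ≤ N 2 * (ε * ‖u‖ * ‖v‖) := by gcongr; exact hDF z u
      _ = N 2 * ε * ‖u‖ * ‖v‖ := by ring
      _ ≤ _ := by
        gcongr ?_ * _ * _
        exact hle _ (by linarith)
  · refine norm_le_of_abs_inner_le (by positivity) fun v' => ?_
    rw [inner_fderiv_hamField_fst hq, fderiv_fderiv_hamiltonian h.smooth_inv]
    simp only [map_zero, Prod.mk_zero_zero, add_zero]
    refine (hP2 z _ _).trans ?_
    rw [hD0, hD0, ← mul_assoc]
    gcongr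
    exact le_max_right _ _
  · refine norm_le_of_abs_inner_le (by positivity) fun u => ?_
    rw [inner_fderiv_hamField_snd hq, fderiv_fderiv_hamiltonian h.smooth_inv, abs_neg]
    simp only [map_zero, _root_.zero_apply, Prod.mk_zero_zero, add_zero]
    refine (hP2 z _ _).trans ?_
    rw [hD0]
    calc _ ≤ N 2 * (‖v‖ * (ε * ‖u‖)) := by gcongr; exact hDF z u
      _ = N 2 * ε * ‖v‖ * ‖u‖ := by ring
      _ ≤ _ := by
        gcongr ?_ * _ * _
        exact hle _ (by linarith)
  · gcongr
    exact le_add_of_nonneg_right (by positivity)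
  · gcongr
    exact le_add_of_nonneg_left (by positivity)

end Verification

end EikonalBounds

namespace EikonalBounds

/-! ### The regularized symbol -/

section Symbol

open Set Filter Topology

variable {d : ℕ}

theorem quad_sub_quad {a : Fin d → Fin d → ℝ} (ha : ∀ i j, a i j = a j i) (ξ η : E d) :
    quad a ξ ξ - quad a η η = quad a (ξ - η) (ξ + η) := by
  have h1 : quad a ξ η = quad a η ξ := by
    unfold quad
    rw [Finset.sum_comm]
    exact Finset.sum_congr rfl fun i _ => Finset.sum_congr rfl fun j _ => by rw [ha j i]; ring
  have h2 : quad a (ξ - η) (ξ + η) = quad a ξ ξ + quad a ξ η - quad a η ξ - quad a η η := by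
    unfold quad
    simp only [← Finset.sum_sub_distrib, ← Finset.sum_add_distrib]
    refine Finset.sum_congr rfl fun i _ => Finset.sum_congr rfl fun j _ => ?_
    simp only [PiLp.sub_apply, PiLp.add_apply]
    ring
  rw [h2, h1]; ring

theorem half_norm_le_sqrt_quad {a : Fin d → Fin d → ℝ}
    (ha : a ∈ Metric.closedBall (idCoeff d) (coeffRadius d)) (ξ : E d) :
    1 / 2 * ‖ξ‖ ≤ √(quad a ξ ξ) := by
  refine Real.le_sqrt_of_sq_le ?_
  have := abs_le.1 (abs_quad_sub_le ha ξ)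
  nlinarith [sq_nonneg ‖ξ‖]

theorem RegularCoefficients.isSymbolOf {G H : Fin d → Fin d → E d → ℝ} {ε r : ℝ} {B : ℕ → ℝ}
    (h : RegularCoefficients G H ε r B) (hε : ε ≤ coeffRadius d) :
    IsSymbolOf (fun x ξ => √(quad (coeff G x) ξ ξ)) (hamiltonian G) := by
  have hr0 := (coeffRadius_pos (d := d)).le
  refine ⟨fun x ξ hx => ?_, fun c hc x ξ => ?_, ?_⟩
  · have := profile_of_mem_shell (h.coeff_mem hε x) hx
    rw [← this]
    simp [hamiltonian, liftMap]
  · have h1 : quad (coeff G x) (c • ξ) (c • ξ) = c ^ 2 * quad (coeff G x) ξ ξ := by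
      simp only [quad, Finset.mul_sum, PiLp.smul_apply, smul_eq_mul]
      exact Finset.sum_congr rfl fun i _ => Finset.sum_congr rfl fun j _ => by ring
    rw [h1, Real.sqrt_mul (sq_nonneg c), Real.sqrt_sq hc.le]
  · set A := ‖idCoeff d‖ + coeffRadius d with hA
    have hA0 : 0 ≤ A := by positivity
    refine ⟨2 * (d ^ 2 * A), by positivity, fun x ξ η => ?_⟩
    have hm := h.coeff_mem hε x
    have hn : ‖coeff G x‖ ≤ A := by
      have h1 := norm_le_norm_add_norm_sub' (coeff G x) (idCoeff d)
      rw [mem_closedBall_iff_norm] at hm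
      linarith
    have hξ := half_norm_le_sqrt_quad hm ξ
    have hη := half_norm_le_sqrt_quad hm η
    set s := √(quad (coeff G x) ξ ξ) with hs
    set t := √(quad (coeff G x) η η) with ht
    have hnn : ∀ ξ, 0 ≤ quad (coeff G x) ξ ξ := fun ξ => by
      have := abs_le.1 (abs_quad_sub_le hm ξ)
      nlinarith [sq_nonneg ‖ξ‖]
    -- The Lipschitz bound is the identity `√a - √b = (a - b) / (√a + √b)`: the difference of the
    -- forms factors by symmetry, and `|ξ + η|` is controlled by the sum of the roots.
    have h1 : (s - t) * (s + t) = quad (coeff G x) (ξ - η) (ξ + η) := by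
      rw [← quad_sub_quad (a := coeff G x) (fun i j => h.symm i j x)]
      have a1 : s ^ 2 = _ := Real.sq_sqrt (hnn ξ)
      have a2 : t ^ 2 = _ := Real.sq_sqrt (hnn η)
      rw [← a1, ← a2]
      ring
    have h2 := abs_quad_le (coeff G x) (ξ - η) (ξ + η)
    rw [← h1, abs_mul] at h2
    have hs0 : 0 ≤ s := Real.sqrt_nonneg _
    have ht0 : 0 ≤ t := Real.sqrt_nonneg _
    have hst : 0 ≤ s + t := by positivity
    rw [abs_of_nonneg hst] at h2
    rcases hst.eq_or_lt with h0 | h0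
    · have e1 : s = 0 := by linarith
      have e2 : t = 0 := by linarith
      rw [e1, e2, sub_zero, abs_zero]
      positivity
    · refine le_of_mul_le_mul_right (h2.trans ?_) h0
      have h3 : ‖ξ + η‖ ≤ 2 * (s + t) := (norm_add_le _ _).trans (by linarith)
      calc _ ≤ (d : ℝ) ^ 2 * A * (‖ξ - η‖ * (2 * (s + t))) := by gcongr
        _ = _ := by ring

/-- The substitution replacing `y` by `r • y`, with `r = 2^{-k/2}`, absorbs the normalizing factor
and brings the mollification to unit scale. -/
theorem mollifiedInverse_eq (χ : E d → ℝ) (g : E d → Matrix (Fin d) (Fin d) ℝ) (k : ℕ) {r : ℝ}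
    (hr : r⁻¹ = (2 : ℝ) ^ ((k : ℝ) / 2)) (x : E d) (i j : Fin d) :
    mollifiedInverse χ g k x i j = mollify χ (fun y => (g (r • y))⁻¹ i j) (r⁻¹ • x) := by
  have hs : 0 < r⁻¹ := by rw [hr]; positivity
  have hr0 : r ≠ 0 := (inv_pos.1 hs).ne'
  have h1 := Measure.integral_comp_smul (volume : Measure (E d))
    (fun y => (g (r • y))⁻¹ i j • χ (r⁻¹ • x - y)) r⁻¹
  rw [finrank_euclideanSpace_fin, abs_of_pos (by positivity), smul_eq_mul] at h1
  have h2 : (2 : ℝ) ^ ((k : ℝ) * d / 2) = r⁻¹ ^ d := by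
    rw [hr, ← Real.rpow_mul_natCast zero_le_two]
    congr 1; ring
  have h3 : ∫ y, χ ((2 : ℝ) ^ ((k : ℝ) / 2) • (x - y)) * (g y)⁻¹ i j =
      ∫ y, (g (r • r⁻¹ • y))⁻¹ i j • χ (r⁻¹ • x - r⁻¹ • y) := by
    refine integral_congr_ae (Eventually.of_forall fun y => ?_)
    simp only
    rw [smul_inv_smul₀ hr0, ← hr, smul_sub, smul_eq_mul, mul_comm]
  rw [mollifiedInverse, h2, h3, h1, mul_inv_cancel_left₀ (by positivity)]
  rfl

theorem symbol_eq (χ : E d → ℝ) (g : E d → Matrix (Fin d) (Fin d) ℝ) (k : ℕ) {r : ℝ}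
    (hr : r⁻¹ = (2 : ℝ) ^ ((k : ℝ) / 2)) :
    symbol χ g k = fun x ξ => √(quad (coeff (fun i j x =>
      mollify χ (fun y => (g (r • y))⁻¹ i j) (r⁻¹ • x)) x) ξ ξ) := by
  ext x ξ
  simp only [symbol, quad, coeff, mollifiedInverse_eq χ g k hr]

end Symbol

end EikonalBounds

/-! ### Assembly of the main theorem. -/

theorem theorem4p1 (d : ℕ) (χ : EikonalBounds.E d → ℝ) (hχ : EikonalBounds.IsMollifier χ) :
    ∃ c : ℝ, 0 < c ∧ ∃ C : ℕ → (Fin d → ℕ) → (Fin d → ℕ) → ℝ,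
      ∀ g : EikonalBounds.E d → Matrix (Fin d) (Fin d) ℝ, EikonalBounds.IsSmallMetric c g →
      ∀ k : ℕ, 1 ≤ k →
      ∃ φ : ℝ → EikonalBounds.E d → EikonalBounds.E d → ℝ,
        EikonalBounds.IsEikonalSolution (EikonalBounds.symbol χ g k) φ ∧
        (∀ ψ, EikonalBounds.IsEikonalSolution (EikonalBounds.symbol χ g k) ψ →
          ∀ t ∈ Set.Icc (0 : ℝ) 1, ∀ x η, η ≠ 0 → ψ t x η = φ t x η) ∧
        (∀ t ∈ Set.Icc (0 : ℝ) 1,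
          ContDiffOn ℝ ∞ (fun z : EikonalBounds.E d × EikonalBounds.E d => φ t z.1 z.2)
            (Set.univ ×ˢ {η | η ≠ 0})) ∧
        ∀ (j : ℕ) (α β : Fin d → ℕ), (2 ≤ ∑ i, α i ∨ 2 ≤ ∑ i, β i) →
          ∀ x η : EikonalBounds.E d, η ≠ 0 →
            (∀ t : ℝ, (2 : ℝ) ^ (-(k : ℝ)) ≤ t → t ≤ 1 →
              |(EikonalBounds.radialEta^[j]
                  (EikonalBounds.multiX β (EikonalBounds.multiEta α (φ t)))) x η|
                ≤ C j α β * (t ^ (1 / 2 : ℝ) * (2 : ℝ) ^ ((k : ℝ) / 2)) ^ (∑ i, α i)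
                  * (2 : ℝ) ^ ((k : ℝ) / 2 * (((∑ i, β i : ℕ) : ℝ) - 2))
                  * ‖η‖ ^ (1 - ((∑ i, α i : ℕ) : ℝ))) ∧
            (∀ t : ℝ, 0 ≤ t → t ≤ (2 : ℝ) ^ (-(k : ℝ)) →
              |(EikonalBounds.radialEta^[j]
                  (EikonalBounds.multiX β (EikonalBounds.multiEta α (φ t)))) x η|
                ≤ C j α β * (2 : ℝ) ^ ((k : ℝ) / 2 * (((∑ i, β i : ℕ) : ℝ) - 2))
                  * ‖η‖ ^ (1 - ((∑ i, α i : ℕ) : ℝ))) := by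
  obtain ⟨A, hA, B, hreg⟩ := EikonalBounds.exists_regularCoefficients hχ
  obtain ⟨Λ, K, ε₁, hε₁, hε₁', hham⟩ := EikonalBounds.exists_isRegularized d B
  obtain ⟨C, hC⟩ := EikonalBounds.exists_bound_solution d Λ K
  have hA0 : 0 < A := by linarith
  have hc : 0 < min 1 ε₁ / A := div_pos (lt_min one_pos hε₁) hA0
  have hAc : A * (min 1 ε₁ / A) = min 1 ε₁ := mul_div_cancel₀ _ hA0.ne'
  -- After multiplication by `A` this is at most 1, for the regularization of the metric, and at
  -- most `ε₁`, for the Hamiltonian.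
  refine ⟨min 1 ε₁ / A, hc, C, fun g hg k _ => ?_⟩
  set s : ℝ := (2 : ℝ) ^ ((k : ℝ) / 2) with hs
  have hs1 : 1 ≤ s := Real.one_le_rpow one_le_two (by positivity)
  have hs0 : 0 < s := by linarith
  have hs2 : s ^ 2 = (2 : ℝ) ^ (k : ℝ) := by
    rw [hs, ← Real.rpow_mul_natCast zero_le_two]; congr 1; push_cast; ring
  have hsk : (2 : ℝ) ^ (-(k : ℝ)) = s⁻¹ ^ 2 := by rw [Real.rpow_neg zero_le_two, ← hs2, inv_pow]
  have hr0 : 0 < s⁻¹ := by positivity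
  have hr1 : s⁻¹ ≤ 1 := inv_le_one_of_one_le₀ hs1
  have hG := hreg _ hc.le (by rw [hAc]; exact min_le_left _ _) g hg s⁻¹ hr0 hr1
  rw [hAc] at hG
  have hsmall : min 1 ε₁ ≤ ε₁ := min_le_right _ _
  obtain ⟨M, ε', hq⟩ := hham (by positivity) hsmall hr0 hG
  have hp := hG.isSymbolOf (hsmall.trans hε₁')
  rw [← EikonalBounds.symbol_eq χ g k (inv_inv s)] at hp
  have hpow : ∀ n : ℕ, (2 : ℝ) ^ ((k : ℝ) / 2 * ((n : ℝ) - 2)) = s⁻¹⁻¹ ^ n * s⁻¹ ^ 2 := fun n => by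
    rw [Real.rpow_mul zero_le_two, ← hs, Real.rpow_sub hs0, Real.rpow_natCast, inv_inv, inv_pow,
      div_eq_mul_inv]
    norm_cast
  refine ⟨_, hq.isEikonalSolution hp, fun ψ hψ t ht x η hη => hq.eq_solution hp hψ ht x hη,
    fun t ht z hz => (hq.isSmooth_solution (EikonalBounds.abs_lt_two_of_mem ht) z
      hz.2).contDiffWithinAt, fun j α β hαβ x η hη => ⟨fun t ht1 ht2 => ?_, fun t ht1 ht2 => ?_⟩⟩
  · rw [hsk] at ht1
    have ht0 : 0 ≤ t := (sq_nonneg _).trans ht1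
    -- For `t ≥ 2^{-k} = r²` the choice `τ = √t` is admissible and optimal: `τ / r` is then `t^{1/2}
    -- 2^{k/2}`.
    have h1 := hC hq hp j α β hαβ x η hη (√t) t (Real.le_sqrt_of_sq_le ht1)
      (Real.sqrt_le_one.2 ht2) ht0 (Real.sq_sqrt ht0).ge
    rw [hpow, ← Real.sqrt_eq_rpow]
    simpa [div_eq_mul_inv] using h1
  · rw [hsk] at ht2
    -- For `t ≤ r²` the smallest admissible value `τ = r` is used, and the factor `τ / r` is one.
    have h1 := hC hq hp j α β hαβ x η hη s⁻¹ t le_rfl hr1 ht1 ht2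
    rw [div_self hr0.ne', one_pow, mul_one] at h1
    rw [hpow]
    exact h1
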